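/- Let $\Bbbk$ be an integral domain of characteristic zero and let $A=A_{\bar 0}\oplus A_{\bar 1}$ be a locally unital $\Bbbk$-superalgebra with even orthogonal distinguished idempotents $I$, so $A=\bigoplus_{i,j\in I}jAi$. Let $\mathtt B=\bigsqcup_{i,j\in I}{}_j\mathtt B_i$ be a homogeneous $\Bbbk$-basis of $A$ with each ${}_j\mathtt B_i$ a finite basis of $jAi$, and put $\mathtt B_i=\bigsqcup_j{}_j\mathtt B_i$. Assume that $A$ is a Frobenius superalgebra: there are an even linear map $\operatorname{tr}:A\to\Bbbk$ and an even algebra automorphism $\psi$ of $A$ fixing every $i\in I$ such that $f\mapsto(g\mapsto\operatorname{tr}(fg))$ is an isomorphism of $A$-bimodules from $A$ to ${}^{\psi}(A^*)$, where $A^*=\bigoplus_{i,j}(jAi)^*$ carries the actions $(f\cdot\theta)(h)=(-1)^{\bar f\bar\theta+\bar f\bar h}\theta(hf)$ and $(\theta\cdot g)(h)=\theta(gh)$, and ${}^\psi$ means that the left action is twisted by $\psi$. For $b\in\mathtt B$ let $b^\vee\in A$ be the element with $\operatorname{tr}(b^\vee c)=\delta_{b,c}$ for all $c\in\mathtt B$.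 Let $n\ge 1$, and let $\mathfrak{gl}_n(A)$ be the Lie superalgebra of $n\times n$ matrices over $A$ with the graded commutator; $E_{r,s}^f$ denotes the matrix with $f$ in position $(r,s)$ and zeros elsewhere. Let $\mathrm{mod}\text{-}\mathfrak{gl}_n(A)$ be the category of right $\mathfrak{gl}_n(A)$-supermodules and all (not only parity preserving) homomorphisms; as $2$ need not be invertible in $\Bbbk$, it is part of the definition of a supermodule that $(mx)x=m(x^2)$ for odd $x$, where $x^2=\tfrac12[x,x]$ is the matrix square. Tensor products have the action $(m\otimes w)x=(-1)^{\bar x\bar w}mx\otimes w+m\otimes wx$. For $i\in I$ let ${}_iV=(iA)^{\oplus n}$ be the supermodule of row vectors, let $v_t^a$ be the row vector with $a\in iA$ in position $t$ and zeros elsewhere, and let $S^k_iV$ be the $k$-th homogeneous component of the quotient of the tensor algebra of ${}_iV$ by the two-sided ideal generated by $v\otimes w-(-1)^{\bar v\bar w}w\otimes v$ for homogeneous $v,w$ and by $v\otimes v$ for odd $v$. For $\mathbf g\in A^k$, $\mathbf r,\mathbf t\in[1,n]^k$ and a nonempty word $w=w_1\cdots w_l$ in distinct letters of $[1,k]$,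 put $$E^{\mathbf g}_{\mathbf r,\mathbf t}(w)=\delta_{t_{w_1},r_{w_2}}\cdots\delta_{t_{w_{l-1}},r_{w_l}}\,E^{g_{w_1}\cdots g_{w_l}}_{r_{w_1},t_{w_l}}.$$ Let $\mathrm{ord}_k^{\mathrm g}$ be the set of permutations $\mathbf u=u_1\cdots u_k$ of $[1,k]$ together with a grouping $\mathbf u^\bullet=\mathbf u^{(1)}|\cdots|\mathbf u^{(d)}$ into consecutive nonempty blocks such that the last entry of each block is smaller than all other entries of that block and the last entries of the blocks increase from left to right. For $\mathbf g$ with homogeneous entries put $$E^{\mathbf g}_{\mathbf r,\mathbf t}(\mathbf u^\bullet)=(-1)^{\sum_{x<y,\,u_x>u_y}\bar g_{u_x}\bar g_{u_y}}E^{\mathbf g}_{\mathbf r,\mathbf t}(\mathbf u^{(1)})\cdots E^{\mathbf g}_{\mathbf r,\mathbf t}(\mathbf u^{(d)}),$$ acting on supermodules from the right, the leftmost factor first. For $i\in I$ let $\mathcal C_i$ be the full subcategory of $\mathrm{mod}\text{-}\mathfrak{gl}_n(A)$ of those $M$ such that for all $m\in M$, $f\in iA$ and $r,s\in[1,n]$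 one has, for all but finitely many $j\in I$, $m\,E_{r,s}^{af}=0$ for all $a\in jAi$. If $jAi\ne0$ for only finitely many $j\in I$ (for example if $I$ is finite), then $\mathcal C_i$ is all of $\mathrm{mod}\text{-}\mathfrak{gl}_n(A)$. The functor $-\otimes S^k_iV$ restricts to an endofunctor of $\mathcal C_i$. **Theorem.** For all $i\in I$, $k\ge1$ and $M\in\mathcal C_i$ there is a unique $\Bbbk$-linear map $C_M^{i^{(k)}}:M\otimes S^k_iV\to M\otimes S^k_iV$ such that $$m\otimes v_{t_1}^{f_1}\cdots v_{t_k}^{f_k}\;\longmapsto\;\sum_{\mathbf b\in\mathtt B_i^k,\ \mathbf r\in[1,n]^k,\ \mathbf u^\bullet\in\mathrm{ord}_k^{\mathrm g}}(-1)^{\sum_{x\le y}\bar b_x\bar f_y}\;m\,E^{(b_1f_1,\dots,b_kf_k)}_{\mathbf r,\mathbf t}(\mathbf u^\bullet)\otimes v_{r_k}^{b_k^\vee}\cdots v_{r_1}^{b_1^\vee}$$ for all $m\in M$, all homogeneous $f_1,\dots,f_k\in iA$ and all $\mathbf t\in[1,n]^k$, where for only finitely many $\mathbf b$ there are $\mathbf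 r,\mathbf u^\bullet$ with $m\,E^{(b_1f_1,\dots,b_kf_k)}_{\mathbf r,\mathbf t}(\mathbf u^\bullet)\ne0$. The maps $C_M^{i^{(k)}}$ are even homomorphisms of $\mathfrak{gl}_n(A)$-supermodules and form an even supernatural transformation $-\otimes S^k_iV\to-\otimes S^k_iV$ of endofunctors of $\mathcal C_i$ (natural with respect to homomorphisms of any parity). -/

import Mathlib

open scoped TensorProduct
open CategoryTheory

universe u v w w₁ w₂

namespace ThickCasimir

/-! ### Signs and supermodules -/

/-- The sign `(-1)^s` of a parity `s ∈ ℤ/2`. -/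
def sgn (s : ZMod 2) : ℤ := if s = 0 then 1 else -1

/-- A `ℤ/2`-grading `M = M₀ ⊕ M₁` of a `k`-module, given by the projection of `M` onto its even part
`M₀` along its odd part `M₁` (so `M₀` is the range and `M₁` the kernel of an idempotent). -/
class SuperModule (k : Type u) (M : Type v) [CommRing k] [AddCommGroup M] [Module k M] where
  evenPart : M →ₗ[k] M
  evenPart_idem : ∀ m, evenPart (evenPart m) = evenPart m

section Super

variable (k : Type u) [CommRing k] {M : Type v} [AddCommGroup M] [Module k M] [SuperModule k M]

/-- The projection of a supermodule to its component of parity `s`. -/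
def proj (s : ZMod 2) : M →ₗ[k] M :=
  if s = 0 then SuperModule.evenPart else LinearMap.id - SuperModule.evenPart

/-- `m` is homogeneous of parity `s`. -/
def IsHomog (s : ZMod 2) (m : M) : Prop := proj k s m = m

variable {k}

theorem parity_cases (s : ZMod 2) : s = 0 ∨ s = 1 := by
  revert s; decide

theorem proj_proj (s t : ZMod 2) (m : M) :
    proj k s (proj k t m) = if s = t then proj k t m else 0 := by
  have h := SuperModule.evenPart_idem (k := k) (M := M)
  rcases parity_cases s with rfl | rfl <;> rcases parity_cases t with rfl | rfl <;>
    simp [proj, h]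

theorem isHomog_proj (s : ZMod 2) (m : M) : IsHomog k s (proj k s m) := by
  simp [IsHomog, proj_proj]

theorem proj_add_proj (m : M) : proj k 0 m + proj k 1 m = m := by
  simp [proj]

theorem IsHomog.proj_eq {s : ZMod 2} {m : M} (h : IsHomog k s m) (t : ZMod 2) :
    proj k t m = if t = s then m else 0 := by
  have h' : proj k s m = m := h
  rw [← h', proj_proj, h']

theorem IsHomog.add {s : ZMod 2} {m m' : M} (h : IsHomog k s m) (h' : IsHomog k s m') :
    IsHomog k s (m + m') := by
  unfold IsHomog at *; rw [map_add, h, h']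

theorem IsHomog.sub {s : ZMod 2} {m m' : M} (h : IsHomog k s m) (h' : IsHomog k s m') :
    IsHomog k s (m - m') := by
  unfold IsHomog at *; rw [map_sub, h, h']

theorem IsHomog.zsmul {s : ZMod 2} {m : M} (h : IsHomog k s m) (c : ℤ) :
    IsHomog k s (c • m) := by
  unfold IsHomog at *; rw [map_zsmul, h]

theorem isHomog_zero (s : ZMod 2) : IsHomog k s (0 : M) := by
  unfold IsHomog; rw [map_zero]

theorem isHomog_of_proj_zero {s : ZMod 2} {m : M} (h : ∀ t, t ≠ s → proj k t m = 0) :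
    IsHomog k s m := by
  have h2 := proj_add_proj (k := k) m
  unfold IsHomog
  rcases parity_cases s with rfl | rfl
  · have := h 1 (by decide)
    simpa [this] using h2
  · have := h 0 (by decide)
    simpa [this] using h2

end Super

theorem sgn_add (s t : ZMod 2) : sgn (s + t) = sgn s * sgn t := by
  revert s t; decide

theorem sgn_mul_self (s : ZMod 2) : sgn s * sgn s = 1 := by
  revert s; decide

/-! ### Locally unital Frobenius superalgebras -/

/-- An associative, not necessarily unital, `k`-superalgebra. -/
class Superalgebra (k : Type u) (A : Type v) [CommRing k] [NonUnitalRing A] [Module k A]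
    [IsScalarTower k A A] [SMulCommClass k A A] extends SuperModule k A where
  mul_homog : ∀ (s t : ZMod 2) (a b : A), IsHomog k s a → IsHomog k t b → IsHomog k (s + t) (a * b)

section Frobenius

variable (k : Type u) [CommRing k] {A : Type v} [NonUnitalRing A] [Module k A]
  [IsScalarTower k A A] [SMulCommClass k A A] {ι : Type w}

/-- The space `iA = {a | i a = a}`, for the distinguished idempotent `e i`. -/
def rightIdeal (e : ι → A) (i : ι) : Submodule k A where
  carrier := {a | e i * a = a}
  add_mem' := by
    intro a b ha hb
    simp only [Set.mem_ofPred_eq] at *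
    rw [mul_add, ha, hb]
  zero_mem' := by simp
  smul_mem' := by
    intro c a ha
    simp only [Set.mem_ofPred_eq] at *
    rw [mul_smul_comm, ha]

/-- The space `jAi`, for distinguished idempotents `e j`, `e i`. -/
def peirce (e : ι → A) (j i : ι) : Submodule k A where
  carrier := {a | e j * a = a ∧ a * e i = a}
  add_mem' := by
    rintro a b ⟨ha, ha'⟩ ⟨hb, hb'⟩
    exact ⟨by rw [mul_add, ha, hb], by rw [add_mul, ha', hb']⟩
  zero_mem' := by simp
  smul_mem' := by
    rintro c a ⟨ha, ha'⟩
    exact ⟨by rw [mul_smul_comm, ha], by rw [smul_mul_assoc, ha']⟩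

variable [Superalgebra k A]

/-- `A` is locally unital with distinguished even orthogonal idempotents `e i`:
`A = ⨁ jAi`. -/
structure LocallyUnital (e : ι → A) : Prop where
  even : ∀ i, IsHomog k 0 (e i)
  idem : ∀ i, e i * e i = e i
  orth : ∀ i j, i ≠ j → e i * e j = 0
  indep : iSupIndep fun p : ι × ι => peirce k e p.1 p.2
  span : ⨆ p : ι × ι, peirce k e p.1 p.2 = ⊤

/-- A homogeneous basis `B = ⨆ jBi` of a locally unital superalgebra, with every `jBi` finite
(so `A` is locally finite): every basis element has a parity and lies in one of the `jAi`. -/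
structure HomogBasis (e : ι → A) (β : Type w₁) where
  basis : Module.Basis β k A
  par : β → ZMod 2
  tgt : β → ι
  src : β → ι
  homog : ∀ b, IsHomog k (par b) (basis b)
  mem_peirce : ∀ b, basis b ∈ peirce k e (tgt b) (src b)
  finite : ∀ j i, {b | tgt b = j ∧ src b = i}.Finite

/-- An automorphism of a locally unital superalgebra: an even algebra automorphism which fixes the
distinguished idempotents. -/
structure LUAut (e : ι → A) extends A ≃ₗ[k] A where
  map_mul : ∀ a b, toFun (a * b) = toFun a * toFun b
  map_homog : ∀ s a, IsHomog k s a → IsHomog k s (toFun a)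
  map_e : ∀ i, toFun (e i) = e i

/-- The local dual `A^* = ⨁ (jAi)^*`: the functionals which vanish on all but finitely many
of the `jAi`. -/
def localDual (e : ι → A) : Submodule k (Module.Dual k A) where
  carrier := {θ | {p : ι × ι | ∃ a ∈ peirce k e p.1 p.2, θ a ≠ 0}.Finite}
  add_mem' := by
    intro θ η hθ hη
    refine (Set.Finite.union hθ hη).subset ?_
    rintro p ⟨a, ha, h⟩
    by_cases h1 : θ a = 0
    · refine Or.inr ⟨a, ha, fun h2 => h ?_⟩
      simp [h1, h2]
    · exact Or.inl ⟨a, ha, h1⟩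
  zero_mem' := by simp
  smul_mem' := by
    intro c θ hθ
    refine Set.Finite.subset hθ ?_
    rintro p ⟨a, ha, h⟩
    refine ⟨a, ha, fun h2 => h ?_⟩
    simp [h2]

/-- The map `f ↦ (g ↦ tr (f g))`. -/
def phi (tr : A →ₗ[k] k) : A →ₗ[k] Module.Dual k A := (LinearMap.mul k A).compr₂ tr

/-- A Frobenius structure: an even trace map `tr` and a Nakayama automorphism `ψ` such that
`phi tr` is an isomorphism of `A`-bimodules from `A` onto the `ψ`-twisted local dual `A^*`, whose
left action is `(c • θ) h = (-1)^(|c||θ| + |c||h|) θ (h c)` and whose right action is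
`(θ • c) h = θ (c h)`. (That `phi tr` preserves parities and the right action is automatic.) -/
structure FrobeniusStructure (e : ι → A) where
  tr : A →ₗ[k] k
  tr_even : ∀ a, IsHomog k 1 a → tr a = 0
  ψ : LUAut k e
  phi_mem : ∀ f, phi k tr f ∈ localDual k e
  phi_bij : Function.Bijective ((phi k tr).codRestrict (localDual k e) phi_mem)
  phi_left : ∀ (s t r : ZMod 2) (a f h : A), IsHomog k s a → IsHomog k t f → IsHomog k r h →
    phi k tr (a * f) h = sgn (s * t + s * r) • phi k tr f (h * ψ.toLinearEquiv a)

variable {k} {e : ι → A}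

theorem HomogBasis.coord_eq_zero (he : LocallyUnital k e) {β : Type w₁} (B : HomogBasis k e β)
    (b : β) {j i : ι} (h : ¬ (B.tgt b = j ∧ B.src b = i)) (x : A) :
    B.basis.coord b (e j * x * e i) = 0 := by
  have key : (B.basis.coord b) ∘ₗ ((LinearMap.mulRight k (e i)) ∘ₗ (LinearMap.mulLeft k (e j))) = 0 := by
    refine B.basis.ext fun c => ?_
    obtain ⟨h1, h2⟩ := B.mem_peirce c
    simp only [LinearMap.comp_apply, LinearMap.mulLeft_apply, LinearMap.mulRight_apply,
      LinearMap.zero_apply]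
    by_cases hj : B.tgt c = j
    · by_cases hi : B.src c = i
      · have hbc : c ≠ b := by rintro rfl; exact h ⟨hj, hi⟩
        subst hj hi
        rw [h1, h2]
        simp [hbc]
      · rw [← h2, mul_assoc, mul_assoc, he.orth _ _ hi]; simp
    · rw [← h1, ← mul_assoc, he.orth _ _ (Ne.symm hj)]; simp
  exact LinearMap.congr_fun key x

theorem HomogBasis.coord_mem (he : LocallyUnital k e) {β : Type w₁} (B : HomogBasis k e β)
    (b : β) : B.basis.coord b ∈ localDual k e := by
  refine Set.Finite.subset (Set.finite_singleton (B.tgt b, B.src b)) ?_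
  rintro ⟨j, i⟩ ⟨a, ⟨h1, h2⟩, h⟩
  by_contra hne
  refine h ?_
  have := B.coord_eq_zero he b (j := j) (i := i)
    (fun h' => hne (by simp [← h'.1, ← h'.2])) a
  simp only at h1 h2
  rwa [h1, h2] at this

/-- The (left) dual basis vector `b^∨ = (phi tr)⁻¹ (b^*)`, so that `tr (b^∨ c) = δ_{b,c}`. -/
noncomputable def FrobeniusStructure.dualVec (F : FrobeniusStructure k e) (he : LocallyUnital k e)
    {β : Type w₁} (B : HomogBasis k e β) (b : β) : A :=
  (LinearEquiv.ofBijective _ F.phi_bij).symm ⟨B.basis.coord b, B.coord_mem he b⟩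

theorem FrobeniusStructure.phi_dualVec (F : FrobeniusStructure k e) (he : LocallyUnital k e)
    {β : Type w₁} (B : HomogBasis k e β) (b : β) :
    phi k F.tr (F.dualVec he B b) = B.basis.coord b := by
  have := (LinearEquiv.ofBijective _ F.phi_bij).apply_symm_apply
    ⟨B.basis.coord b, B.coord_mem he b⟩
  exact congrArg Subtype.val this

theorem FrobeniusStructure.phi_e (F : FrobeniusStructure k e) (he : LocallyUnital k e) (i : ι)
    (f h : A) : phi k F.tr (e i * f) h = phi k F.tr f (h * e i) := by
  have key : ∀ s t : ZMod 2, phi k F.tr (e i * proj k s f) (proj k t h) =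
      phi k F.tr (proj k s f) (proj k t h * e i) := by
    intro s t
    have h1 : F.ψ.toLinearEquiv (e i) = e i := F.ψ.map_e i
    rw [F.phi_left 0 s t _ _ _ (he.even i) (isHomog_proj s f) (isHomog_proj t h), h1]
    simp [sgn]
  rw [← proj_add_proj (k := k) f, ← proj_add_proj (k := k) h]
  simp only [mul_add, add_mul, map_add, LinearMap.add_apply, key]

theorem FrobeniusStructure.dualVec_mem (F : FrobeniusStructure k e) (he : LocallyUnital k e)
    {β : Type w₁} (B : HomogBasis k e β) (b : β) :
    F.dualVec he B b ∈ rightIdeal k e (B.src b) := by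
  have hinj : Function.Injective (phi k F.tr) := by
    intro x y hxy
    exact F.phi_bij.1 (Subtype.ext hxy)
  refine hinj (LinearMap.ext fun h => ?_)
  rw [F.phi_e he, F.phi_dualVec he]
  have key : (B.basis.coord b) ∘ₗ (LinearMap.mulRight k (e (B.src b))) = B.basis.coord b := by
    refine B.basis.ext fun c => ?_
    obtain ⟨-, h2⟩ := B.mem_peirce c
    simp only [LinearMap.comp_apply, LinearMap.mulRight_apply]
    by_cases hi : B.src c = B.src b
    · rw [← hi, h2]
    · have hbc : c ≠ b := by rintro rfl; exact hi rfl
      rw [← h2, mul_assoc, he.orth _ _ hi, h2]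
      simp [hbc]
  exact LinearMap.congr_fun key h

end Frobenius

/-! ### The Lie superalgebra `gl_n(A)` and its right supermodules -/

section GLModules

variable (k : Type u) [CommRing k] {A : Type u} [NonUnitalRing A] [Module k A]
  [IsScalarTower k A A] [SMulCommClass k A A] [Superalgebra k A] {n : ℕ}

/-- The entrywise grading of `gl_n(A)`. -/
instance matrixSuper : SuperModule k (Matrix (Fin n) (Fin n) A) where
  evenPart := LinearMap.mapMatrix SuperModule.evenPart
  evenPart_idem := by
    intro m; ext i j; simp [SuperModule.evenPart_idem]

theorem proj_matrix (s : ZMod 2) (x : Matrix (Fin n) (Fin n) A) (i j : Fin n) :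
    proj k s x i j = proj k s (x i j) := by
  unfold proj
  split_ifs
  · rfl
  · rfl

theorem matrix_mul_homog {s t : ZMod 2} {x y : Matrix (Fin n) (Fin n) A} (hx : IsHomog k s x)
    (hy : IsHomog k t y) : IsHomog k (s + t) (x * y) := by
  unfold IsHomog
  ext i j
  rw [proj_matrix, Matrix.mul_apply, map_sum]
  refine Finset.sum_congr rfl fun l _ => ?_
  refine Superalgebra.mul_homog s t _ _ ?_ ?_
  · unfold IsHomog; rw [← proj_matrix, hx]
  · unfold IsHomog; rw [← proj_matrix, hy]

/-- The graded commutator on `gl_n(A)`: `[x, y] = x y - (-1)^(|x||y|) y x` for homogeneous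
`x`, `y`, extended bilinearly. -/
def superBracket (x y : Matrix (Fin n) (Fin n) A) : Matrix (Fin n) (Fin n) A :=
  ∑ s : ZMod 2, ∑ t : ZMod 2, (proj k s x * proj k t y - sgn (s * t) • (proj k t y * proj k s x))

variable {k}

theorem sum_parity {M : Type v} [AddCommMonoid M] (g : ZMod 2 → M) : ∑ s, g s = g 0 + g 1 :=
  Fin.sum_univ_two g

theorem superBracket_homog {s t : ZMod 2} {x y : Matrix (Fin n) (Fin n) A} (hx : IsHomog k s x)
    (hy : IsHomog k t y) : superBracket k x y = x * y - sgn (s * t) • (y * x) := by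
  unfold superBracket
  simp only [hx.proj_eq, hy.proj_eq, sum_parity]
  rcases parity_cases s with rfl | rfl <;> rcases parity_cases t with rfl | rfl <;> simp

theorem superBracket_isHomog {s t : ZMod 2} {x y : Matrix (Fin n) (Fin n) A}
    (hx : IsHomog k s x) (hy : IsHomog k t y) : IsHomog k (s + t) (superBracket k x y) := by
  rw [superBracket_homog hx hy]
  refine (matrix_mul_homog k hx hy).sub (IsHomog.zsmul ?_ _)
  rw [add_comm]
  exact matrix_mul_homog k hy hx

variable (k A n)

/-- A right `gl_n(A)`-supermodule; `act x m` is `m · x`. As `2` need not be invertible in `k`, the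
relation `x² = [x, x] / 2` of the universal enveloping superalgebra for odd `x` (here `[x, x] / 2` is
the matrix `x * x`) is required too; it follows from `act_bracket` when the module has no
`2`-torsion. -/
structure GlMod where
  carrier : Type w
  [grp : AddCommGroup carrier]
  [mod : Module k carrier]
  [super : SuperModule k carrier]
  act : Matrix (Fin n) (Fin n) A →ₗ[k] carrier →ₗ[k] carrier
  act_homog : ∀ s t x m, IsHomog k s x → IsHomog k t m → IsHomog k (s + t) (act x m)
  act_bracket : ∀ s t x y m, IsHomog k s x → IsHomog k t y →
    act (superBracket k x y) m = act y (act x m) - sgn (s * t) • act x (act y m)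
  act_odd_sq : ∀ x m, IsHomog k 1 x → act x (act x m) = act (x * x) m

attribute [instance] GlMod.grp GlMod.mod GlMod.super

variable {k A n}

namespace GlMod

/-- A homomorphism of right supermodules, of arbitrary parity. -/
@[ext] structure Hom (M : GlMod.{u, w₁} k A n) (N : GlMod.{u, w₂} k A n) where
  lin : M.carrier →ₗ[k] N.carrier
  map_act : ∀ x m, lin (M.act x m) = N.act x (lin m)

/-- The category `mod-gl_n(A)` (all homomorphisms, not only the even ones). -/
instance : Category (GlMod.{u, w} k A n) where
  Hom M N := Hom M N
  id M := ⟨LinearMap.id, fun _ _ => rfl⟩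
  comp f g := ⟨g.lin ∘ₗ f.lin, fun x m => by simp [f.map_act, g.map_act]⟩

/-- The linear map underlying a morphism of `mod-gl_n(A)`. -/
def linOf {M N : GlMod.{u, w} k A n} (f : M ⟶ N) : M.carrier →ₗ[k] N.carrier := Hom.lin f

/-- The trivial supermodule `k`. -/
def unit (k : Type u) [CommRing k] (A : Type u) [NonUnitalRing A] [Module k A]
    [IsScalarTower k A A] [SMulCommClass k A A] [Superalgebra k A] (n : ℕ) :
    GlMod.{u, u} k A n :=
  letI : SuperModule k k := ⟨LinearMap.id, fun _ => rfl⟩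
  { carrier := k
    act := 0
    act_homog := by
      intro s t x m _ _
      exact isHomog_zero _
    act_bracket := by intros; simp
    act_odd_sq := by intros; simp }

end GlMod

/-! ### Tensor products -/

/-- The grading of a tensor product: `(M ⊗ N)₀ = M₀ ⊗ N₀ ⊕ M₁ ⊗ N₁`. -/
instance tensorSuper (M : Type w₁) (N : Type w₂) [AddCommGroup M] [Module k M] [SuperModule k M]
    [AddCommGroup N] [Module k N] [SuperModule k N] : SuperModule k (M ⊗[k] N) where
  evenPart := TensorProduct.map (proj k 0) (proj k 0) + TensorProduct.map (proj k 1) (proj k 1)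
  evenPart_idem := by
    intro z
    induction z with
    | zero => simp
    | add x y hx hy => simp only [map_add, hx, hy]
    | tmul m n => simp [proj_proj]

section Tensor

variable {M : Type w₁} {N : Type w₂} [AddCommGroup M] [Module k M] [SuperModule k M]
    [AddCommGroup N] [Module k N] [SuperModule k N]

theorem isHomog_tmul {s t : ZMod 2} {m : M} {n : N} (hm : IsHomog k s m) (hn : IsHomog k t n) :
    IsHomog k (s + t) (m ⊗ₜ[k] n) := by
  have e : SuperModule.evenPart (k := k) (m ⊗ₜ[k] n) = if s = t then m ⊗ₜ n else 0 := by
    have e' : SuperModule.evenPart (k := k) (m ⊗ₜ[k] n) =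
      proj k 0 m ⊗ₜ proj k 0 n + proj k 1 m ⊗ₜ proj k 1 n := rfl
    rw [e', hm.proj_eq, hm.proj_eq, hn.proj_eq, hn.proj_eq]
    rcases parity_cases s with rfl | rfl <;> rcases parity_cases t with rfl | rfl <;> simp
  rcases parity_cases s with rfl | rfl <;> rcases parity_cases t with rfl | rfl <;>
    simp [IsHomog, proj, e, show (1 : ZMod 2) + 1 = 0 by decide]

theorem tmul_decomp (m : M) (n : N) :
    m ⊗ₜ[k] n = ∑ s : ZMod 2, ∑ t : ZMod 2, proj k s m ⊗ₜ[k] proj k t n := by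
  simp only [sum_parity]
  rw [← TensorProduct.tmul_add, ← TensorProduct.tmul_add, ← TensorProduct.add_tmul,
    proj_add_proj, proj_add_proj]

/-- Two linear maps on a tensor product which agree on homogeneous pure tensors are equal. -/
theorem tensor_ext_homog {P : Type v} [AddCommGroup P] [Module k P] {f g : M ⊗[k] N →ₗ[k] P}
    (h : ∀ s t m n, IsHomog k s m → IsHomog k t n → f (m ⊗ₜ n) = g (m ⊗ₜ n)) : f = g := by
  refine TensorProduct.ext' fun m n => ?_
  rw [tmul_decomp m n]
  simp only [map_sum]
  exact Finset.sum_congr rfl fun s _ => Finset.sum_congr rfl fun t _ =>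
    h s t _ _ (isHomog_proj _ _) (isHomog_proj _ _)

end Tensor

namespace GlMod

/-- The action of `gl_n(A)` on `M ⊗ N`:
`(m ⊗ n) x = (-1)^(|x||n|) m x ⊗ n + m ⊗ n x` for homogeneous `x`, `n`. -/
def tensorAct (M : GlMod.{u, w₁} k A n) (N : GlMod.{u, w₂} k A n) :
    Matrix (Fin n) (Fin n) A →ₗ[k] M.carrier ⊗[k] N.carrier →ₗ[k] M.carrier ⊗[k] N.carrier where
  toFun x := (∑ s : ZMod 2, ∑ t : ZMod 2,
      sgn (s * t) • TensorProduct.map (M.act (proj k s x)) (proj k t)) +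
    TensorProduct.map LinearMap.id (N.act x)
  map_add' x y := by
    simp only [map_add, TensorProduct.map_add_left, TensorProduct.map_add_right, smul_add,
      Finset.sum_add_distrib]
    abel
  map_smul' c x := by
    simp only [map_smul, TensorProduct.map_smul_left, TensorProduct.map_smul_right,
      RingHom.id_apply, smul_add, Finset.smul_sum]
    simp only [smul_comm c]

theorem tensorAct_tmul (M : GlMod.{u, w₁} k A n) (N : GlMod.{u, w₂} k A n) {s t : ZMod 2}
    {x : Matrix (Fin n) (Fin n) A} (hx : IsHomog k s x) (m : M.carrier) {y : N.carrier}
    (hy : IsHomog k t y) :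
    tensorAct M N x (m ⊗ₜ y) = sgn (s * t) • (M.act x m ⊗ₜ[k] y) + m ⊗ₜ[k] N.act x y := by
  simp only [tensorAct, LinearMap.coe_mk, AddHom.coe_mk, LinearMap.add_apply, sum_parity,
    LinearMap.smul_apply, TensorProduct.map_tmul, hx.proj_eq, hy.proj_eq, LinearMap.id_apply]
  rcases parity_cases s with rfl | rfl <;> rcases parity_cases t with rfl | rfl <;> simp

/-- The tensor product of right `gl_n(A)`-supermodules. -/
def tensor (M : GlMod.{u, w₁} k A n) (N : GlMod.{u, w₂} k A n) :
    GlMod.{u, max w₁ w₂} k A n where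
  carrier := M.carrier ⊗[k] N.carrier
  act := tensorAct M N
  act_homog := by
    intro s t x z hx hz
    have key : (proj k (s + t)) ∘ₗ (tensorAct M N x) ∘ₗ (proj k t) =
        (tensorAct M N x) ∘ₗ (proj k t) := by
      refine tensor_ext_homog fun a b m y hm hy => ?_
      simp only [LinearMap.comp_apply, (isHomog_tmul hm hy).proj_eq]
      split_ifs with h
      · subst h
        rw [tensorAct_tmul M N hx m hy]
        refine IsHomog.add (IsHomog.zsmul ?_ _) ?_
        · rw [← add_assoc]
          exact isHomog_tmul (M.act_homog _ _ _ _ hx hm) hy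
        · rw [add_left_comm]
          exact isHomog_tmul hm (N.act_homog _ _ _ _ hx hy)
      · simp
    have := LinearMap.congr_fun key z
    simp only [LinearMap.comp_apply] at this
    have hz' : proj k t z = z := hz
    rwa [hz'] at this
  act_bracket := by
    intro s t x y z hx hy
    have key : tensorAct M N (superBracket k x y) = (tensorAct M N y) ∘ₗ (tensorAct M N x) -
        sgn (s * t) • (tensorAct M N x) ∘ₗ (tensorAct M N y) := by
      refine tensor_ext_homog fun a b m v hm hv => ?_
      rw [tensorAct_tmul M N (superBracket_isHomog hx hy) m hv]
      simp only [LinearMap.sub_apply, LinearMap.smul_apply, LinearMap.comp_apply,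
        tensorAct_tmul M N hx m hv, tensorAct_tmul M N hy m hv, map_add, map_zsmul,
        tensorAct_tmul M N hx _ hv, tensorAct_tmul M N hy _ hv,
        tensorAct_tmul M N hy m (N.act_homog _ _ _ _ hx hv),
        tensorAct_tmul M N hx m (N.act_homog _ _ _ _ hy hv),
        M.act_bracket s t x y _ hx hy, N.act_bracket s t x y _ hx hy,
        TensorProduct.tmul_sub, TensorProduct.sub_tmul]
      rcases parity_cases s with rfl | rfl <;> rcases parity_cases t with rfl | rfl <;>
        rcases parity_cases b with rfl | rfl <;>
        simp [sgn, neg_smul, TensorProduct.tmul_neg, TensorProduct.neg_tmul,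
          show (1 : ZMod 2) + 1 = 0 by decide] <;> abel
    exact LinearMap.congr_fun key z
  act_odd_sq := by
    intro x z hx
    have key : (tensorAct M N x) ∘ₗ (tensorAct M N x) = tensorAct M N (x * x) := by
      refine tensor_ext_homog fun a b m v hm hv => ?_
      rw [tensorAct_tmul M N (matrix_mul_homog k hx hx) m hv]
      simp only [LinearMap.comp_apply, tensorAct_tmul M N hx m hv, map_add, map_zsmul,
        tensorAct_tmul M N hx _ hv,
        tensorAct_tmul M N hx m (N.act_homog _ _ _ _ hx hv),
        M.act_odd_sq x _ hx, N.act_odd_sq x _ hx]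
      rcases parity_cases b with rfl | rfl <;>
        simp [sgn, show (1 : ZMod 2) + 1 = 0 by decide]
    exact LinearMap.congr_fun key z

/-- The pure tensor `m ⊗ y`, as an element of the supermodule `M ⊗ N`. -/
def tm (M : GlMod.{u, w₁} k A n) (N : GlMod.{u, w₂} k A n) (m : M.carrier) (y : N.carrier) :
    (tensor M N).carrier := m ⊗ₜ[k] y

section

variable (M : GlMod.{u, w₁} k A n) (N : GlMod.{u, w₂} k A n)

theorem tm_add_left (m m' : M.carrier) (y : N.carrier) :
    tm M N (m + m') y = tm M N m y + tm M N m' y := TensorProduct.add_tmul m m' y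

theorem tm_add_right (m : M.carrier) (y y' : N.carrier) :
    tm M N m (y + y') = tm M N m y + tm M N m y' := TensorProduct.tmul_add m y y'

theorem tm_zsmul_left (c : ℤ) (m : M.carrier) (y : N.carrier) :
    tm M N (c • m) y = c • tm M N m y := (TensorProduct.smul_tmul' c m y).symm

theorem tm_act {s t : ZMod 2} {x : Matrix (Fin n) (Fin n) A} (hx : IsHomog k s x)
    (m : M.carrier) {y : N.carrier} (hy : IsHomog k t y) :
    (tensor M N).act x (tm M N m y) = sgn (s * t) • tm M N (M.act x m) y + tm M N m (N.act x y) :=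
  tensorAct_tmul M N hx m hy

theorem tm_homog {s t : ZMod 2} {m : M.carrier} {y : N.carrier} (hm : IsHomog k s m)
    (hy : IsHomog k t y) : IsHomog k (s + t) (tm M N m y) := isHomog_tmul hm hy

theorem tm_evenPart (m : M.carrier) (y : N.carrier) :
    SuperModule.evenPart (k := k) (tm M N m y) =
      tm M N (proj k 0 m) (proj k 0 y) + tm M N (proj k 1 m) (proj k 1 y) := rfl

end

/-- The functor `- ⊗ N` on `mod-gl_n(A)`, with `φ ↦ φ ⊗ id`. -/
def tensorRight (N : GlMod.{u, w₂} k A n) :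
    GlMod.{u, max w w₂} k A n ⥤ GlMod.{u, max w w₂} k A n where
  obj M := tensor M N
  map {M M'} φ := ⟨TensorProduct.map (linOf φ) LinearMap.id, by
    intro x z
    have key : (TensorProduct.map (linOf φ) LinearMap.id) ∘ₗ (tensorAct M N x) =
        (tensorAct M' N x) ∘ₗ (TensorProduct.map (linOf φ) LinearMap.id) := by
      refine TensorProduct.ext' fun m y => ?_
      have h : ∀ x m, linOf φ (M.act x m) = M'.act x (linOf φ m) := Hom.map_act φ
      simp [tensorAct, h, sum_parity]
    exact LinearMap.congr_fun key z⟩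
  map_id M := by
    refine Hom.ext ?_
    exact TensorProduct.map_id
  map_comp {M₁ M₂ M₃} f g := by
    exact Hom.ext (TensorProduct.ext' fun _ _ => rfl)

/-! ### Quotients -/

/-- The quotient of a supermodule by a graded submodule which is stable under the action. -/
def quot (M : GlMod.{u, w} k A n) (R : Submodule k M.carrier)
    (hR : ∀ z ∈ R, SuperModule.evenPart (k := k) z ∈ R) (hR' : ∀ x, ∀ z ∈ R, M.act x z ∈ R) :
    GlMod.{u, w} k A n :=
  letI inst : SuperModule k (M.carrier ⧸ R) :=
    { evenPart := R.mapQ R SuperModule.evenPart hR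
      evenPart_idem := by
        intro z
        obtain ⟨z, rfl⟩ := R.mkQ_surjective z
        simp [SuperModule.evenPart_idem] }
  have hproj : ∀ s (m : M.carrier), proj k s (R.mkQ m) = R.mkQ (proj k s m) := by
    intro s m
    unfold proj
    split_ifs
    · rfl
    · rfl
  { carrier := M.carrier ⧸ R
    act :=
      { toFun := fun x => R.mapQ R (M.act x) (hR' x)
        map_add' := by
          intro x y
          ext z
          simp
        map_smul' := by
          intro c x
          ext z
          simp }
    act_homog := by
      intro s t x m hx hm
      obtain ⟨z, rfl⟩ := R.mkQ_surjective m
      unfold IsHomog at hm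
      rw [← hm, hproj]
      have := M.act_homog s t x _ hx (isHomog_proj t z)
      unfold IsHomog at this ⊢
      change proj k (s + t) (R.mkQ (M.act x (proj k t z))) = R.mkQ (M.act x (proj k t z))
      rw [hproj, this]
    act_bracket := by
      intro s t x y m hx hy
      obtain ⟨z, rfl⟩ := R.mkQ_surjective m
      change R.mkQ _ = R.mkQ _ - sgn (s * t) • R.mkQ _
      rw [M.act_bracket s t x y z hx hy, map_sub, map_zsmul]
    act_odd_sq := by
      intro x m hx
      obtain ⟨z, rfl⟩ := R.mkQ_surjective m
      change R.mkQ _ = R.mkQ _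
      rw [M.act_odd_sq x z hx] }

end GlMod

/-! ### Row vectors and symmetric powers -/

section Sym

variable {ι : Type v} {e : ι → A}

theorem proj_rightIdeal (he : LocallyUnital k e) {i : ι} (s : ZMod 2) {a : A}
    (ha : a ∈ rightIdeal k e i) : proj k s a ∈ rightIdeal k e i := by
  have ha' : e i * a = a := ha
  have h0 := Superalgebra.mul_homog (k := k) 0 0 _ _ (he.even i) (isHomog_proj 0 a)
  have h1 := Superalgebra.mul_homog (k := k) 0 1 _ _ (he.even i) (isHomog_proj 1 a)
  change e i * proj k s a = proj k s a
  conv_rhs => rw [← ha', ← proj_add_proj (k := k) a, mul_add, map_add]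
  simp only [zero_add] at h0 h1
  rw [h0.proj_eq, h1.proj_eq]
  rcases parity_cases s with rfl | rfl <;> simp

variable (k n) in
/-- The row vectors of length `n` with entries in `iA`. -/
def rowVec (e : ι → A) (i : ι) : Submodule k (Fin n → A) where
  carrier := {v | ∀ t, v t ∈ rightIdeal k e i}
  add_mem' := fun hv hw t => add_mem (hv t) (hw t)
  zero_mem' := fun _ => zero_mem _
  smul_mem' := fun c _ hv t => Submodule.smul_mem _ c (hv t)

/-- The entrywise grading of the row vectors. -/
@[reducible] def rowVecSuper (he : LocallyUnital k e) (i : ι) : SuperModule k (rowVec k n e i) where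
  evenPart := (LinearMap.pi fun t => SuperModule.evenPart ∘ₗ LinearMap.proj t).restrict
    (fun _ hv t => proj_rightIdeal he 0 (hv t))
  evenPart_idem := by
    intro v
    ext t
    exact SuperModule.evenPart_idem _

theorem vecMul_mem {i : ι} (x : Matrix (Fin n) (Fin n) A) (v : rowVec k n e i) :
    Matrix.vecMul v.1 x ∈ rowVec k n e i := by
  intro t
  change e i * _ = _
  rw [Matrix.vecMul, dotProduct, Finset.mul_sum]
  refine Finset.sum_congr rfl fun j _ => ?_
  rw [← mul_assoc]
  congr 1
  exact v.2 j

/-- Right multiplication of row vectors by matrices. -/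
def rowVecAct (e : ι → A) (i : ι) :
    Matrix (Fin n) (Fin n) A →ₗ[k] rowVec k n e i →ₗ[k] rowVec k n e i :=
  LinearMap.mk₂ k (fun x v => ⟨Matrix.vecMul v.1 x, vecMul_mem x v⟩)
    (fun x y v => Subtype.ext (Matrix.vecMul_add x y v.1))
    (fun c x v => Subtype.ext (Matrix.vecMul_smul v.1 c x))
    (fun x v w => Subtype.ext (Matrix.add_vecMul x v.1 w.1))
    (fun c x v => Subtype.ext (Matrix.smul_vecMul c v.1 x))

/-- The right `gl_n(A)`-supermodule `ᵢV` of row vectors with entries in `iA`, with `gl_n(A)` acting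
by right multiplication. -/
def GlMod.V (he : LocallyUnital k e) (n : ℕ) (i : ι) : GlMod.{u, u} k A n :=
  letI := rowVecSuper (n := n) he i
  have hproj : ∀ s (v : rowVec k n e i) t, (proj k s v).1 t = proj k s (v.1 t) := by
    intro s v t
    unfold proj
    split_ifs
    · rfl
    · rfl
  { carrier := rowVec k n e i
    act := rowVecAct e i
    act_homog := by
      intro s t x v hx hv
      refine Subtype.ext (funext fun j => ?_)
      rw [hproj]
      change proj k (s + t) (Matrix.vecMul v.1 x j) = Matrix.vecMul v.1 x j
      rw [Matrix.vecMul, dotProduct, map_sum]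
      refine Finset.sum_congr rfl fun l _ => ?_
      rw [add_comm]
      refine Superalgebra.mul_homog t s _ _ ?_ ?_
      · unfold IsHomog; rw [← hproj, hv]
      · unfold IsHomog; rw [← proj_matrix, hx]
    act_bracket := by
      intro s t x y v hx hy
      rw [superBracket_homog hx hy]
      simp only [map_sub, map_zsmul, LinearMap.sub_apply, LinearMap.smul_apply]
      congr 1
      · exact Subtype.ext (Matrix.vecMul_vecMul v.1 x y).symm
      · congr 1
        exact Subtype.ext (Matrix.vecMul_vecMul v.1 y x).symm
    act_odd_sq := by
      intro x v hx
      exact Subtype.ext (Matrix.vecMul_vecMul v.1 x x) }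

/-- The row vector `v_t^a ∈ ᵢV`, with `a ∈ iA` in position `t` and zeros elsewhere. -/
def rowSingle (he : LocallyUnital k e) {i : ι} (t : Fin n) (a : rightIdeal k e i) :
    (GlMod.V he n i).carrier :=
  (⟨Pi.single t a.1, by
    intro s
    rcases eq_or_ne s t with rfl | h
    · simp
    · simp [Pi.single_eq_of_ne h]⟩ : rowVec k n e i)

namespace GlMod

/-- The tensor powers `V^{⊗ x}`. -/
def tpow (V : GlMod.{u, u} k A n) : ℕ → GlMod.{u, u} k A n
  | 0 => unit k A n
  | x + 1 => tensor (tpow V x) V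

/-- The pure tensor `v₁ ⊗ ⋯ ⊗ vₓ`. -/
def tprod (V : GlMod.{u, u} k A n) : (x : ℕ) → (Fin x → V.carrier) → (tpow V x).carrier
  | 0, _ => (1 : k)
  | x + 1, v => tm (tpow V x) V (tprod V x fun j => v j.castSucc) (v (Fin.last x))

/-- From `R ⊆ M ⊗ V`, the submodule of `(M ⊗ V) ⊗ V` spanned by `R ⊗ V` and by the elements
`y ⊗ v ⊗ w - (-1)^(|v||w|) y ⊗ w ⊗ v` for homogeneous `v`, `w`, and `y ⊗ v ⊗ v` for odd `v`. -/
def relStep (M V : GlMod.{u, u} k A n) (R : Submodule k (tensor M V).carrier) :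
    Submodule k (tensor (tensor M V) V).carrier :=
  Submodule.span k
    ({z | ∃ r ∈ R, ∃ v : V.carrier, z = tm (tensor M V) V r v} ∪
      {z | ∃ (y : M.carrier) (s t : ZMod 2) (v w : V.carrier), IsHomog k s v ∧ IsHomog k t w ∧
        z = tm (tensor M V) V (tm M V y v) w - sgn (s * t) • tm (tensor M V) V (tm M V y w) v} ∪
      {z | ∃ (y : M.carrier) (v : V.carrier), IsHomog k 1 v ∧
        z = tm (tensor M V) V (tm M V y v) v})

/-- The component `Jₓ ⊆ V^{⊗ x}` of the two-sided ideal `J` of the tensor algebra of `V` generated by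
`v ⊗ w - (-1)^(|v||w|) w ⊗ v` for homogeneous `v`, `w`, and by `v ⊗ v` for odd `v`; that is,
`J₀ = J₁ = 0` and `J_{x+2} = J_{x+1} ⊗ V + V^{⊗ x} ⊗ J₂`. -/
def symRel (V : GlMod.{u, u} k A n) : (x : ℕ) → Submodule k (tpow V x).carrier
  | 0 => ⊥
  | 1 => ⊥
  | x + 2 => relStep (tpow V x) V (symRel V (x + 1))

section

variable (M V : GlMod.{u, u} k A n) (R : Submodule k (tensor M V).carrier)

theorem relStep_mul {r : (tensor M V).carrier} (hr : r ∈ R) (v : V.carrier) :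
    tm (tensor M V) V r v ∈ relStep M V R :=
  Submodule.subset_span (Or.inl (Or.inl ⟨r, hr, v, rfl⟩))

theorem relStep_swap (y : M.carrier) {s t : ZMod 2} {v w : V.carrier} (hv : IsHomog k s v)
    (hw : IsHomog k t w) :
    tm (tensor M V) V (tm M V y v) w - sgn (s * t) • tm (tensor M V) V (tm M V y w) v ∈
      relStep M V R :=
  Submodule.subset_span (Or.inl (Or.inr ⟨y, s, t, v, w, hv, hw, rfl⟩))

theorem relStep_sq (y : M.carrier) {v : V.carrier} (hv : IsHomog k 1 v) :
    tm (tensor M V) V (tm M V y v) v ∈ relStep M V R :=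
  Submodule.subset_span (Or.inr ⟨y, v, hv, rfl⟩)

theorem evenPart_mem_of_homog {P : Type v} [AddCommGroup P] [Module k P] [SuperModule k P]
    {N : Submodule k P} {s : ZMod 2} {z : P} (hz : IsHomog k s z) (h : z ∈ N) :
    SuperModule.evenPart (k := k) z ∈ N := by
  have : SuperModule.evenPart (k := k) z = proj k 0 z := rfl
  rw [this, hz.proj_eq]
  split_ifs
  · exact h
  · exact zero_mem _

theorem relStep_even (ih : ∀ r ∈ R, SuperModule.evenPart (k := k) r ∈ R)
    (z : (tensor (tensor M V) V).carrier) (hz : z ∈ relStep M V R) :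
    SuperModule.evenPart (k := k) z ∈ relStep M V R := by
  refine Submodule.span_induction (p := fun z _ =>
    SuperModule.evenPart (k := k) z ∈ relStep M V R) ?_ ?_ ?_ ?_ hz
  · rintro z ((⟨r, hr, v, rfl⟩ | ⟨y, s, t, v, w, hv, hw, rfl⟩) | ⟨y, v, hv, rfl⟩)
    · have h0 : proj k 0 r ∈ R := ih r hr
      have h1 : proj k 1 r ∈ R := sub_mem hr (ih r hr)
      rw [tm_evenPart]
      exact add_mem (relStep_mul M V R h0 _) (relStep_mul M V R h1 _)
    · have key : ∀ a, IsHomog k (a + s + t) (tm (tensor M V) V (tm M V (proj k a y) v) w -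
          sgn (s * t) • tm (tensor M V) V (tm M V (proj k a y) w) v) := by
        intro a
        refine (tm_homog _ _ (tm_homog _ _ (isHomog_proj a y) hv) hw).sub (IsHomog.zsmul ?_ _)
        rw [add_right_comm]
        exact tm_homog _ _ (tm_homog _ _ (isHomog_proj a y) hw) hv
      rw [← proj_add_proj (k := k) y]
      simp only [tm_add_left, smul_add, add_sub_add_comm]
      rw [map_add]
      exact add_mem (evenPart_mem_of_homog (key 0) (relStep_swap M V R _ hv hw))
        (evenPart_mem_of_homog (key 1) (relStep_swap M V R _ hv hw))
    · rw [← proj_add_proj (k := k) y]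
      simp only [tm_add_left]
      rw [map_add]
      exact add_mem
        (evenPart_mem_of_homog (tm_homog _ _ (tm_homog _ _ (isHomog_proj 0 y) hv) hv)
          (relStep_sq M V R _ hv))
        (evenPart_mem_of_homog (tm_homog _ _ (tm_homog _ _ (isHomog_proj 1 y) hv) hv)
          (relStep_sq M V R _ hv))
  · rw [map_zero]; exact zero_mem _
  · intro a b _ _ ha hb
    rw [map_add]; exact add_mem ha hb
  · intro c a _ ha
    rw [map_smul]; exact Submodule.smul_mem _ _ ha

theorem relStep_act {c : ZMod 2} {X : Matrix (Fin n) (Fin n) A} (hX : IsHomog k c X)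
    (ih : ∀ r ∈ R, (tensor M V).act X r ∈ R)
    (z : (tensor (tensor M V) V).carrier) (hz : z ∈ relStep M V R) :
    (tensor (tensor M V) V).act X z ∈ relStep M V R := by
  have act2 : ∀ (y : M.carrier) {s t : ZMod 2} {v w : V.carrier}, IsHomog k s v →
      IsHomog k t w → (tensor (tensor M V) V).act X (tm (tensor M V) V (tm M V y v) w) =
        sgn (c * t) • (sgn (c * s) • tm (tensor M V) V (tm M V (M.act X y) v) w +
          tm (tensor M V) V (tm M V y (V.act X v)) w) +
        tm (tensor M V) V (tm M V y v) (V.act X w) := by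
    intro y s t v w hv hw
    rw [tm_act _ _ hX _ hw, tm_act _ _ hX _ hv, tm_add_left, tm_zsmul_left]
  refine Submodule.span_induction (p := fun z _ =>
    (tensor (tensor M V) V).act X z ∈ relStep M V R) ?_ ?_ ?_ ?_ hz
  · rintro z ((⟨r, hr, v, rfl⟩ | ⟨y, s, t, v, w, hv, hw, rfl⟩) | ⟨y, v, hv, rfl⟩)
    · have key : ∀ b, (tensor (tensor M V) V).act X (tm (tensor M V) V r (proj k b v)) ∈
          relStep M V R := by
        intro b
        rw [tm_act _ _ hX _ (isHomog_proj b v)]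
        exact add_mem (zsmul_mem (relStep_mul M V R (ih r hr) _) _) (relStep_mul M V R hr _)
      rw [← proj_add_proj (k := k) v, tm_add_right, map_add]
      exact add_mem (key 0) (key 1)
    · have h1 := relStep_swap M V R (M.act X y) hv hw
      have h2 := relStep_swap M V R y (V.act_homog _ _ _ _ hX hv) hw
      have h3 := relStep_swap M V R y hv (V.act_homog _ _ _ _ hX hw)
      have h := add_mem (add_mem (zsmul_mem h1 (sgn (c * t) * sgn (c * s)))
        (zsmul_mem h2 (sgn (c * t)))) h3
      refine (congrArg (· ∈ relStep M V R) ?_).mp h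
      rw [map_sub, map_zsmul, act2 y hv hw, act2 y hw hv]
      rcases parity_cases c with rfl | rfl <;> rcases parity_cases s with rfl | rfl <;>
        rcases parity_cases t with rfl | rfl <;>
        simp [sgn, neg_smul, show (1 : ZMod 2) + 1 = 0 by decide] <;> abel
    · have h1 := relStep_sq M V R (M.act X y) hv
      have h2 := relStep_swap M V R y hv (V.act_homog _ _ _ _ hX hv)
      refine (congrArg (· ∈ relStep M V R) ?_).mp (add_mem h1 h2)
      rw [act2 y hv hv]
      rcases parity_cases c with rfl | rfl <;>
        simp [sgn, neg_smul, show (1 : ZMod 2) + 1 = 0 by decide] <;> abel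
  · rw [map_zero]; exact zero_mem _
  · intro a b _ _ ha hb
    rw [map_add]; exact add_mem ha hb
  · intro c a _ ha
    rw [map_smul]; exact Submodule.smul_mem _ _ ha

end

theorem symRel_even (V : GlMod.{u, u} k A n) : ∀ (x : ℕ) (z : (tpow V x).carrier),
    z ∈ symRel V x → SuperModule.evenPart (k := k) z ∈ symRel V x
  | 0, z, hz => by
    have : z = 0 := (Submodule.mem_bot k).1 hz
    rw [this, map_zero]; exact zero_mem _
  | 1, z, hz => by
    have : z = 0 := (Submodule.mem_bot k).1 hz
    rw [this, map_zero]; exact zero_mem _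
  | x + 2, z, hz => relStep_even (tpow V x) V (symRel V (x + 1)) (symRel_even V (x + 1)) z hz

theorem symRel_act_homog (V : GlMod.{u, u} k A n) {c : ZMod 2} {X : Matrix (Fin n) (Fin n) A}
    (hX : IsHomog k c X) : ∀ (x : ℕ) (z : (tpow V x).carrier),
    z ∈ symRel V x → (tpow V x).act X z ∈ symRel V x
  | 0, z, hz => by
    have : z = 0 := (Submodule.mem_bot k).1 hz
    rw [this, map_zero]; exact zero_mem _
  | 1, z, hz => by
    have : z = 0 := (Submodule.mem_bot k).1 hz
    rw [this, map_zero]; exact zero_mem _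
  | x + 2, z, hz =>
    relStep_act (tpow V x) V (symRel V (x + 1)) hX (symRel_act_homog V hX (x + 1)) z hz

theorem symRel_act (V : GlMod.{u, u} k A n) (x : ℕ) (X : Matrix (Fin n) (Fin n) A)
    (z : (tpow V x).carrier) (hz : z ∈ symRel V x) : (tpow V x).act X z ∈ symRel V x := by
  rw [← proj_add_proj (k := k) X, map_add]
  exact add_mem (symRel_act_homog V (isHomog_proj 0 X) x z hz)
    (symRel_act_homog V (isHomog_proj 1 X) x z hz)

/-- The symmetric power `S^x V = V^{⊗ x} / Jₓ`. -/
def symPow (V : GlMod.{u, u} k A n) (x : ℕ) : GlMod.{u, u} k A n :=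
  quot (tpow V x) (symRel V x) (symRel_even V x) (symRel_act V x)

/-- The product `v₁ ⋯ vₓ ∈ S^x V`. -/
def sprod (V : GlMod.{u, u} k A n) (x : ℕ) (v : Fin x → V.carrier) : (symPow V x).carrier :=
  (symRel V x).mkQ (tprod V x v)

/-- A homomorphism is even when it preserves parities. -/
def IsEven {M : GlMod.{u, w₁} k A n} {N : GlMod.{u, w₂} k A n}
    (f : M.carrier →ₗ[k] N.carrier) : Prop :=
  ∀ s m, IsHomog k s m → IsHomog k s (f m)

end GlMod

/-! ### Supermodules on which the Casimir sums are finite -/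

/-- The supermodules `M` such that, for all `m ∈ M`, `f ∈ iA` and all `r`, `s`, one has
`m · E_{r,s}^{a f} = 0` for all `a ∈ jAi`, for all but finitely many `j`. -/
def casimirFinite (k : Type u) [CommRing k] {A : Type u} [NonUnitalRing A] [Module k A]
    [IsScalarTower k A A] [SMulCommClass k A A] [Superalgebra k A] (n : ℕ) (e : ι → A) (i : ι) :
    ObjectProperty (GlMod.{u, w} k A n) :=
  fun M => ∀ (m : M.carrier), ∀ f ∈ rightIdeal k e i, ∀ r s : Fin n,
    {j | ∃ a ∈ peirce k e j i, M.act (Matrix.single r s (a * f)) m ≠ 0}.Finite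

theorem proj_peirce (he : LocallyUnital k e) {j i : ι} (s : ZMod 2) {a : A}
    (ha : a ∈ peirce k e j i) : proj k s a ∈ peirce k e j i := by
  refine ⟨proj_rightIdeal he s (i := j) ha.1, ?_⟩
  have ha' : a * e i = a := ha.2
  have h0 := Superalgebra.mul_homog (k := k) 0 0 _ _ (isHomog_proj 0 a) (he.even i)
  have h1 := Superalgebra.mul_homog (k := k) 1 0 _ _ (isHomog_proj 1 a) (he.even i)
  conv_rhs => rw [← ha', ← proj_add_proj (k := k) a, add_mul, map_add]
  simp only [add_zero] at h0 h1
  rw [h0.proj_eq, h1.proj_eq]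
  rcases parity_cases s with rfl | rfl <;> simp

theorem proj_single_mul (r s : Fin n) (c : ZMod 2) (a f : A) :
    proj k c (Matrix.single r s (a * f)) =
      Matrix.single r s (proj k 0 a * proj k c f) +
        Matrix.single r s (proj k 1 a * proj k (c + 1) f) := by
  have h1 : ∀ x : A, proj k c (Matrix.single r s x) = Matrix.single r s (proj k c x) := by
    intro x
    ext p q
    rw [proj_matrix, Matrix.single_apply, Matrix.single_apply]
    split_ifs
    · rfl
    · exact map_zero _
  have hh : ∀ p q, IsHomog k (p + q) (proj k p a * proj k q f) := fun p q =>
    Superalgebra.mul_homog p q _ _ (isHomog_proj p a) (isHomog_proj q f)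
  rw [h1, ← Matrix.single_add]
  congr 1
  conv_lhs => rw [← proj_add_proj (k := k) a, ← proj_add_proj (k := k) f]
  simp only [add_mul, mul_add, map_add, (hh _ _).proj_eq]
  rcases parity_cases c with rfl | rfl <;>
    simp [show (1 : ZMod 2) + 1 = 0 by decide, add_comm]

theorem map_add_eq_zero {P : Type v} [AddCommGroup P] [Module k P] (L : P →ₗ[k] P) {z z' : P}
    (h : L z = 0) (h' : L z' = 0) : L (z + z') = 0 := by
  rw [map_add, h, h', add_zero]

theorem casimirFinite_tensor (he : LocallyUnital k e) (i : ι) (M : GlMod.{u, w₁} k A n)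
    (N : GlMod.{u, w₂} k A n) (hM : casimirFinite k n e i M) (hN : casimirFinite k n e i N) :
    casimirFinite k n e i (GlMod.tensor M N) := by
  intro z f hf r s
  change M.carrier ⊗[k] N.carrier at z
  induction z with
  | zero =>
    refine Set.finite_empty.subset ?_
    rintro j ⟨a, -, h⟩
    exact h (map_zero _)
  | add z z' hz hz' =>
    refine (hz.union hz').subset ?_
    rintro j ⟨a, ha, h⟩
    by_cases h0 : (GlMod.tensor M N).act (Matrix.single r s (a * f)) z = 0
    · refine Or.inr ⟨a, ha, fun h1 => h ?_⟩
      exact map_add_eq_zero ((GlMod.tensor M N).act (Matrix.single r s (a * f))) h0 h1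
    · exact Or.inl ⟨a, ha, h0⟩
  | tmul m y =>
    refine (((hM m _ (proj_rightIdeal he 0 hf) r s).union
      (hM m _ (proj_rightIdeal he 1 hf) r s)).union (hN y f hf r s)).subset ?_
    rintro j ⟨a, ha, h⟩
    by_contra hj
    simp only [Set.mem_union, not_or, Set.mem_ofPred_eq, not_exists, not_and, not_not] at hj
    obtain ⟨⟨h0, h1⟩, h2⟩ := hj
    refine h ?_
    change GlMod.tensorAct M N _ (m ⊗ₜ y) = 0
    have h3 : ∀ c, M.act (proj k c (Matrix.single r s (a * f))) m = 0 := by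
      intro c
      rw [proj_single_mul, map_add, LinearMap.add_apply]
      rcases parity_cases c with rfl | rfl
      · rw [h0 _ (proj_peirce he 0 ha), zero_add 1, h1 _ (proj_peirce he 1 ha), add_zero]
      · rw [h1 _ (proj_peirce he 0 ha), show (1 : ZMod 2) + 1 = 0 by decide,
          h0 _ (proj_peirce he 1 ha), add_zero]
    simp [GlMod.tensorAct, h3, h2 a ha]

theorem finite_mul_e (he : LocallyUnital k e) (x : A) : {j | x * e j ≠ 0}.Finite := by
  have hx : x ∈ ⨆ p : ι × ι, peirce k e p.1 p.2 := by rw [he.span]; trivial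
  refine Submodule.iSup_induction _ (motive := fun x => {j | x * e j ≠ 0}.Finite) hx ?_ ?_ ?_
  · rintro ⟨p, q⟩ y ⟨-, hy⟩
    refine (Set.finite_singleton q).subset ?_
    intro j hj
    by_contra hne
    refine hj ?_
    simp only at hy
    rw [← hy, mul_assoc, he.orth q j (Ne.symm hne), mul_zero]
  · simp
  · intro y z hy hz
    refine (hy.union hz).subset ?_
    intro j hj
    by_cases h : y * e j = 0
    · refine Or.inr fun h' => hj ?_
      rw [add_mul, h, h', add_zero]
    · exact Or.inl h

theorem casimirFinite_V (he : LocallyUnital k e) (i : ι) :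
    casimirFinite k n e i (GlMod.V he n i) := by
  intro v f hf r s
  refine (finite_mul_e he (Subtype.val (p := fun w => w ∈ rowVec k n e i) v r)).subset ?_
  rintro j ⟨a, ha, h⟩ h0
  refine h ?_
  refine Subtype.ext (funext fun t => ?_)
  change Matrix.vecMul (Subtype.val (p := fun w => w ∈ rowVec k n e i) v)
    (Matrix.single r s (a * f)) t = 0
  rw [Matrix.vecMul, dotProduct]
  refine Finset.sum_eq_zero fun l _ => ?_
  rw [Matrix.single_apply]
  split_ifs with hc
  · obtain ⟨rfl, -⟩ := hc
    have ha1 : e j * a = a := ha.1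
    rw [← ha1, mul_assoc (e j), ← mul_assoc, h0, zero_mul]
  · exact mul_zero _

theorem casimirFinite_symPow (he : LocallyUnital k e) (i : ι) (d : ℕ) :
    casimirFinite k n e i (GlMod.symPow (GlMod.V he n i) d) := by
  have h1 : ∀ d, casimirFinite k n e i (GlMod.tpow (GlMod.V he n i) d) := by
    intro d
    induction d with
    | zero =>
      intro m f _ r s
      refine Set.finite_empty.subset ?_
      rintro j ⟨a, -, h⟩
      exact h rfl
    | succ d ih => exact casimirFinite_tensor he i _ _ ih (casimirFinite_V he i)
  intro z f hf r s
  obtain ⟨z, rfl⟩ := (GlMod.symRel (GlMod.V he n i) d).mkQ_surjective z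
  refine (h1 d z f hf r s).subset ?_
  rintro j ⟨a, ha, h⟩
  refine ⟨a, ha, fun h0 => h ?_⟩
  change (GlMod.symRel (GlMod.V he n i) d).mkQ _ = 0
  rw [h0, map_zero]

/-- The endofunctor `- ⊗ S^d(ᵢV)`, on the full subcategory of `mod-gl_n(A)` formed by the
supermodules on which the Casimir sums are finite. -/
def tensorSym (he : LocallyUnital k e) (n : ℕ) (i : ι) (d : ℕ) :
    (casimirFinite.{u, v, max w u} k n e i).FullSubcategory ⥤
      (casimirFinite.{u, v, max w u} k n e i).FullSubcategory :=
  (casimirFinite.{u, v, max w u} k n e i).lift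
    ((casimirFinite.{u, v, max w u} k n e i).ι ⋙
      GlMod.tensorRight.{u, w, u} (GlMod.symPow (GlMod.V he n i) d))
    (fun M => casimirFinite_tensor he i _ _ M.property (casimirFinite_symPow he i d))

/-! ### Good ordered partitions -/

/-- An ordered `d`-partition `u⁽¹⁾ | u⁽²⁾ | ⋯` of `{1, …, d}`: a permutation `u₁ ⋯ u_d` with a
grouping of its entries into consecutive nonempty blocks. -/
abbrev OrdPart (d : ℕ) := Equiv.Perm (Fin d) × Composition d

/-- The blocks `u⁽¹⁾, u⁽²⁾, …`. -/
def OrdPart.parts {d : ℕ} (u : OrdPart d) : List (List (Fin d)) :=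
  (List.ofFn u.1).splitWrtComposition u.2

/-- The last entry is smaller than all others. -/
def LeastLast {d : ℕ} (w : List (Fin d)) : Prop := ∀ a ∈ w.dropLast, ∀ b ∈ w.getLast?, b < a

/-- All blocks are least-last, and the last entries of the blocks increase. -/
def OrdPart.Good {d : ℕ} (u : OrdPart d) : Prop :=
  (∀ w ∈ u.parts, LeastLast w) ∧ (u.parts.filterMap List.getLast?).Pairwise (· < ·)

instance {d : ℕ} : DecidablePred (OrdPart.Good (d := d)) := fun u => by
  unfold OrdPart.Good LeastLast; infer_instance

/-! ### The thick Casimir maps -/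

section Casimir

variable {d : ℕ}

/-- For a nonempty word `w = w₁ ⋯ w_l` the matrix
`δ_{t_{w₁}, r_{w₂}} ⋯ δ_{t_{w_{l-1}}, r_{w_l}} E_{r_{w₁}, t_{w_l}}^{g_{w₁} ⋯ g_{w_l}}`, that is, the
product of the matrices `E_{r_{w_j}, t_{w_j}}^{g_{w_j}}`. -/
def wordMat (g : Fin d → A) (r t : Fin d → Fin n) : List (Fin d) → Matrix (Fin n) (Fin n) A
  | [] => 0
  | [j] => Matrix.single (r j) (t j) (g j)
  | j :: j' :: w => Matrix.single (r j) (t j) (g j) * wordMat g r t (j' :: w)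

/-- `m · E(u⁽¹⁾) E(u⁽²⁾) ⋯`. -/
def partsAct (M : GlMod.{u, w} k A n) (g : Fin d → A) (r t : Fin d → Fin n) (u : OrdPart d)
    (m : M.carrier) : M.carrier :=
  u.parts.foldl (fun m w => M.act (wordMat g r t w) m) m

/-- The sum of `p (uᵢ) p (uⱼ)` over all inversions `i < j`, `uᵢ > uⱼ`. -/
def inversionParity (u : Equiv.Perm (Fin d)) (p : Fin d → ZMod 2) : ZMod 2 :=
  ∑ i, ∑ j, if i < j ∧ u j < u i then p (u i) * p (u j) else 0

/-- The sum of `q i * p j` over all `i ≤ j`. -/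
def pairingParity (p q : Fin d → ZMod 2) : ZMod 2 :=
  ∑ i, ∑ j, if i ≤ j then q i * p j else 0

variable {β : Type w₁}

/-- The basis elements in `Ai = ⨁ jAi`. -/
abbrev HomogBasis.Src (B : HomogBasis k e β) (i : ι) : Type w₁ := {b : β // B.src b = i}

/-- The dual basis vector `b^∨ ∈ iA` of a basis element `b ∈ Ai`. -/
noncomputable def dualIn (F : FrobeniusStructure k e) (he : LocallyUnital k e)
    (B : HomogBasis k e β) {i : ι} (b : B.Src i) : rightIdeal k e i :=
  ⟨F.dualVec he B b.1, by have h := F.dualVec_mem he B b.1; rwa [b.2] at h⟩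

/-- `C` is given by the formula which defines the thick Casimir map `C_M^{i^(d)}`:
`m ⊗ v_{t₁}^{f₁} ⋯ v_{t_d}^{f_d}` is sent to the sum over `b ∈ B^d`, `r ∈ [1, n]^d` and the good
ordered partitions `u` of
`(-1)^(∑_{i ≤ j} |bᵢ||fⱼ|) m E_{r,t}^{b f}(u) ⊗ v_{r_d}^{b_d^∨} ⋯ v_{r₁}^{b₁^∨}`, where
`E_{r,t}^{g}(u) = (-1)^(∑_{i < j, uᵢ > uⱼ} |g_{uᵢ}||g_{uⱼ}|) E_{r,t}^{g}(u⁽¹⁾) E_{r,t}^{g}(u⁽²⁾) ⋯`,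
with only finitely many non-zero terms. Only the `b` with all entries in `Ai` have to be summed over,
as `b f = 0` for `f ∈ iA` and a basis element `b` outside `Ai`. -/
def IsThickCasimir (F : FrobeniusStructure k e) (he : LocallyUnital k e) (B : HomogBasis k e β)
    (i : ι) (d : ℕ) (M : GlMod.{u, w} k A n)
    (C : (GlMod.tensor M (GlMod.symPow (GlMod.V he n i) d)).carrier →ₗ[k]
      (GlMod.tensor M (GlMod.symPow (GlMod.V he n i) d)).carrier) : Prop :=
  ∀ (m : M.carrier) (f : Fin d → rightIdeal k e i) (p : Fin d → ZMod 2) (t : Fin d → Fin n),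
    (∀ j, IsHomog k (p j) (f j : A)) →
    {b : Fin d → B.Src i | ∃ (r : Fin d → Fin n) (u : OrdPart d), u.Good ∧
      partsAct M (fun j => B.basis (b j).1 * (f j : A)) r t u m ≠ 0}.Finite ∧
    C (GlMod.tm M _ m (GlMod.sprod (GlMod.V he n i) d fun j => rowSingle he (t j) (f j))) =
      ∑ᶠ b : Fin d → B.Src i, ∑ r : Fin d → Fin n, ∑ u : OrdPart d with u.Good,
        sgn (pairingParity p (fun j => B.par (b j).1) +
            inversionParity u.1 (fun j => B.par (b j).1 + p j)) •
          GlMod.tm M _ (partsAct M (fun j => B.basis (b j).1 * (f j : A)) r t u m)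
            (GlMod.sprod (GlMod.V he n i) d fun j =>
              rowSingle he (r j.rev) (dualIn F he B (b j.rev)))

end Casimir

end Sym

end GLModules

end ThickCasimir

open ThickCasimir

namespace ThickCasimir

/-! The ordinary Casimir map on `N ⊗ V` sends `z ⊗ v` to the signed sum of `z · mat a v ⊗ dual a`,
where `a = (r, b)`, `mat a (v_t^f) = E_{r,t}^{bf}` and `dual a = v_r^{b^∨}`. It is a natural even
homomorphism for one reason only: a matrix `X` acts on the dual vectors and multiplies the matrices
`mat a v` from the left with the same coefficients (`CasimirPair.act_dual` and
`CasimirPair.mul_mat`). So under the sum over `a`, an `X` acting on `dual a` may be moved in front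
of `mat a v` (`CasimirPair.sum_act_dual`). The Frobenius form provides this: `x b = ∑ coord_c(x b)
c` for basis elements, and dually `b^∨ x = ∑ coord_b(x c) c^∨`.

The thick map is built by iteration. Given the map on `M ⊗ V^{⊗ d}` with values in `M ⊗ S^d V`,
apply the Casimir map of the supermodule `N = M ⊗ S^d V` to the next factor of `V`, and multiply the
resulting vector into the symmetric power (`dmap`). Every step is a natural even homomorphism, hence
so is the composite; no formula is needed for this.

The composite factors through `S^d V` because two successive Casimir maps, followed by
multiplication, are supersymmetric in their two arguments. By invariance the double sum has the
coefficients `z · x · y + (-1)^{|x||y|} z · (yx)` with `x = mat a v`, `y = mat c w` (`omega_omega`),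
and the supercommutator relation says precisely that this expression is supersymmetric in `x`, `y`
(`symProd_swap`). For a repeated odd vector the off-diagonal terms cancel in pairs, while the
diagonal ones vanish by `(zx)x = z(x²)` for odd `x` or by `u u = 0` for odd `u` in the symmetric
power, so `2` need not be inverted (`omega_omega_sq`).

The explicit formula follows by induction on `d`. In the new step the matrix of the last letter acts
by the Leibniz rule either on `M`, which appends a block consisting of the largest letter, or on the
dual vector of some letter `j`, which by invariance inserts the largest letter in front of `j`. Each
good ordered partition of `d + 1` letters arises exactly once in this way from one of `d` letters
(`sum_goodLists_succ`); the rest is a comparison of signs (`signParity_appendLast`,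
`signParity_insertBefore`). Uniqueness holds because the products of homogeneous `v_t^f` span the
symmetric power. -/

theorem IsHomog.sum {k : Type u} [CommRing k] {M : Type v} [AddCommGroup M] [Module k M]
    [SuperModule k M] {α : Type w} {s : ZMod 2} (T : Finset α) (f : α → M)
    (h : ∀ a ∈ T, IsHomog k s (f a)) : IsHomog k s (∑ a ∈ T, f a) := by
  unfold IsHomog at *
  rw [map_sum]
  exact Finset.sum_congr rfl h

theorem zmod_two_add_self (s : ZMod 2) : s + s = 0 := by
  revert s; decide

theorem sgn_smul_smul {M : Type v} [AddCommGroup M] (s t : ZMod 2) (m : M) :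
    sgn s • sgn t • m = sgn (s + t) • m := by
  rw [smul_smul, sgn_add]

@[simp] theorem sgn_zero : sgn 0 = 1 := rfl

/-- The twist `m ↦ (-1)^(s|m|) m` of a supermodule. -/
def twist (k : Type u) [CommRing k] {M : Type v} [AddCommGroup M] [Module k M] [SuperModule k M]
    (s : ZMod 2) : M →ₗ[k] M :=
  proj k 0 + sgn s • proj k 1

theorem IsHomog.twist_eq {k : Type u} [CommRing k] {M : Type v} [AddCommGroup M] [Module k M]
    [SuperModule k M] {t : ZMod 2} {m : M} (h : IsHomog k t m) (s : ZMod 2) :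
    twist k s m = sgn (s * t) • m := by
  simp only [twist, LinearMap.add_apply, LinearMap.smul_apply, h.proj_eq]
  rcases parity_cases t with rfl | rfl <;> simp

namespace GlMod

/-! ### Linear maps on tensor products of supermodules. -/

section TensorAPI

variable {k : Type u} [CommRing k] {A : Type u} [NonUnitalRing A] [Module k A]
  [IsScalarTower k A A] [SMulCommClass k A A] [Superalgebra k A] {n : ℕ}

universe w₃ w₄ w₅

variable (M : GlMod.{u, w₁} k A n) (N : GlMod.{u, w₂} k A n)

/-- The bilinear map `(m, y) ↦ m ⊗ y`. -/
def tmₗ : M.carrier →ₗ[k] N.carrier →ₗ[k] (tensor M N).carrier :=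
  TensorProduct.mk k M.carrier N.carrier

theorem tmₗ_apply (m : M.carrier) (y : N.carrier) : tmₗ M N m y = tm M N m y := rfl

theorem tm_zsmul_right (c : ℤ) (m : M.carrier) (y : N.carrier) :
    tm M N m (c • y) = c • tm M N m y := by
  simp only [← tmₗ_apply, map_zsmul]

theorem tm_smul_left (c : k) (m : M.carrier) (y : N.carrier) :
    tm M N (c • m) y = c • tm M N m y := by
  simp only [← tmₗ_apply, map_smul, LinearMap.smul_apply]

theorem tm_zero_left (y : N.carrier) : tm M N 0 y = 0 := by
  simp only [← tmₗ_apply, map_zero, LinearMap.zero_apply]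

theorem tm_zero_right (m : M.carrier) : tm M N m 0 = 0 := by
  simp only [← tmₗ_apply, map_zero]

theorem tm_sum_left {α : Type w} (T : Finset α) (f : α → M.carrier) (y : N.carrier) :
    tm M N (∑ a ∈ T, f a) y = ∑ a ∈ T, tm M N (f a) y := by
  simp only [← tmₗ_apply, map_sum, LinearMap.sum_apply]

theorem tm_sum_right {α : Type w} (T : Finset α) (m : M.carrier) (f : α → N.carrier) :
    tm M N m (∑ a ∈ T, f a) = ∑ a ∈ T, tm M N m (f a) := by
  simp only [← tmₗ_apply, map_sum]

variable {M N}

@[elab_as_elim]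
theorem tensor_induction {p : (tensor M N).carrier → Prop} (z : (tensor M N).carrier)
    (zero : p 0) (tm : ∀ m y, p (tm M N m y)) (add : ∀ z z', p z → p z' → p (z + z')) : p z :=
  TensorProduct.induction_on (motive := p) z zero tm add

theorem tensor_hom_ext {P : Type w₃} [AddCommGroup P] [Module k P]
    {f g : (tensor M N).carrier →ₗ[k] P}
    (h : ∀ s t m y, IsHomog k s m → IsHomog k t y → f (tm M N m y) = g (tm M N m y)) : f = g :=
  tensor_ext_homog h

/-- The linear map on `M ⊗ N` induced by a bilinear map. -/
def tlift {P : Type w₃} [AddCommGroup P] [Module k P] (f : M.carrier →ₗ[k] N.carrier →ₗ[k] P) :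
    (tensor M N).carrier →ₗ[k] P :=
  TensorProduct.lift f

/-- The tensor product of two linear maps. -/
def tmap {M' : GlMod.{u, w₃} k A n} {N' : GlMod.{u, w₄} k A n}
    (f : M.carrier →ₗ[k] M'.carrier) (g : N.carrier →ₗ[k] N'.carrier) :
    (tensor M N).carrier →ₗ[k] (tensor M' N').carrier :=
  TensorProduct.map f g

theorem tmap_tm {M' : GlMod.{u, w₃} k A n} {N' : GlMod.{u, w₄} k A n}
    (f : M.carrier →ₗ[k] M'.carrier) (g : N.carrier →ₗ[k] N'.carrier) (m : M.carrier)
    (y : N.carrier) : tmap f g (tm M N m y) = tm M' N' (f m) (g y) := rfl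

variable (M N) in
/-- The associativity isomorphism `(M ⊗ N) ⊗ P → M ⊗ (N ⊗ P)`. -/
def tassoc (P : GlMod.{u, w₃} k A n) :
    (tensor (tensor M N) P).carrier →ₗ[k] (tensor M (tensor N P)).carrier :=
  (TensorProduct.assoc k M.carrier N.carrier P.carrier).toLinearMap

variable (M N) in
/-- The associativity isomorphism `M ⊗ (N ⊗ P) → (M ⊗ N) ⊗ P`. -/
def tassocSymm (P : GlMod.{u, w₃} k A n) :
    (tensor M (tensor N P)).carrier →ₗ[k] (tensor (tensor M N) P).carrier :=
  (TensorProduct.assoc k M.carrier N.carrier P.carrier).symm.toLinearMap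

variable (M N) in
/-- A linear map commutes with the action of `gl_n(A)`. -/
def IsHom (f : M.carrier →ₗ[k] N.carrier) : Prop := ∀ x m, f (M.act x m) = N.act x (f m)

theorem isHom_of_homog {f : M.carrier →ₗ[k] N.carrier}
    (h : ∀ c x m, IsHomog k c x → f (M.act x m) = N.act x (f m)) : IsHom M N f := by
  intro x m
  rw [← proj_add_proj (k := k) x]
  simp only [map_add, LinearMap.add_apply, h _ _ _ (isHomog_proj _ x)]

theorem isHom_tensor {P : GlMod.{u, w₃} k A n} {f : (tensor M N).carrier →ₗ[k] P.carrier}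
    (h : ∀ c s t x m y, IsHomog k c x → IsHomog k s m → IsHomog k t y →
      f ((tensor M N).act x (tm M N m y)) = P.act x (f (tm M N m y))) : IsHom (tensor M N) P f := by
  refine isHom_of_homog fun c x m hx => ?_
  have key : f ∘ₗ (tensor M N).act x = (P.act x) ∘ₗ f :=
    tensor_hom_ext fun s t m y hm hy => h c s t x m y hx hm hy
  exact LinearMap.congr_fun key m

theorem isEven_tensor {P : GlMod.{u, w₃} k A n} {f : (tensor M N).carrier →ₗ[k] P.carrier}
    (h : ∀ s t m y, IsHomog k s m → IsHomog k t y → IsHomog k (s + t) (f (tm M N m y))) :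
    IsEven f := by
  intro r z hz
  -- Homogeneity of a vector is not inherited by the pure tensors in an expansion of it. Projecting
  -- before and after `f` turns the claim into an equality of linear maps, which can be checked on
  -- homogeneous pure tensors.
  have key : (proj k r) ∘ₗ f ∘ₗ (proj k r) = f ∘ₗ (proj k r) := by
    refine tensor_hom_ext fun s t m y hm hy => ?_
    simp only [LinearMap.comp_apply, (tm_homog M N hm hy).proj_eq]
    split_ifs with hr
    · subst hr; exact h s t m y hm hy
    · simp
  have := LinearMap.congr_fun key z
  have hz' : proj k r z = z := hz
  simp only [LinearMap.comp_apply, hz'] at this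
  exact this

end TensorAPI

/-! ### Multiplication in the symmetric powers. -/

section SymAPI

variable {k : Type u} [CommRing k] {A : Type u} [NonUnitalRing A] [Module k A]
  [IsScalarTower k A A] [SMulCommClass k A A] [Superalgebra k A] {n : ℕ}
  (V : GlMod.{u, u} k A n)

theorem proj_mkQ (d : ℕ) (s : ZMod 2) (z : (tpow V d).carrier) :
    proj k s (M := (symPow V d).carrier) ((symRel V d).mkQ z) = (symRel V d).mkQ (proj k s z) := by
  unfold proj
  split_ifs <;> rfl

/-- The quotient map `V^{⊗ d} → S^d V`. -/
def toSym (d : ℕ) : (tpow V d).carrier →ₗ[k] (symPow V d).carrier := (symRel V d).mkQ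

theorem toSym_surjective (d : ℕ) : Function.Surjective (toSym V d) := (symRel V d).mkQ_surjective

theorem toSym_eq_zero {d : ℕ} {z : (tpow V d).carrier} (hz : z ∈ symRel V d) : toSym V d z = 0 :=
  (Submodule.Quotient.mk_eq_zero _).2 hz

theorem toSym_act (d : ℕ) : IsHom (tpow V d) (symPow V d) (toSym V d) := fun _ _ => rfl

theorem toSym_even (d : ℕ) : IsEven (M := tpow V d) (N := symPow V d) (toSym V d) := by
  intro s m hm
  have hm' : proj k s m = m := hm
  unfold IsHomog
  exact (proj_mkQ V d s m).trans (by rw [hm']; rfl)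

theorem exists_homog_lift {d : ℕ} {s : ZMod 2} {z : (symPow V d).carrier} (hz : IsHomog k s z) :
    ∃ y, IsHomog k s y ∧ toSym V d y = z := by
  obtain ⟨y, rfl⟩ := toSym_surjective V d z
  exact ⟨proj k s y, isHomog_proj s y, (proj_mkQ V d s y).symm.trans hz⟩

theorem symRel_mul {d : ℕ} {r : (tpow V d).carrier} (hr : r ∈ symRel V d) (v : V.carrier) :
    tm (tpow V d) V r v ∈ symRel V (d + 1) := by
  -- The relations in degree one are zero by definition and not an instance of `relStep`, so degree
  -- zero is separate.
  cases d with
  | zero =>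
    have h : r = 0 := (Submodule.mem_bot k).1 hr
    rw [h, tm_zero_left]
    exact zero_mem _
  | succ d => exact relStep_mul _ _ _ hr v

/-- The multiplication `V^{⊗ d} ⊗ V → V^{⊗ (d+1)}`, as a bilinear map. -/
def tsnoc (d : ℕ) : (tpow V d).carrier →ₗ[k] V.carrier →ₗ[k] (tpow V (d + 1)).carrier :=
  tmₗ (tpow V d) V

theorem tsnoc_act (d : ℕ) {c t : ZMod 2} {x : Matrix (Fin n) (Fin n) A} {v : V.carrier}
    (hx : IsHomog k c x) (y : (tpow V d).carrier) (hv : IsHomog k t v) :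
    (tpow V (d + 1)).act x (tsnoc V d y v) =
      sgn (c * t) • tsnoc V d ((tpow V d).act x y) v + tsnoc V d y (V.act x v) :=
  tm_act (tpow V d) V hx y hv

theorem tsnoc_homog (d : ℕ) {s t : ZMod 2} {y : (tpow V d).carrier} {v : V.carrier}
    (hy : IsHomog k s y) (hv : IsHomog k t v) : IsHomog k (s + t) (tsnoc V d y v) :=
  tm_homog _ _ hy hv

theorem tpow_succ_induction {d : ℕ} {p : (tpow V (d + 1)).carrier → Prop}
    (z : (tpow V (d + 1)).carrier) (zero : p 0) (snoc : ∀ y v, p (tsnoc V d y v))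
    (add : ∀ z z', p z → p z' → p (z + z')) : p z :=
  tensor_induction (M := tpow V d) (N := V) (p := p) z zero snoc add

/-- The multiplication `S^d V ⊗ V → S^{d+1} V`, as a bilinear map. -/
def smul₂ (d : ℕ) : (symPow V d).carrier →ₗ[k] V.carrier →ₗ[k] (symPow V (d + 1)).carrier :=
  (symRel V d).liftQ ((tsnoc V d).compr₂ (toSym V (d + 1))) (by
    intro r hr
    refine LinearMap.ext fun v => ?_
    exact toSym_eq_zero V (symRel_mul V hr v))

theorem smul₂_toSym (d : ℕ) (y : (tpow V d).carrier) (v : V.carrier) :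
    smul₂ V d (toSym V d y) v = toSym V (d + 1) (tsnoc V d y v) := rfl

theorem smul₂_homog (d : ℕ) {s t : ZMod 2} {z : (symPow V d).carrier} {v : V.carrier}
    (hz : IsHomog k s z) (hv : IsHomog k t v) : IsHomog k (s + t) (smul₂ V d z v) := by
  obtain ⟨y, hy, rfl⟩ := exists_homog_lift V hz
  exact toSym_even V (d + 1) _ _ (tm_homog _ _ hy hv)

theorem smul₂_act (d : ℕ) {c t : ZMod 2} {x : Matrix (Fin n) (Fin n) A} {v : V.carrier}
    (hx : IsHomog k c x) (z : (symPow V d).carrier) (hv : IsHomog k t v) :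
    (symPow V (d + 1)).act x (smul₂ V d z v) =
      sgn (c * t) • smul₂ V d ((symPow V d).act x z) v + smul₂ V d z (V.act x v) := by
  obtain ⟨y, rfl⟩ := toSym_surjective V d z
  rw [smul₂_toSym, ← toSym_act V d, ← toSym_act V (d + 1), smul₂_toSym, smul₂_toSym, ← map_zsmul,
    ← map_add, tsnoc_act V d hx y hv]

/-- The defining relations concern the last two factors behind an arbitrary prefix, which is exactly
the shape of two successive right multiplications. -/
theorem smul₂_swap (d : ℕ) (z : (symPow V d).carrier) {s t : ZMod 2} {v v' : V.carrier}
    (hv : IsHomog k s v) (hv' : IsHomog k t v') :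
    smul₂ V (d + 1) (smul₂ V d z v) v' = sgn (s * t) • smul₂ V (d + 1) (smul₂ V d z v') v := by
  obtain ⟨y, rfl⟩ := toSym_surjective V d z
  have h : toSym V (d + 2) (tsnoc V (d + 1) (tsnoc V d y v) v' -
      sgn (s * t) • tsnoc V (d + 1) (tsnoc V d y v') v) = 0 :=
    toSym_eq_zero V (relStep_swap (tpow V d) V (symRel V (d + 1)) y hv hv')
  rw [map_sub, map_zsmul, sub_eq_zero] at h
  exact h

theorem smul₂_sq (d : ℕ) (z : (symPow V d).carrier) {v : V.carrier} (hv : IsHomog k 1 v) :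
    smul₂ V (d + 1) (smul₂ V d z v) v = 0 := by
  obtain ⟨y, rfl⟩ := toSym_surjective V d z
  exact toSym_eq_zero V (d := d + 2) (relStep_sq (tpow V d) V (symRel V (d + 1)) y hv)

variable {V} in
/-- The multiplication `(M ⊗ S^d V) ⊗ V → M ⊗ S^{d+1} V`. -/
def mulS (M : GlMod.{u, w₁} k A n) (d : ℕ) :
    (tensor (tensor M (symPow V d)) V).carrier →ₗ[k] (tensor M (symPow V (d + 1))).carrier :=
  tmap LinearMap.id (tlift (smul₂ V d)) ∘ₗ tassoc M (symPow V d) V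

variable (M : GlMod.{u, w₁} k A n)

theorem mulS_tm (d : ℕ) (m : M.carrier) (z : (symPow V d).carrier) (v : V.carrier) :
    mulS M d (tm _ V (tm M _ m z) v) = tm M _ m (smul₂ V d z v) := rfl

theorem mulS_homog (d : ℕ) {s t : ZMod 2} {z : (tensor M (symPow V d)).carrier} {v : V.carrier}
    (hz : IsHomog k s z) (hv : IsHomog k t v) : IsHomog k (s + t) (mulS M d (tm _ V z v)) := by
  have h : IsEven (M := tensor M (symPow V d)) (N := tensor M (symPow V (d + 1)))
      (mulS M d ∘ₗ (tmₗ _ V).flip (proj k 0 v)) := by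
    refine isEven_tensor fun s t m y hm hy => ?_
    change IsHomog k _ (tm M _ m (smul₂ V d y (proj k 0 v)))
    have := tm_homog M (symPow V (d + 1)) hm (smul₂_homog V d hy (isHomog_proj 0 v))
    simpa using this
  -- Multiplication by an odd vector shifts parity, so `isEven_tensor` does not cover it and its
  -- argument is repeated with the shifted target parity.
  have h' : ∀ r, IsHomog k r z → IsHomog k (r + 1) (mulS M d (tm _ V z (proj k 1 v))) := by
    have key : ∀ r, (proj k (r + 1)) ∘ₗ (mulS M d ∘ₗ (tmₗ _ V).flip (proj k 1 v)) ∘ₗ proj k r =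
        (mulS M d ∘ₗ (tmₗ (tensor M (symPow V d)) V).flip (proj k 1 v)) ∘ₗ proj k r := by
      intro r
      refine tensor_hom_ext fun s t m y hm hy => ?_
      simp only [LinearMap.comp_apply, (tm_homog M _ hm hy).proj_eq]
      split_ifs with hr
      · subst hr
        have := tm_homog M (symPow V (d + 1)) hm (smul₂_homog V d hy (isHomog_proj 1 v))
        rw [← add_assoc] at this
        exact this
      · simp
    intro r hr
    have := LinearMap.congr_fun (key r) z
    have hz' : proj k r z = z := hr
    simp only [LinearMap.comp_apply, hz'] at this
    exact this
  have hv' : proj k t v = v := hv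
  rcases parity_cases t with rfl | rfl
  · have := h s z hz
    simp only [LinearMap.comp_apply, LinearMap.flip_apply, hv'] at this
    rw [add_zero]; exact this
  · have := h' s hz
    rwa [hv'] at this

/-- Both sides obey the Leibniz rule, and `X` picks up the same sign whether it passes `y` and `v`
one after the other or passes the product `y v`. That this map is a homomorphism lets the Casimir
map be transported along multiplication. -/
theorem mulS_isHom (d : ℕ) :
    IsHom (tensor (tensor M (symPow V d)) V) (tensor M (symPow V (d + 1))) (mulS M d) := by
  refine isHom_tensor fun c s t x z v hx hz hv => ?_
  -- The summands of `z` need not be homogeneous, so this hypothesis must go before the induction.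
  clear hz
  induction z using tensor_induction with
  | zero => rw [tm_zero_left]; simp only [map_zero]
  | add z z' h h' => rw [tm_add_left]; rw [map_add, map_add, map_add, map_add, h, h']
  | tm m y =>
    have key : ∀ r y, IsHomog k r y → mulS M d ((tensor _ V).act x (tm _ V (tm M _ m y) v)) =
        (tensor M (symPow V (d + 1))).act x (mulS M d (tm _ V (tm M _ m y) v)) := by
      intro r y hy
      rw [tm_act _ V hx _ hv, tm_act M _ hx _ hy, mulS_tm,
        tm_act M _ hx _ (smul₂_homog V d hy hv), smul₂_act V d hx _ hv]
      simp only [tm_add_left, tm_zsmul_left, map_add, map_zsmul, mulS_tm, tm_add_right,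
        tm_zsmul_right, mul_add, sgn_add, smul_add, mul_smul]
      rw [smul_comm (sgn (c * t)) (sgn (c * r))]
      abel
    rw [← proj_add_proj (k := k) y]
    simp only [tm_add_right, tm_add_left, map_add, key _ _ (isHomog_proj _ y)]

end SymAPI

end GlMod

end ThickCasimir

namespace ThickCasimir

namespace GlMod

/-! ### Casimir pairs, the Casimir map, and two successive Casimir maps. -/

section Casimir

variable {k : Type u} [CommRing k] {A : Type u} [NonUnitalRing A] [Module k A]
  [IsScalarTower k A A] [SMulCommClass k A A] [Superalgebra k A] {n : ℕ}

theorem act_mul_sub (N : GlMod.{u, w₁} k A n) {s t : ZMod 2} {x y : Matrix (Fin n) (Fin n) A}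
    (hx : IsHomog k s x) (hy : IsHomog k t y) (m : N.carrier) :
    N.act (x * y) m - sgn (s * t) • N.act (y * x) m =
      N.act y (N.act x m) - sgn (s * t) • N.act x (N.act y m) := by
  rw [← N.act_bracket s t x y m hx hy, superBracket_homog hx hy, map_sub, map_zsmul]
  rfl

/-- A family of linear maps `mat a : V → gl_n(A)` and of vectors `dual a ∈ V` such that the formal
sum `∑ₐ mat a v ⊗ dual a` has the invariance property of the Casimir element of a Frobenius
superalgebra. -/
structure CasimirPair (V : GlMod.{u, u} k A n) (I : Type w) where
  par : I → ZMod 2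
  dual : I → V.carrier
  dual_homog : ∀ a, IsHomog k (par a) (dual a)
  mat : I → V.carrier →ₗ[k] Matrix (Fin n) (Fin n) A
  mat_homog : ∀ a p v, IsHomog k p v → IsHomog k (par a + p) (mat a v)
  mat_mul : ∀ a v X, mat a v * X = mat a (V.act X v)
  finite_act : ∀ w v, {a | V.act (mat a v) w ≠ 0}.Finite
  coef : Matrix (Fin n) (Fin n) A → I → I → k
  coef_row : ∀ X a, {a' | coef X a a' ≠ 0}.Finite
  coef_col : ∀ X a', {a | coef X a a' ≠ 0}.Finite
  coef_par : ∀ c X a a', IsHomog k c X → coef X a a' ≠ 0 → par a = par a' + c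
  act_dual : ∀ X a, V.act X (dual a) = ∑ᶠ a', coef X a a' • dual a'
  mul_mat : ∀ X a' v, X * mat a' v = ∑ᶠ a, coef X a a' • mat a v

variable {V : GlMod.{u, u} k A n} {I : Type w} (K : CasimirPair V I)

namespace CasimirPair

/-- Only finitely many terms of the Casimir sum act nontrivially on a given vector of `N`. -/
def Good (N : GlMod.{u, w₁} k A n) : Prop :=
  ∀ (z : N.carrier) (v : V.carrier), {a | N.act (K.mat a v) z ≠ 0}.Finite

/-- The conclusion is stated for every larger finite set, so that several finiteness conditions can
be met at once by taking a union. -/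
theorem exists_finset {I : Type w} {p : I → Prop} (h : {a | ¬ p a}.Finite) :
    ∃ T : Finset I, ∀ T', T ⊆ T' → ∀ a ∉ T', p a :=
  ⟨h.toFinset, fun T' hT a ha => by
    by_contra hp
    exact ha (hT (h.mem_toFinset.2 hp))⟩

variable {K} in
theorem Good.exists_finset {N : GlMod.{u, w₁} k A n} (hN : K.Good N) (z : N.carrier)
    (v : V.carrier) : ∃ T : Finset I, ∀ T', T ⊆ T' → ∀ a ∉ T', N.act (K.mat a v) z = 0 :=
  CasimirPair.exists_finset (hN z v)

/-- Invariance of the Casimir element: expanding the left side by `act_dual` and the right side by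
`mul_mat` gives the same double sum of coefficients. The weight `σ` stands for any sign depending on
the parity of the index. It is shifted by `c` because a nonzero coefficient relates only indices
whose parities differ by `c`. The two vanishing hypotheses say that `T` contains all relevant
indices on both sides. -/
theorem sum_act_dual {P : Type w₁} [AddCommGroup P] [Module k P]
    (L : Matrix (Fin n) (Fin n) A →ₗ[k] V.carrier →ₗ[k] P) (σ : ZMod 2 → ℤ) {c : ZMod 2}
    {X : Matrix (Fin n) (Fin n) A} (hX : IsHomog k c X) (v : V.carrier) (T : Finset I)
    (h1 : ∀ a ∉ T, L (K.mat a v) = 0) (h2 : ∀ a ∉ T, L (X * K.mat a v) = 0) :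
    ∑ a ∈ T, σ (K.par a) • L (K.mat a v) (V.act X (K.dual a)) =
      ∑ a ∈ T, σ (K.par a + c) • L (X * K.mat a v) (K.dual a) := by
  classical
  -- `T'` also contains every index occurring in the expansion of some `dual a · X` with `a ∈ T`;
  -- the additional terms on the right vanish by `h2`.
  set T' := T ∪ T.biUnion fun a => (K.coef_row X a).toFinset with hT'
  have e1 : ∀ a ∈ T, V.act X (K.dual a) = ∑ a' ∈ T', K.coef X a a' • K.dual a' := by
    intro a ha
    rw [K.act_dual]
    refine finsum_eq_sum_of_support_subset _ fun a' ha' => ?_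
    have : K.coef X a a' ≠ 0 := by
      intro h; exact ha' (by simp [h])
    rw [hT', Finset.mem_coe, Finset.mem_union, Finset.mem_biUnion]
    exact Or.inr ⟨a, ha, (K.coef_row X a).mem_toFinset.2 this⟩
  have e2 : ∀ a', L (X * K.mat a' v) = ∑ a ∈ T, K.coef X a a' • L (K.mat a v) := by
    intro a'
    rw [K.mul_mat, finsum_eq_sum_of_support_subset (s := T ∪ (K.coef_col X a').toFinset), map_sum]
    · simp only [map_smul]
      symm
      refine Finset.sum_subset Finset.subset_union_left fun a _ ha => ?_
      rw [h1 a ha, smul_zero]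
    · intro a ha
      have : K.coef X a a' ≠ 0 := by
        intro h; exact ha (by simp [h])
      rw [Finset.mem_coe, Finset.mem_union]
      exact Or.inr ((K.coef_col X a').mem_toFinset.2 this)
  have e3 : ∑ a ∈ T, σ (K.par a + c) • L (X * K.mat a v) (K.dual a) =
      ∑ a ∈ T', σ (K.par a + c) • L (X * K.mat a v) (K.dual a) := by
    refine Finset.sum_subset Finset.subset_union_left fun a _ ha => ?_
    rw [h2 a ha, LinearMap.zero_apply, smul_zero]
  rw [e3, Finset.sum_congr rfl fun a ha => by rw [e1 a ha]]
  simp only [e2, map_sum, LinearMap.sum_apply, Finset.smul_sum, map_smul, LinearMap.smul_apply]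
  rw [Finset.sum_comm]
  refine Finset.sum_congr rfl fun a' _ => Finset.sum_congr rfl fun a _ => ?_
  by_cases h : K.coef X a a' = 0
  · simp [h]
  · rw [K.coef_par c X a a' hX h]

variable {K}

theorem Good.finite_twist {N : GlMod.{u, w₁} k A n} (hN : K.Good N) (z : N.carrier)
    (v : V.carrier) : {a | N.act (K.mat a (twist k (K.par a) v)) z ≠ 0}.Finite := by
  refine ((hN z (proj k 0 v)).union (hN z (proj k 1 v))).subset fun a ha => ?_
  by_contra h
  simp only [Set.mem_union, Set.mem_ofPred_eq, not_or, not_not] at h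
  refine ha ?_
  simp only [twist, LinearMap.add_apply, LinearMap.smul_apply, map_add, map_zsmul, h.1, h.2,
    smul_zero, add_zero]

/-- The Casimir map `N ⊗ V → N ⊗ V`,
`z ⊗ v ↦ ∑ₐ (-1)^(|a||v|) z · mat a v ⊗ dual a`. -/
noncomputable def omega {N : GlMod.{u, w₁} k A n} (hN : K.Good N) :
    (tensor N V).carrier →ₗ[k] (tensor N V).carrier :=
  -- Finite supports are what makes the sum additive in each argument. Writing the sign as a twist
  -- of `v` makes it linear in `v`, so vectors of mixed parity are covered.
  have fin : ∀ z v, (Function.support fun a =>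
      tm N V (N.act (K.mat a (twist k (K.par a) v)) z) (K.dual a)).Finite := fun z v =>
    (hN.finite_twist z v).subset fun a ha h => ha (by simp only [h, tm_zero_left])
  tlift (LinearMap.mk₂ k
    (fun z v => ∑ᶠ a, tm N V (N.act (K.mat a (twist k (K.par a) v)) z) (K.dual a))
    (fun z z' v => by
      rw [← finsum_add_distrib (fin z v) (fin z' v)]
      simp only [map_add, tm_add_left])
    (fun c z v => by
      rw [smul_finsum' c (fin z v)]
      simp only [map_smul, tm_smul_left])
    (fun z v v' => by
      rw [← finsum_add_distrib (fin z v) (fin z v')]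
      simp only [map_add, LinearMap.add_apply, tm_add_left])
    (fun c z v => by
      rw [smul_finsum' c (fin z v)]
      simp only [map_smul, LinearMap.smul_apply, tm_smul_left]))

theorem omega_tm {N : GlMod.{u, w₁} k A n} (hN : K.Good N) (z : N.carrier) {p : ZMod 2}
    {v : V.carrier} (hv : IsHomog k p v) (T : Finset I)
    (hT : ∀ a ∉ T, N.act (K.mat a v) z = 0) :
    omega hN (tm N V z v) =
      ∑ a ∈ T, sgn (K.par a * p) • tm N V (N.act (K.mat a v) z) (K.dual a) := by
  have h : omega hN (tm N V z v) =
    ∑ᶠ a, tm N V (N.act (K.mat a (twist k (K.par a) v)) z) (K.dual a) := rfl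
  rw [h]
  simp only [hv.twist_eq, map_zsmul, LinearMap.smul_apply, tm_zsmul_left]
  refine finsum_eq_sum_of_support_subset _ fun a ha => ?_
  by_contra haT
  exact ha (by simp only [hT a haT, tm_zero_left, smul_zero])

/-- By the supercommutator relation the action of `X * mat a v` is a combination of the three
actions assumed to vanish, since `mat a v * X = mat a (v · X)`. This supplies the second vanishing
hypothesis of `sum_act_dual`. -/
theorem act_mul_mat_eq_zero (N : GlMod.{u, w₁} k A n) {z : N.carrier} {a : I} {v : V.carrier}
    {p c : ZMod 2} (hv : IsHomog k p v) {X : Matrix (Fin n) (Fin n) A} (hX : IsHomog k c X)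
    (h1 : N.act (K.mat a v) z = 0) (h2 : N.act (K.mat a v) (N.act X z) = 0)
    (h3 : N.act (K.mat a (V.act X v)) z = 0) : N.act (X * K.mat a v) z = 0 := by
  have h := act_mul_sub N hX (K.mat_homog a p v hv) z
  rw [h1, h2, K.mat_mul, h3, map_zero, smul_zero, sub_zero, sub_zero] at h
  exact h

theorem omega_isHom {N : GlMod.{u, w₁} k A n} (hN : K.Good N) :
    IsHom (tensor N V) (tensor N V) (omega hN) := by
  classical
  refine isHom_tensor fun c s p X z v hX _ hv => ?_
  obtain ⟨T1, h1⟩ := hN.exists_finset z v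
  obtain ⟨T2, h2⟩ := hN.exists_finset (N.act X z) v
  obtain ⟨T3, h3⟩ := hN.exists_finset z (V.act X v)
  set T := T1 ∪ T2 ∪ T3
  replace h1 := h1 T (by grind)
  replace h2 := h2 T (by grind)
  replace h3 := h3 T (by grind)
  have hXv := V.act_homog _ _ _ _ hX hv
  -- Invariance turns the terms in which `X` acts on `dual a` into terms with `X * mat a v` acting
  -- on `z`, so that afterwards the two sides can be compared index by index.
  have inv := K.sum_act_dual ((tmₗ N V) ∘ₗ N.act.flip z) (fun q => sgn (q * p)) hX v T
    (fun a ha => by simp [h1 a ha])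
    (fun a ha => by simp [act_mul_mat_eq_zero N hv hX (h1 a ha) (h2 a ha) (h3 a ha)])
  simp only [LinearMap.comp_apply, LinearMap.flip_apply, tmₗ_apply] at inv
  rw [tm_act N V hX z hv, map_add, map_zsmul, omega_tm hN _ hv T h2, omega_tm hN _ hXv T h3,
    omega_tm hN z hv T h1, map_sum]
  simp only [map_zsmul, tm_act N V hX _ (K.dual_homog _), smul_add]
  rw [Finset.sum_add_distrib, inv, Finset.smul_sum, ← Finset.sum_add_distrib,
    ← Finset.sum_add_distrib]
  refine Finset.sum_congr rfl fun a _ => ?_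
  -- For a single index, what is left is the supercommutator relation in `N`; it is solved for the
  -- term in which `X` acts first, and the signs are compared for all parities.
  have h := act_mul_sub N hX (K.mat_homog a p v hv) z
  rw [K.mat_mul] at h
  simp only [← tm_zsmul_left, ← tm_add_left]
  congr 1
  generalize N.act (K.mat a v) (N.act X z) = x1 at *
  generalize N.act X (N.act (K.mat a v) z) = x2 at *
  generalize N.act (X * K.mat a v) z = x3 at *
  generalize N.act (K.mat a (V.act X v)) z = x4 at *
  generalize K.par a = b at *
  have h' : x1 = x3 - sgn (c * (b + p)) • x4 + sgn (c * (b + p)) • x2 := by rw [h]; abel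
  rw [h']
  rcases parity_cases b with rfl | rfl <;> rcases parity_cases p with rfl | rfl <;>
    rcases parity_cases c with rfl | rfl <;>
    simp [sgn, show (1 : ZMod 2) + 1 = 0 by decide] <;> abel

theorem omega_homog {N : GlMod.{u, w₁} k A n} (hN : K.Good N) {s p : ZMod 2} {z : N.carrier}
    {v : V.carrier} (hz : IsHomog k s z) (hv : IsHomog k p v) :
    IsHomog k (s + p) (omega hN (tm N V z v)) := by
  obtain ⟨T, hT⟩ := hN.exists_finset z v
  rw [omega_tm hN z hv T (hT T subset_rfl)]
  refine IsHomog.sum _ _ fun a _ => IsHomog.zsmul ?_ _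
  have := tm_homog N V (N.act_homog _ _ _ _ (K.mat_homog a p v hv) hz) (K.dual_homog a)
  have e : K.par a + p + s + K.par a = s + p := by
    rw [add_right_comm, add_right_comm (K.par a), zmod_two_add_self, zero_add, add_comm]
  rwa [e] at this

/-- Since `φ` commutes with every matrix without a sign, it may be applied term by term. Besides
giving naturality in `M`, this is used with `φ` the multiplication into the next symmetric power. -/
theorem omega_map {N : GlMod.{u, w₁} k A n} {N' : GlMod.{u, w₂} k A n} (hN : K.Good N)
    (hN' : K.Good N') (φ : N.carrier →ₗ[k] N'.carrier) (hφ : IsHom N N' φ)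
    (ζ : (tensor N V).carrier) :
    omega hN' (tmap φ LinearMap.id ζ) = tmap φ LinearMap.id (omega hN ζ) := by
  have key : omega hN' ∘ₗ tmap φ LinearMap.id = tmap φ LinearMap.id ∘ₗ omega hN := by
    refine tensor_hom_ext fun s p z v _ hv => ?_
    obtain ⟨T, hT⟩ := hN.exists_finset z v
    replace hT := hT T subset_rfl
    simp only [LinearMap.comp_apply, tmap_tm, LinearMap.id_apply]
    rw [omega_tm hN z hv T hT, omega_tm hN' (φ z) hv T
      (fun a ha => by rw [← hφ, hT a ha, map_zero])]
    simp only [map_sum, map_zsmul, tmap_tm, LinearMap.id_apply, hφ _ _]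
  exact LinearMap.congr_fun key ζ

/-- By the Leibniz rule an index acting nontrivially on `m ⊗ y` acts nontrivially on `m` or on a
homogeneous component of `y`. Thus the Casimir map exists on all the supermodules met in the
iteration. -/
theorem good_tensor {N : GlMod.{u, w₁} k A n} {P : GlMod.{u, w₂} k A n} (hN : K.Good N)
    (hP : K.Good P) : K.Good (tensor N P) := by
  have key : ∀ p v, IsHomog k p v → ∀ z, {a | (tensor N P).act (K.mat a v) z ≠ 0}.Finite := by
    intro p v hv z
    induction z using tensor_induction with
    | zero => simp
    | add z z' h h' =>
      refine (h.union h').subset fun a ha => ?_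
      by_contra hn
      simp only [Set.mem_union, Set.mem_ofPred_eq, not_or, not_not] at hn
      exact ha (by rw [map_add, hn.1, hn.2, add_zero])
    | tm m y =>
      refine ((hN m v).union ((hP (proj k 0 y) v).union (hP (proj k 1 y) v))).subset fun a ha => ?_
      by_contra hn
      simp only [Set.mem_union, Set.mem_ofPred_eq, not_or, not_not] at hn
      refine ha ?_
      rw [← proj_add_proj (k := k) y, tm_add_right, map_add,
        tm_act _ _ (K.mat_homog a p v hv) _ (isHomog_proj 0 y),
        tm_act _ _ (K.mat_homog a p v hv) _ (isHomog_proj 1 y), hn.1, hn.2.1, hn.2.2]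
      simp only [tm_zero_left, tm_zero_right, smul_zero, add_zero]
  intro z v
  refine ((key 0 _ (isHomog_proj 0 v) z).union (key 1 _ (isHomog_proj 1 v) z)).subset
    fun a ha => ?_
  by_contra hn
  simp only [Set.mem_union, Set.mem_ofPred_eq, not_or, not_not] at hn
  refine ha ?_
  rw [← proj_add_proj (k := k) v, map_add, map_add, LinearMap.add_apply, hn.1, hn.2, add_zero]

theorem good_self : K.Good V := K.finite_act

theorem good_tpow : ∀ d, K.Good (tpow V d)
  | 0 => fun _ _ => Set.finite_empty.subset fun _ ha => ha rfl
  | d + 1 => good_tensor (good_tpow d) good_self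

theorem good_symPow (d : ℕ) : K.Good (symPow V d) := by
  intro z v
  obtain ⟨y, rfl⟩ := toSym_surjective V d z
  refine (good_tpow (K := K) d y v).subset fun a ha h => ha ?_
  rw [← toSym_act V d, h, map_zero]

/-- `z · x y + (-1)^(|x||y|) z · (y x)`, for `x` and `y` of parities `s` and `t`. -/
def symProd (N : GlMod.{u, w₁} k A n) (s t : ZMod 2) (x y : Matrix (Fin n) (Fin n) A)
    (z : N.carrier) : N.carrier :=
  N.act y (N.act x z) + sgn (s * t) • N.act (y * x) z

/-- A rearrangement of the supercommutator relation: `z · x · y` and `z · y · x` differ, up to sign,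
by the action of the supercommutator, and the product terms restore the symmetry. -/
theorem symProd_swap (N : GlMod.{u, w₁} k A n) {s t : ZMod 2} {x y : Matrix (Fin n) (Fin n) A}
    (hx : IsHomog k s x) (hy : IsHomog k t y) (z : N.carrier) :
    symProd N t s y x z = sgn (s * t) • symProd N s t x y z := by
  have h := act_mul_sub N hx hy z
  rw [sub_eq_iff_eq_add] at h
  unfold symProd
  rw [h, mul_comm t s]
  simp only [smul_add, smul_sub, smul_smul, sgn_mul_self, one_smul]
  abel

/-- Supersymmetry would only give twice this identity; it is here that the separate axiom on squares
of odd matrices enters. -/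
theorem symProd_self (N : GlMod.{u, w₁} k A n) {x : Matrix (Fin n) (Fin n) A}
    (hx : IsHomog k 1 x) (z : N.carrier) : symProd N 1 1 x x z = 0 := by
  unfold symProd
  rw [N.act_odd_sq x z hx]
  simp [sgn]

/-- The second Casimir map acts on `N ⊗ V` by the Leibniz rule. Its part on `N` gives `z · x · y`,
and its part on the dual vector becomes, by invariance, the action of the product `y * x`; together
they form `symProd`. The map `G` is a placeholder for multiplication into a symmetric power. -/
theorem omega_omega {N : GlMod.{u, w₁} k A n} (hN : K.Good N) {Q : Type w₂} [AddCommGroup Q]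
    [Module k Q] (G : (tensor (tensor N V) V).carrier →ₗ[k] Q) (z : N.carrier) {p q : ZMod 2}
    {v w : V.carrier} (hv : IsHomog k p v) (hw : IsHomog k q w) (T : Finset I)
    (h1 : ∀ a ∉ T, N.act (K.mat a v) z = 0) (h2 : ∀ a ∉ T, V.act (K.mat a v) w = 0)
    (h3 : ∀ a ∉ T, (tensor N V).act (K.mat a w) (omega hN (tm N V z v)) = 0) :
    G (omega (good_tensor hN good_self) (tm _ V (omega hN (tm N V z v)) w)) =
      ∑ a ∈ T, ∑ c ∈ T, sgn (K.par a * p + K.par c * q + (K.par c + q) * K.par a) •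
        G (tm _ V (tm N V (symProd N (K.par a + p) (K.par c + q) (K.mat a v) (K.mat c w) z)
          (K.dual a)) (K.dual c)) := by
  rw [omega_tm _ _ hw T h3, Finset.sum_comm, map_sum]
  refine Finset.sum_congr rfl fun c _ => ?_
  have hX := K.mat_homog c q w hw
  set X := K.mat c w with hXdef
  have inv := K.sum_act_dual
    (((tmₗ N V) ∘ₗ N.act.flip z).compr₂ (G ∘ₗ (tmₗ (tensor N V) V).flip (K.dual c)))
    (fun r => sgn (r * p)) hX v T
    (fun a ha => by ext; simp [h1 a ha])
    (fun a ha => by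
      ext
      -- Indeed `mat c w * mat a v = mat c (w · mat a v)`, and `mat a v` kills `w` for indices
      -- outside `T`.
      rw [hXdef, K.mat_mul, h2 a ha]
      simp)
  simp only [LinearMap.compr₂_apply, LinearMap.comp_apply, LinearMap.flip_apply, tmₗ_apply] at inv
  rw [omega_tm hN z hv T h1, map_sum]
  simp only [map_zsmul, tm_act N V hX _ (K.dual_homog _), smul_add, tm_sum_left, tm_zsmul_left,
    tm_add_left, map_sum, map_add]
  rw [Finset.sum_add_distrib, inv, ← Finset.sum_add_distrib, Finset.smul_sum]
  refine Finset.sum_congr rfl fun a _ => ?_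
  unfold symProd
  simp only [tm_add_left, tm_zsmul_left, map_add, map_zsmul, smul_add, sgn_smul_smul]
  have e : ∀ a c p q : ZMod 2, (a + (c + q)) * p + c * q =
      a * p + c * q + (c + q) * a + (a + p) * (c + q) := by decide
  rw [← e]
  congr 3 <;> ring

theorem exists_finset_omega {N : GlMod.{u, w₁} k A n} (hN : K.Good N) (z : N.carrier)
    (v w : V.carrier) : ∃ T : Finset I, ∀ T', T ⊆ T' →
      (∀ a ∉ T', N.act (K.mat a v) z = 0) ∧ (∀ a ∉ T', V.act (K.mat a v) w = 0) ∧
      (∀ a ∉ T', (tensor N V).act (K.mat a w) (omega hN (tm N V z v)) = 0) := by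
  classical
  obtain ⟨T1, h1⟩ := hN.exists_finset z v
  obtain ⟨T2, h2⟩ := (good_self (K := K)).exists_finset w v
  obtain ⟨T3, h3⟩ := (good_tensor hN (good_self (K := K))).exists_finset (omega hN (tm N V z v)) w
  exact ⟨T1 ∪ T2 ∪ T3, fun T' hT => ⟨h1 T' (by grind), h2 T' (by grind), h3 T' (by grind)⟩⟩

/-- Exchanging the two summation indices costs one sign from `symProd_swap` and one from the
supersymmetry of `G` in the dual vectors; with the explicit signs these leave only the sign of `v`
and `w`. -/
theorem omega_omega_swap {N : GlMod.{u, w₁} k A n} (hN : K.Good N) {Q : Type w₂}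
    [AddCommGroup Q] [Module k Q] (G : (tensor (tensor N V) V).carrier →ₗ[k] Q)
    (hG : ∀ z s t v w, IsHomog k s v → IsHomog k t w →
      G (tm _ V (tm N V z v) w) = sgn (s * t) • G (tm _ V (tm N V z w) v))
    (z : N.carrier) {p q : ZMod 2} {v w : V.carrier} (hv : IsHomog k p v) (hw : IsHomog k q w) :
    G (omega (good_tensor hN good_self) (tm _ V (omega hN (tm N V z v)) w)) =
      sgn (p * q) •
        G (omega (good_tensor hN good_self) (tm _ V (omega hN (tm N V z w)) v)) := by
  classical
  obtain ⟨T1, hT1⟩ := exists_finset_omega hN z v w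
  obtain ⟨T2, hT2⟩ := exists_finset_omega hN z w v
  obtain ⟨h1, h2, h3⟩ := hT1 (T1 ∪ T2) Finset.subset_union_left
  obtain ⟨h1', h2', h3'⟩ := hT2 (T1 ∪ T2) Finset.subset_union_right
  rw [omega_omega hN G z hv hw _ h1 h2 h3, omega_omega hN G z hw hv _ h1' h2' h3',
    Finset.smul_sum, Finset.sum_comm]
  refine Finset.sum_congr rfl fun c _ => ?_
  rw [Finset.smul_sum]
  refine Finset.sum_congr rfl fun a _ => ?_
  rw [hG _ _ _ _ _ (K.dual_homog a) (K.dual_homog c),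
    symProd_swap N (K.mat_homog a p v hv) (K.mat_homog c q w hw)]
  simp only [tm_zsmul_left, map_zsmul, sgn_smul_smul]
  have e : ∀ a c p q : ZMod 2, a * p + c * q + (c + q) * a + a * c =
      p * q + (c * q + a * p + (a + p) * c + (a + p) * (c + q)) := by decide
  rw [e]

/-- Supersymmetry alone only shows that twice this element vanishes. Here the double sum is
cancelled by the involution exchanging its indices, and the fixed points are treated separately. -/
theorem omega_omega_sq {N : GlMod.{u, w₁} k A n} (hN : K.Good N) {Q : Type w₂}
    [AddCommGroup Q] [Module k Q] (G : (tensor (tensor N V) V).carrier →ₗ[k] Q)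
    (hG : ∀ z s t v w, IsHomog k s v → IsHomog k t w →
      G (tm _ V (tm N V z v) w) = sgn (s * t) • G (tm _ V (tm N V z w) v))
    (hG' : ∀ z v, IsHomog k 1 v → G (tm _ V (tm N V z v) v) = 0)
    (z : N.carrier) {v : V.carrier} (hv : IsHomog k 1 v) :
    G (omega (good_tensor hN good_self) (tm _ V (omega hN (tm N V z v)) v)) = 0 := by
  classical
  obtain ⟨T, hT⟩ := exists_finset_omega hN z v v
  obtain ⟨h1, h2, h3⟩ := hT T subset_rfl
  rw [omega_omega hN G z hv hv _ h1 h2 h3, ← Finset.sum_product']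
  refine Finset.sum_involution (fun x _ => (x.2, x.1)) ?_ ?_ ?_ ?_
  · rintro ⟨a, c⟩ _
    simp only
    rw [hG _ _ _ _ _ (K.dual_homog a) (K.dual_homog c),
      symProd_swap N (K.mat_homog a 1 v hv) (K.mat_homog c 1 v hv)]
    simp only [tm_zsmul_left, map_zsmul, sgn_smul_smul]
    generalize G _ = g
    generalize K.par a = a
    generalize K.par c = c
    rcases parity_cases a with rfl | rfl <;> rcases parity_cases c with rfl | rfl <;>
      simp [sgn, show (1 : ZMod 2) + 1 = 0 by decide]
  · rintro ⟨a, c⟩ _ h hac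
    simp only [Prod.mk.injEq] at hac
    obtain ⟨rfl, -⟩ := hac
    refine h ?_
    have ha := K.mat_homog c 1 v hv
    have hd := K.dual_homog c
    simp only
    -- On the diagonal, an even index makes `mat c v` odd, so `symProd_self` applies; an odd index
    -- makes `dual c` odd, so its square is killed by `G`.
    rcases parity_cases (K.par c) with hc | hc
    · rw [hc] at ha ⊢
      rw [zero_add] at ha ⊢
      rw [symProd_self N ha, tm_zero_left, tm_zero_left, map_zero, smul_zero]
    · rw [hc] at hd
      rw [hG' _ _ hd, smul_zero]
  · rintro ⟨a, c⟩ h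
    simp only [Finset.mem_product] at h ⊢
    exact ⟨h.2, h.1⟩
  · rintro ⟨a, c⟩ _
    rfl

end CasimirPair

end Casimir

end GlMod

end ThickCasimir

namespace ThickCasimir

namespace GlMod

namespace CasimirPair

/-! ### The thick Casimir map and its descent to the symmetric power. -/

section Thick

variable {k : Type u} [CommRing k] {A : Type u} [NonUnitalRing A] [Module k A]
  [IsScalarTower k A A] [SMulCommClass k A A] [Superalgebra k A] {n : ℕ}
  {V : GlMod.{u, u} k A n} {I : Type w} {K : CasimirPair V I}

theorem tsnoc_hom_ext {M : GlMod.{u, w₁} k A n} {d : ℕ} {P : Type w₂} [AddCommGroup P]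
    [Module k P] {f g : (tensor M (tpow V (d + 1))).carrier →ₗ[k] P}
    (h : ∀ s r p m y v, IsHomog k s m → IsHomog k r y → IsHomog k p v →
      f (tm M _ m (tsnoc V d y v)) = g (tm M _ m (tsnoc V d y v))) : f = g := by
  refine tensor_hom_ext fun s t m y hm hy => ?_
  clear hy
  induction y using tpow_succ_induction with
  | zero => simp only [tm_zero_right, map_zero]
  | add y y' h h' => rw [tm_add_right, map_add, map_add, h, h']
  | snoc y v =>
    rw [← proj_add_proj (k := k) y, ← proj_add_proj (k := k) v]
    simp only [map_add, LinearMap.add_apply, tm_add_right,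
      h _ _ _ _ _ _ hm (isHomog_proj _ y) (isHomog_proj _ v)]

/-- The lift `M ⊗ V^{⊗ d} → M ⊗ S^d V` of the thick Casimir map. -/
noncomputable def dmap {M : GlMod.{u, w₁} k A n} (hM : K.Good M) :
    ∀ d, (tensor M (tpow V d)).carrier →ₗ[k] (tensor M (symPow V d)).carrier
  | 0 => tmap LinearMap.id (toSym V 0)
  -- The Casimir map is that of the supermodule `M ⊗ S^d V`, so the matrices of the new factor act
  -- both on `M` and on the dual vectors already produced.
  | d + 1 => mulS M d ∘ₗ omega (good_tensor hM (good_symPow d)) ∘ₗ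
      tmap (dmap hM d) LinearMap.id ∘ₗ tassocSymm M (tpow V d) V

theorem dmap_zero {M : GlMod.{u, w₁} k A n} (hM : K.Good M) (m : M.carrier)
    (y : (tpow V 0).carrier) :
    dmap hM 0 (tm M (tpow V 0) m y) = tm M (symPow V 0) m (toSym V 0 y) := rfl

theorem dmap_tsnoc {M : GlMod.{u, w₁} k A n} (hM : K.Good M) (d : ℕ) (m : M.carrier)
    (y : (tpow V d).carrier) (v : V.carrier) :
    dmap hM (d + 1) (tm M _ m (tsnoc V d y v)) =
      mulS M d (omega (good_tensor hM (good_symPow d)) (tm _ V (dmap hM d (tm M _ m y)) v)) :=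
  rfl

theorem dmap_isHom {M : GlMod.{u, w₁} k A n} (hM : K.Good M) :
    ∀ d, IsHom (tensor M (tpow V d)) (tensor M (symPow V d)) (dmap hM d)
  | 0 => by
    refine isHom_tensor fun c s t x m y hx hm hy => ?_
    rw [tm_act _ _ hx _ hy, map_add, map_zsmul, dmap_zero, dmap_zero, dmap_zero, toSym_act V 0,
      tm_act M (symPow V 0) hx m (toSym_even V 0 _ _ hy)]
  | d + 1 => by
    refine isHom_of_homog fun c x ζ hx => ?_
    have key : dmap hM (d + 1) ∘ₗ (tensor M (tpow V (d + 1))).act x =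
        (tensor M (symPow V (d + 1))).act x ∘ₗ dmap hM (d + 1) := by
      refine tsnoc_hom_ext fun s r p m y v hm hy hv => ?_
      have h := dmap_isHom hM d x (tm M _ m y)
      rw [tm_act M _ hx _ hy] at h
      simp only [LinearMap.comp_apply]
      rw [dmap_tsnoc, ← mulS_isHom, ← omega_isHom, tm_act _ V hx _ hv,
        tm_act M _ hx _ (tsnoc_homog V d hy hv), tsnoc_act V d hx _ hv, ← h]
      simp only [map_add, map_zsmul, tm_add_right, tm_zsmul_right, dmap_tsnoc, tm_add_left,
        tm_zsmul_left, smul_add, sgn_smul_smul]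
      rw [mul_add, add_comm (c * r)]
      abel
    exact LinearMap.congr_fun key ζ

theorem dmap_homog {M : GlMod.{u, w₁} k A n} (hM : K.Good M) :
    ∀ d, IsEven (M := tensor M (tpow V d)) (N := tensor M (symPow V d)) (dmap hM d)
  | 0 => isEven_tensor fun _ _ _ _ hm hy => tm_homog _ _ hm (toSym_even V 0 _ _ hy)
  | d + 1 => by
    intro r ζ hζ
    have key : (proj k r) ∘ₗ dmap hM (d + 1) ∘ₗ (proj k r) = dmap hM (d + 1) ∘ₗ (proj k r) := by
      refine tsnoc_hom_ext fun s t p m y v hm hy hv => ?_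
      have hz := tm_homog M _ hm (tsnoc_homog V d hy hv)
      simp only [LinearMap.comp_apply, hz.proj_eq]
      split_ifs with hr
      · subst hr
        have h1 := dmap_homog hM d _ _ (tm_homog M _ hm hy)
        have h2 := omega_homog (good_tensor hM (good_symPow d)) h1 hv
        have h3 : IsEven (mulS M d) := isEven_tensor fun _ _ _ _ => mulS_homog V M d
        have h4 := h3 _ _ h2
        rw [add_assoc] at h4
        exact h4
      · simp
    have := LinearMap.congr_fun key ζ
    have hz' : proj k r ζ = ζ := hζ
    simp only [LinearMap.comp_apply, hz'] at this
    exact this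

theorem mulS_map {M : GlMod.{u, w₁} k A n} {M' : GlMod.{u, w₂} k A n}
    (φ : M.carrier →ₗ[k] M'.carrier) (d : ℕ) (ζ : (tensor (tensor M (symPow V d)) V).carrier) :
    mulS M' d (tmap (tmap φ LinearMap.id) LinearMap.id ζ) =
      tmap φ LinearMap.id (mulS M d ζ) := by
  induction ζ using tensor_induction with
  | zero => simp only [map_zero]
  | add y y' h h' => rw [map_add, map_add, map_add, map_add, h, h']
  | tm ζ v =>
    induction ζ using tensor_induction with
    | zero => simp only [tm_zero_left, map_zero]
    | add y y' h h' => rw [tm_add_left, map_add, map_add, map_add, map_add, h, h']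
    | tm m y => rfl

/-- Each ingredient of the recursion is natural: the Casimir map by `omega_map`, applied to `φ ⊗ id`
on `M ⊗ S^d V`, and the multiplication by inspection. -/
theorem dmap_map {M : GlMod.{u, w₁} k A n} {M' : GlMod.{u, w₂} k A n} (hM : K.Good M)
    (hM' : K.Good M') (φ : M.carrier →ₗ[k] M'.carrier) (hφ : IsHom M M' φ) :
    ∀ (d : ℕ) (m : M.carrier) (y : (tpow V d).carrier),
      dmap hM' d (tm M' _ (φ m) y) = tmap φ LinearMap.id (dmap hM d (tm M _ m y))
  | 0, m, y => rfl
  | d + 1, m, y => by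
    have hφ' : ∀ e, IsHom (tensor M (symPow V e)) (tensor M' (symPow V e))
        (tmap φ (LinearMap.id (M := (symPow V e).carrier))) := by
      intro e
      refine isHom_tensor fun c s t x m y hx _ hy => ?_
      rw [tm_act M _ hx _ hy, map_add, map_zsmul]
      simp only [tmap_tm, LinearMap.id_apply]
      rw [tm_act M' _ hx _ hy, hφ]
    induction y using tpow_succ_induction with
    | zero => simp only [tm_zero_right, map_zero]
    | add y y' h h' => rw [tm_add_right, tm_add_right, map_add, map_add, map_add, h, h']
    | snoc y v =>
      rw [dmap_tsnoc, dmap_tsnoc, dmap_map hM hM' φ hφ d m y]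
      have h := omega_map (good_tensor hM (good_symPow (K := K) d))
        (good_tensor hM' (good_symPow (K := K) d)) (tmap φ (LinearMap.id (M := (symPow V d).carrier))) (hφ' d)
        (tm _ V (dmap hM d (tm M _ m y)) v)
      rw [tmap_tm, LinearMap.id_apply] at h
      rw [h]
      exact mulS_map φ d _

/-- Naturality of the Casimir map along the multiplication lets both Casimir maps be performed
before both multiplications. This brings two steps of the recursion to the form treated by
`omega_omega_swap` and `omega_omega_sq`. -/
theorem dmap_tsnoc_tsnoc {M : GlMod.{u, w₁} k A n} (hM : K.Good M) (d : ℕ) (m : M.carrier)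
    (y : (tpow V d).carrier) (v v' : V.carrier) :
    dmap hM (d + 2) (tm M _ m (tsnoc V (d + 1) (tsnoc V d y v) v')) =
      (mulS M (d + 1) ∘ₗ tmap (mulS M d) LinearMap.id)
        (omega (good_tensor (good_tensor hM (good_symPow d)) good_self)
          (tm _ V (omega (good_tensor hM (good_symPow d))
            (tm _ V (dmap hM d (tm M _ m y)) v)) v')) := by
  rw [dmap_tsnoc, dmap_tsnoc]
  exact congrArg (mulS M (d + 1)) (omega_map (good_tensor (good_tensor hM (good_symPow d)) good_self)
    (good_tensor hM (good_symPow (d + 1))) (mulS M d) (mulS_isHom V M d) (tm _ V _ v'))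

theorem mulS_mulS_swap {M : GlMod.{u, w₁} k A n} (d : ℕ) (z : (tensor M (symPow V d)).carrier)
    (s t : ZMod 2) (v v' : V.carrier) (hv : IsHomog k s v) (hv' : IsHomog k t v') :
    (mulS M (d + 1) ∘ₗ tmap (mulS M d) LinearMap.id) (tm _ V (tm _ V z v) v') =
      sgn (s * t) •
        (mulS M (d + 1) ∘ₗ tmap (mulS M d) LinearMap.id) (tm _ V (tm _ V z v') v) := by
  induction z using tensor_induction with
  | zero => simp only [tm_zero_left, map_zero, smul_zero]
  | add y y' h h' => simp only [tm_add_left, map_add, h, h', smul_add]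
  | tm m y =>
    change tm M _ m (smul₂ V (d + 1) (smul₂ V d y v) v') =
      _ • tm M _ m (smul₂ V (d + 1) (smul₂ V d y v') v)
    rw [smul₂_swap V d y hv hv', tm_zsmul_right]

theorem mulS_mulS_sq {M : GlMod.{u, w₁} k A n} (d : ℕ) (z : (tensor M (symPow V d)).carrier)
    (v : V.carrier) (hv : IsHomog k 1 v) :
    (mulS M (d + 1) ∘ₗ tmap (mulS M d) LinearMap.id) (tm _ V (tm _ V z v) v) = 0 := by
  induction z using tensor_induction with
  | zero => simp only [tm_zero_left, map_zero]
  | add y y' h h' => rw [tm_add_left, tm_add_left, map_add, h, h', add_zero]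
  | tm m y =>
    change tm M _ m (smul₂ V (d + 1) (smul₂ V d y v) v) = 0
    rw [smul₂_sq V d y hv, tm_zero_right]

/-- Relations in the earlier factors die by induction, as the recursion starts by applying the
previous map to them. Relations in the last two factors die by the supersymmetry of two successive
Casimir maps. -/
theorem dmap_symRel {M : GlMod.{u, w₁} k A n} (hM : K.Good M) :
    ∀ (d : ℕ) (m : M.carrier) (y : (tpow V d).carrier), y ∈ symRel V d →
      dmap hM d (tm M _ m y) = 0
  | 0, m, y, hy => by
    have : y = 0 := (Submodule.mem_bot k).1 hy
    rw [this, tm_zero_right, map_zero]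
  | 1, m, y, hy => by
    have : y = 0 := (Submodule.mem_bot k).1 hy
    rw [this, tm_zero_right, map_zero]
  | d + 2, m, y, hy => by
    have hle : symRel V (d + 2) ≤ LinearMap.ker (dmap hM (d + 2) ∘ₗ tmₗ M (tpow V (d + 2)) m) := by
      refine Submodule.span_le.2 ?_
      have e1 : ∀ r ∈ symRel V (d + 1), ∀ v,
          dmap hM (d + 2) (tm M _ m (tsnoc V (d + 1) r v)) = 0 := by
        intro r hr v
        rw [dmap_tsnoc, dmap_symRel hM (d + 1) m r hr, tm_zero_left, map_zero, map_zero]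
      rintro z ((⟨r, hr, v, rfl⟩ | ⟨y, s, t, v, w, hv, hw, rfl⟩) | ⟨y, v, hv, rfl⟩)
      · exact e1 r hr v
      · change dmap hM (d + 2) (tmₗ M (tpow V (d + 2)) m (tsnoc V (d + 1) (tsnoc V d y v) w -
          sgn (s * t) • tsnoc V (d + 1) (tsnoc V d y w) v)) = 0
        have h := omega_omega_swap (good_tensor hM (good_symPow (K := K) d))
          (mulS M (d + 1) ∘ₗ tmap (mulS M d) LinearMap.id) (mulS_mulS_swap d)
          (dmap hM d (tm M _ m y)) hv hw
        rw [← dmap_tsnoc_tsnoc, ← dmap_tsnoc_tsnoc] at h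
        rw [map_sub, map_sub, map_zsmul, map_zsmul, tmₗ_apply, tmₗ_apply, h, sub_self]
      · change dmap hM (d + 2) (tm M _ m (tsnoc V (d + 1) (tsnoc V d y v) v)) = 0
        rw [dmap_tsnoc_tsnoc]
        exact omega_omega_sq (good_tensor hM (good_symPow (K := K) d))
          (mulS M (d + 1) ∘ₗ tmap (mulS M d) LinearMap.id) (mulS_mulS_swap d) (mulS_mulS_sq d)
          (dmap hM d (tm M _ m y)) hv
    exact hle hy

/-- The thick Casimir map `M ⊗ S^d V → M ⊗ S^d V`. -/
noncomputable def casimir {M : GlMod.{u, w₁} k A n} (hM : K.Good M) (d : ℕ) :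
    (tensor M (symPow V d)).carrier →ₗ[k] (tensor M (symPow V d)).carrier :=
  tlift (LinearMap.flip ((symRel V d).liftQ ((tmₗ M (tpow V d)).compr₂ (dmap hM d)).flip (by
    intro y hy
    refine LinearMap.ext fun m => ?_
    exact dmap_symRel hM d m y hy)))

theorem casimir_tm {M : GlMod.{u, w₁} k A n} (hM : K.Good M) (d : ℕ) (m : M.carrier)
    (y : (tpow V d).carrier) :
    casimir hM d (tm M _ m (toSym V d y)) = dmap hM d (tm M _ m y) := rfl

theorem casimir_isHom {M : GlMod.{u, w₁} k A n} (hM : K.Good M) (d : ℕ) :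
    IsHom (tensor M (symPow V d)) (tensor M (symPow V d)) (casimir hM d) := by
  refine isHom_tensor fun c s t x m z hx _ hz => ?_
  obtain ⟨y, hy, rfl⟩ := exists_homog_lift V hz
  rw [casimir_tm, ← dmap_isHom, tm_act M _ hx _ hz, tm_act M _ hx _ hy, ← toSym_act V d]
  simp only [map_add, map_zsmul, casimir_tm]

theorem casimir_even {M : GlMod.{u, w₁} k A n} (hM : K.Good M) (d : ℕ) :
    IsEven (M := tensor M (symPow V d)) (N := tensor M (symPow V d)) (casimir hM d) := by
  refine isEven_tensor fun s t m z hm hz => ?_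
  obtain ⟨y, hy, rfl⟩ := exists_homog_lift V hz
  rw [casimir_tm]
  exact dmap_homog hM d _ _ (tm_homog M _ hm hy)

theorem casimir_map {M : GlMod.{u, w₁} k A n} {M' : GlMod.{u, w₂} k A n} (hM : K.Good M)
    (hM' : K.Good M') (φ : M.carrier →ₗ[k] M'.carrier) (hφ : IsHom M M' φ) (d : ℕ)
    (ζ : (tensor M (symPow V d)).carrier) :
    casimir hM' d (tmap φ LinearMap.id ζ) = tmap φ LinearMap.id (casimir hM d ζ) := by
  induction ζ using tensor_induction with
  | zero => simp only [map_zero]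
  | add y y' h h' => rw [map_add, map_add, map_add, map_add, h, h']
  | tm m z =>
    obtain ⟨y, rfl⟩ := toSym_surjective V d z
    rw [casimir_tm, ← dmap_map hM hM' φ hφ, tmap_tm, LinearMap.id_apply, casimir_tm]

end Thick

end CasimirPair

end GlMod

end ThickCasimir

namespace ThickCasimir

namespace GlMod

/-! ### Products of vectors: multilinearity, generation, and the Leibniz rule. -/

section Products

variable {k : Type u} [CommRing k] {A : Type u} [NonUnitalRing A] [Module k A]
  [IsScalarTower k A A] [SMulCommClass k A A] [Superalgebra k A] {n : ℕ}
  (V : GlMod.{u, u} k A n)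

theorem tprod_succ (d : ℕ) (v : Fin (d + 1) → V.carrier) :
    tprod V (d + 1) v = tsnoc V d (tprod V d fun j => v j.castSucc) (v (Fin.last d)) := rfl

theorem toSym_tprod (d : ℕ) (v : Fin d → V.carrier) : toSym V d (tprod V d v) = sprod V d v := rfl

theorem sprod_succ (d : ℕ) (v : Fin (d + 1) → V.carrier) :
    sprod V (d + 1) v = smul₂ V d (sprod V d fun j => v j.castSucc) (v (Fin.last d)) := rfl

/-- Linearity in one factor, in the form of a linear map that can be substituted into
`sum_act_dual`. -/
theorem tprod_update (d : ℕ) (v : Fin d → V.carrier) (j : Fin d) :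
    ∃ L : V.carrier →ₗ[k] (tpow V d).carrier, ∀ x, tprod V d (Function.update v j x) = L x := by
  induction d with
  | zero => exact j.elim0
  | succ d ih =>
    induction j using Fin.lastCases with
    | last =>
      refine ⟨tsnoc V d (tprod V d fun j => v j.castSucc), fun x => ?_⟩
      rw [tprod_succ]
      simp
    | cast j =>
      obtain ⟨L, hL⟩ := ih (fun j => v j.castSucc) j
      refine ⟨(tsnoc V d).flip (v (Fin.last d)) ∘ₗ L, fun x => ?_⟩
      rw [tprod_succ, LinearMap.comp_apply, ← hL, LinearMap.flip_apply]
      congr 2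
      · congr 1
        funext i
        by_cases h : i = j
        · subst h; simp
        · rw [Function.update_of_ne h, Function.update_of_ne (by simpa using h)]
      · rw [Function.update_of_ne (Fin.castSucc_ne_last j).symm]

theorem tpow_hom_ext {S : Set V.carrier} (hS : Submodule.span k S = ⊤) {P : Type w}
    [AddCommGroup P] [Module k P] (d : ℕ) : ∀ {f g : (tpow V d).carrier →ₗ[k] P},
    (∀ v, (∀ j, v j ∈ S) → f (tprod V d v) = g (tprod V d v)) → f = g := by
  induction d with
  | zero =>
    intro f g h
    refine LinearMap.ext fun z => ?_
    have hz : z = (show k from z) • tprod V 0 Fin.elim0 := (mul_one (show k from z)).symm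
    rw [hz, map_smul, map_smul, h _ fun j => j.elim0]
  | succ d ih =>
    intro f g h
    have h1 : ∀ v ∈ S, f ∘ₗ (tsnoc V d).flip v = g ∘ₗ (tsnoc V d).flip v := by
      intro v hv
      refine ih fun y hy => ?_
      have := h (Fin.snoc y v) (fun j => by
        induction j using Fin.lastCases with
        | last => simpa using hv
        | cast j => simpa using hy j)
      simpa [tprod_succ] using this
    have h2 : ∀ y, f ∘ₗ tsnoc V d y = g ∘ₗ tsnoc V d y := fun y =>
      LinearMap.ext_on hS fun v hv => LinearMap.congr_fun (h1 v hv) y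
    refine LinearMap.ext fun z => ?_
    induction z using tpow_succ_induction with
    | zero => simp only [map_zero]
    | add z z' hz hz' => rw [map_add, map_add, hz, hz']
    | snoc y v => exact LinearMap.congr_fun (h2 y) v

/-- Products of vectors from a spanning set span the symmetric power; this gives the uniqueness of
the thick Casimir map. -/
theorem tensor_symPow_hom_ext {S : Set V.carrier} (hS : Submodule.span k S = ⊤)
    {M : GlMod.{u, w₁} k A n} {P : Type w}
    [AddCommGroup P] [Module k P] (d : ℕ) {f g : (tensor M (symPow V d)).carrier →ₗ[k] P}
    (h : ∀ m v, (∀ j, v j ∈ S) → f (tm M _ m (sprod V d v)) = g (tm M _ m (sprod V d v))) :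
    f = g := by
  refine tensor_hom_ext fun s t m y _ _ => ?_
  obtain ⟨y, rfl⟩ := toSym_surjective V d y
  have : (f ∘ₗ tmₗ M (symPow V d) m) ∘ₗ toSym V d = (g ∘ₗ tmₗ M (symPow V d) m) ∘ₗ toSym V d :=
    tpow_hom_ext V hS d fun v hv => h m v hv
  exact LinearMap.congr_fun this y

theorem sum_update_add {α : Type w} [Fintype α] [DecidableEq α] (q : α → ZMod 2) (j : α)
    (c : ZMod 2) : ∑ i, Function.update q j (c + q j) i = c + ∑ i, q i := by
  have : Function.update q j (c + q j) = fun i => (if i = j then c else 0) + q i := by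
    funext i
    by_cases h : i = j
    · subst h; simp
    · simp [h]
  rw [this, Finset.sum_add_distrib]
  simp

/-- The product `w_d ⋯ w₁ ∈ S^d V`. -/
def rsprod (d : ℕ) (w : Fin d → V.carrier) : (symPow V d).carrier :=
  sprod V d fun j => w j.rev

theorem rsprod_update (d : ℕ) (w : Fin d → V.carrier) (j : Fin d) :
    ∃ L : V.carrier →ₗ[k] (symPow V d).carrier,
      ∀ x, rsprod V d (Function.update w j x) = L x := by
  obtain ⟨L, hL⟩ := tprod_update V d (fun j => w j.rev) j.rev
  refine ⟨toSym V d ∘ₗ L, fun x => ?_⟩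
  rw [LinearMap.comp_apply, ← hL, toSym_tprod, rsprod]
  congr 1
  funext i
  by_cases h : i = j.rev
  · subst h; simp
  · rw [Function.update_of_ne h, Function.update_of_ne (by rintro rfl; simp at h)]

theorem smul₂_sprod (d : ℕ) (v : Fin d → V.carrier) (q : Fin d → ZMod 2)
    (hv : ∀ j, IsHomog k (q j) (v j)) {p : ZMod 2} {x : V.carrier} (hx : IsHomog k p x) :
    smul₂ V d (sprod V d v) x = sgn (p * ∑ j, q j) • sprod V (d + 1) (Fin.cons x v) := by
  induction d with
  | zero =>
    rw [sprod_succ]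
    simp only [Finset.univ_eq_empty, Finset.sum_empty, mul_zero, sgn_zero, one_smul]
    rfl
  | succ d ih =>
    rw [sprod_succ, smul₂_swap V d _ (hv _) hx, ih _ (fun j => q j.castSucc) (fun j => hv _),
      map_zsmul, LinearMap.smul_apply, sgn_smul_smul, sprod_succ V (d + 1)]
    congr 2
    · rw [Fin.sum_univ_castSucc, mul_add]; ring
    · congr 2
      funext j
      refine Fin.cases ?_ (fun i => ?_) j
      · simp
      · rw [Fin.cons_succ, ← Fin.succ_castSucc, Fin.cons_succ]

/-- The recursion multiplies the newest vector in on the right, whereas the formula lists it first.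
Moving it past all the others produces this sign. -/
theorem rsprod_succ (d : ℕ) (w : Fin (d + 1) → V.carrier) (q : Fin (d + 1) → ZMod 2)
    (hw : ∀ j, IsHomog k (q j) (w j)) :
    smul₂ V d (rsprod V d fun j => w j.castSucc) (w (Fin.last d)) =
      sgn (q (Fin.last d) * ∑ j : Fin d, q j.castSucc) • rsprod V (d + 1) w := by
  unfold rsprod
  rw [smul₂_sprod V d _ (fun j => q j.rev.castSucc) (fun j => hw _) (hw _)]
  congr 2
  · congr 1
    exact Equiv.sum_comp Fin.revPerm fun j => q j.castSucc
  · funext j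
    refine Fin.cases ?_ (fun i => ?_) j
    · simp
    · rw [Fin.cons_succ, Fin.rev_succ]

/-- A matrix acting from the right reaches a factor after passing those to its right. In the
reversed product the factors to the right of the one with index `j` are those with smaller index. -/
theorem rsprod_act (d : ℕ) (w : Fin d → V.carrier) (q : Fin d → ZMod 2)
    (hw : ∀ j, IsHomog k (q j) (w j)) {c : ZMod 2} {X : Matrix (Fin n) (Fin n) A}
    (hX : IsHomog k c X) :
    (symPow V d).act X (rsprod V d w) =
      ∑ j, sgn (c * ∑ l, if l < j then q l else 0) •
        rsprod V d (Function.update w j (V.act X (w j))) := by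
  induction d with
  | zero => rfl
  | succ d ih =>
    have h1 := rsprod_succ V d w q hw
    -- The reordering sign is needed also after `X` has acted on one factor, which changes the
    -- parity of that factor by `c`.
    have h2 : ∀ j : Fin (d + 1), smul₂ V d
        (rsprod V d fun i => Function.update w j (V.act X (w j)) i.castSucc)
        (Function.update w j (V.act X (w j)) (Fin.last d)) =
        sgn (Function.update q j (c + q j) (Fin.last d) *
          ∑ i : Fin d, Function.update q j (c + q j) i.castSucc) •
          rsprod V (d + 1) (Function.update w j (V.act X (w j))) := by
      intro j
      refine rsprod_succ V d _ _ fun i => ?_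
      by_cases h : i = j
      · subst h; simpa using V.act_homog _ _ _ _ hX (hw i)
      · rw [Function.update_of_ne h, Function.update_of_ne h]; exact hw i
    have h3 : rsprod V (d + 1) w = sgn (q (Fin.last d) * ∑ j : Fin d, q j.castSucc) •
        smul₂ V d (rsprod V d fun j => w j.castSucc) (w (Fin.last d)) := by
      rw [h1, smul_smul, sgn_mul_self, one_smul]
    rw [h3, map_zsmul, smul₂_act V d hX _ (hw _), ih _ _ fun j => hw _, Fin.sum_univ_castSucc,
      map_sum, LinearMap.sum_apply, smul_add, Finset.smul_sum, Finset.smul_sum]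
    congr 1
    · refine Finset.sum_congr rfl fun j _ => ?_
      have h := h2 j.castSucc
      have e1 : (fun i : Fin d => Function.update w j.castSucc (V.act X (w j.castSucc)) i.castSucc) =
          Function.update (fun i => w i.castSucc) j (V.act X (w j.castSucc)) := by
        funext i
        by_cases hi : i = j
        · subst hi; simp
        · rw [Function.update_of_ne hi, Function.update_of_ne (by simpa using hi)]
      have e2 : ∑ i : Fin d, Function.update q j.castSucc (c + q j.castSucc) i.castSucc =
          c + ∑ i : Fin d, q i.castSucc := by
        have : (fun i : Fin d => Function.update q j.castSucc (c + q j.castSucc) i.castSucc) =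
            Function.update (fun i => q i.castSucc) j (c + q j.castSucc) := by
          funext i
          by_cases hi : i = j
          · subst hi; simp
          · rw [Function.update_of_ne hi, Function.update_of_ne (by simpa using hi)]
        rw [this, sum_update_add (fun i : Fin d => q i.castSucc) j c]
      rw [e1, e2, Function.update_of_ne (Fin.castSucc_ne_last j).symm,
        Function.update_of_ne (Fin.castSucc_ne_last j).symm] at h
      rw [map_zsmul, LinearMap.smul_apply, h, Fin.sum_univ_castSucc]
      simp only [sgn_smul_smul, Fin.castSucc_lt_castSucc_iff]
      rw [if_neg (by exact not_lt.2 (Fin.le_last _)), add_zero]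
      congr 2
      have : ∀ a b c d : ZMod 2, a * b + (c * a + (c * d + a * (c + b))) = c * d := by decide
      exact this _ _ _ _
    · have h := h2 (Fin.last d)
      have e1 : ∀ {α : Type u} (f : Fin (d + 1) → α) (x : α),
          (fun i : Fin d => Function.update f (Fin.last d) x i.castSucc) =
          fun i => f i.castSucc := by
        intro α f x
        funext i
        rw [Function.update_of_ne (Fin.castSucc_ne_last i)]
      have e2 : (∑ i : Fin d, Function.update q (Fin.last d) (c + q (Fin.last d)) i.castSucc) =
          ∑ i : Fin d, q i.castSucc :=
        Finset.sum_congr rfl fun i _ => by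
          rw [Function.update_of_ne (Fin.castSucc_ne_last i)]
      rw [e1, e2, Function.update_self, Function.update_self] at h
      rw [h, Fin.sum_univ_castSucc]
      simp only [sgn_smul_smul, Fin.castSucc_lt_last, if_true, lt_irrefl, if_false, add_zero]
      congr 2
      have : ∀ a b c : ZMod 2, a * b + (c + a) * b = c * b := by decide
      exact this _ _ _

end Products

end GlMod

end ThickCasimir

namespace ThickCasimir

/-! ### Good ordered partitions: removal of the largest letter, and inversions. -/

section GoodPartitions

variable {d : ℕ}

/-- The good ordered partitions, described as lists of blocks. -/
structure IsGood (L : List (List (Fin d))) : Prop where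
  ne_nil : ∀ w ∈ L, w ≠ []
  nodup : L.flatten.Nodup
  mem : ∀ x, x ∈ L.flatten
  least : ∀ w ∈ L, ∀ a ∈ w, ∀ b ∈ w.getLast?, b ≤ a
  incr : (L.filterMap List.getLast?).Pairwise (· < ·)

/-- Without repeated letters a weak comparison with all entries, including the last one itself,
amounts to a strict comparison with the others. The weak form is easier to transport along
insertions. -/
theorem leastLast_iff {w : List (Fin d)} (hw : w.Nodup) :
    LeastLast w ↔ ∀ a ∈ w, ∀ b ∈ w.getLast?, b ≤ a := by
  rcases List.eq_nil_or_concat w with rfl | ⟨l, c, rfl⟩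
  · simp [LeastLast]
  · rw [List.concat_eq_append, List.nodup_append] at hw
    unfold LeastLast
    simp only [List.concat_eq_append, List.dropLast_concat, List.getLast?_concat, Option.mem_def,
      Option.some.injEq, forall_eq', List.mem_append, List.mem_singleton]
    constructor
    · rintro h a (ha | rfl)
      · exact (h a ha).le
      · exact le_rfl
    · intro h a ha
      exact lt_of_le_of_ne (h a (Or.inl ha)) (hw.2.2 a ha c (by simp)).symm

theorem OrdPart.flatten_parts (u : OrdPart d) : u.parts.flatten = List.ofFn u.1 :=
  List.flatten_splitWrtCompositionAux (by rw [u.2.blocks_sum, List.length_ofFn])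

theorem OrdPart.map_length_parts (u : OrdPart d) : u.parts.map List.length = u.2.blocks :=
  List.map_length_splitWrtCompositionAux (by rw [u.2.blocks_sum, List.length_ofFn])

/-- The permutation is recovered by concatenating the blocks, the composition from their lengths. -/
theorem OrdPart.parts_injective : Function.Injective (OrdPart.parts (d := d)) := by
  intro u u' h
  have h1 := u.flatten_parts
  have h2 := u.map_length_parts
  rw [h, u'.flatten_parts] at h1
  rw [h, u'.map_length_parts] at h2
  exact Prod.ext (Equiv.coe_fn_injective (List.ofFn_injective h1.symm)) (Composition.ext h2.symm)

theorem OrdPart.good_iff (u : OrdPart d) : u.Good ↔ IsGood u.parts := by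
  have hnd : u.parts.flatten.Nodup := by
    rw [u.flatten_parts]; exact List.nodup_ofFn.2 u.1.injective
  have hw : ∀ w ∈ u.parts, w.Nodup := fun w hw => (List.nodup_flatten.1 hnd).1 w hw
  constructor
  · rintro ⟨h1, h2⟩
    refine ⟨fun w hw h => ?_, hnd, fun x => ?_, fun w hm => (leastLast_iff (hw w hm)).1 (h1 w hm), h2⟩
    · have : w.length ∈ u.2.blocks := by
        rw [← u.map_length_parts]; exact List.mem_map_of_mem hw
      have := u.2.blocks_pos this
      simp [h] at this
    · rw [u.flatten_parts, List.mem_ofFn]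
      exact u.1.surjective x
  · intro h
    exact ⟨fun w hm => (leastLast_iff (hw w hm)).2 (h.least w hm), h.incr⟩

theorem IsGood.exists_parts {L : List (List (Fin d))} (h : IsGood L) :
    ∃ u : OrdPart d, u.parts = L := by
  have hlen : L.flatten.length = d := by
    have := Fintype.card_congr (List.Nodup.getEquivOfForallMemList _ h.nodup h.mem)
    simpa using this
  let c : Composition d := ⟨L.map List.length, by
    intro i hi
    obtain ⟨w, hw, rfl⟩ := List.mem_map.1 hi
    exact List.length_pos_of_ne_nil (h.ne_nil w hw), by
    rw [← List.length_flatten, hlen]⟩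
  let u : Equiv.Perm (Fin d) :=
    (finCongr hlen.symm).trans (List.Nodup.getEquivOfForallMemList _ h.nodup h.mem)
  have hu : List.ofFn u = L.flatten := by
    refine List.ext_getElem (by simp [hlen]) fun i h1 h2 => ?_
    simp [u]
  refine ⟨(u, c), ?_⟩
  refine List.eq_iff_flatten_eq.2 ⟨?_, ?_⟩
  · rw [OrdPart.flatten_parts, hu]
  · rw [OrdPart.map_length_parts]

/-- The finite set of good ordered partitions. -/
def goodLists (d : ℕ) : Finset (List (List (Fin d))) :=
  (Finset.univ.filter fun u : OrdPart d => u.Good).image OrdPart.parts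

theorem mem_goodLists {L : List (List (Fin d))} : L ∈ goodLists d ↔ IsGood L := by
  unfold goodLists
  rw [Finset.mem_image]
  constructor
  · rintro ⟨u, hu, rfl⟩
    exact u.good_iff.1 (Finset.mem_filter.1 hu).2
  · intro h
    obtain ⟨u, rfl⟩ := h.exists_parts
    exact ⟨u, by simpa using u.good_iff.2 h, rfl⟩

theorem sum_goodLists {P : Type w} [AddCommMonoid P] (F : List (List (Fin d)) → P) :
    ∑ L ∈ goodLists d, F L = ∑ u : OrdPart d with u.Good, F u.parts :=
  Finset.sum_image fun _ _ _ _ h => OrdPart.parts_injective h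

theorem goodLists_zero : goodLists 0 = {[]} := by
  ext L
  rw [mem_goodLists, Finset.mem_singleton]
  constructor
  · intro h
    rcases L with _ | ⟨w, L⟩
    · rfl
    · rcases w with _ | ⟨a, w⟩
      · exact absurd rfl (h.ne_nil [] (by simp))
      · exact a.elim0
  · rintro rfl
    exact ⟨by simp, by simp, fun x => x.elim0, by simp, by simp⟩

/-- Append the largest letter as a block of its own. -/
def appendLast (L : List (List (Fin d))) : List (List (Fin (d + 1))) :=
  L.map (List.map Fin.castSucc) ++ [[Fin.last d]]

/-- Insert the largest letter in front of the letter `j`. -/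
def insWord (j : Fin d) (w : List (Fin d)) : List (Fin (d + 1)) :=
  w.flatMap fun x => if x = j then [Fin.last d, x.castSucc] else [x.castSucc]

/-- Insert the largest letter in front of the letter `j`, in every block. -/
def insertBefore (j : Fin d) (L : List (List (Fin d))) : List (List (Fin (d + 1))) :=
  L.map (insWord j)

@[simp] theorem insWord_nil (j : Fin d) : insWord j [] = [] := rfl

theorem insWord_cons_self (j : Fin d) (w : List (Fin d)) :
    insWord j (j :: w) = Fin.last d :: j.castSucc :: insWord j w := by
  simp [insWord]

theorem insWord_cons_of_ne {j x : Fin d} (h : x ≠ j) (w : List (Fin d)) :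
    insWord j (x :: w) = x.castSucc :: insWord j w := by
  simp [insWord, h]

theorem mem_insWord {j : Fin d} {w : List (Fin d)} {a : Fin (d + 1)} :
    a ∈ insWord j w ↔ (a = Fin.last d ∧ j ∈ w) ∨ ∃ x ∈ w, x.castSucc = a := by
  induction w with
  | nil => simp
  | cons x w ih =>
    by_cases h : x = j
    · subst h
      rw [insWord_cons_self]
      simp only [List.mem_cons, ih, true_or, and_true, exists_eq_or_imp]
      grind
    · rw [insWord_cons_of_ne h]
      simp only [List.mem_cons, ih, exists_eq_or_imp]
      grind

theorem insWord_of_notMem {j : Fin d} {w : List (Fin d)} (h : j ∉ w) :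
    insWord j w = w.map Fin.castSucc := by
  induction w with
  | nil => rfl
  | cons x w ih =>
    simp only [List.mem_cons, not_or] at h
    rw [insWord_cons_of_ne (Ne.symm h.1), ih h.2, List.map_cons]

theorem insWord_append (j : Fin d) (w w' : List (Fin d)) :
    insWord j (w ++ w') = insWord j w ++ insWord j w' := by
  simp [insWord]

theorem insWord_eq_nil {j : Fin d} {w : List (Fin d)} : insWord j w = [] ↔ w = [] := by
  rcases w with _ | ⟨x, w⟩
  · simp
  · by_cases h : x = j
    · subst h; simp [insWord_cons_self]
    · simp [insWord_cons_of_ne h]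

theorem getLast?_insWord (j : Fin d) (w : List (Fin d)) :
    (insWord j w).getLast? = w.getLast?.map Fin.castSucc := by
  rcases List.eq_nil_or_concat w with rfl | ⟨l, c, rfl⟩
  · rfl
  · rw [List.concat_eq_append, insWord_append, List.getLast?_concat]
    by_cases h : c = j
    · subst h; simp [insWord_cons_self]
    · simp [insWord_cons_of_ne h]

theorem flatten_insertBefore (j : Fin d) (L : List (List (Fin d))) :
    (insertBefore j L).flatten = insWord j L.flatten := by
  induction L with
  | nil => rfl
  | cons w L ih =>
    rw [List.flatten_cons, insWord_append, ← ih]; rfl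

theorem nodup_insWord {j : Fin d} {w : List (Fin d)} : (insWord j w).Nodup ↔ w.Nodup := by
  induction w with
  | nil => simp
  | cons x w ih =>
    by_cases h : x = j
    · subst h
      rw [insWord_cons_self, List.nodup_cons, List.nodup_cons, List.nodup_cons, ih, mem_insWord,
        List.mem_cons, mem_insWord]
      simp [Fin.castSucc_ne_last, (Fin.castSucc_ne_last _).symm]
    · rw [insWord_cons_of_ne h, List.nodup_cons, List.nodup_cons, ih, mem_insWord]
      simp [Fin.castSucc_ne_last]

theorem filterMap_getLast?_insertBefore (j : Fin d) (L : List (List (Fin d))) :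
    (insertBefore j L).filterMap List.getLast? =
      (L.filterMap List.getLast?).map Fin.castSucc := by
  rw [insertBefore, List.filterMap_map, List.map_filterMap]
  congr 1
  funext w
  exact getLast?_insWord j w

/-- The inserted letter always stands in front of another one, so the last entries of the blocks do
not change; being the largest, it does not disturb their minimality. -/
theorem isGood_insertBefore {j : Fin d} {L : List (List (Fin d))} :
    IsGood (insertBefore j L) ↔ IsGood L := by
  constructor
  · intro h
    refine ⟨fun w hw hn => h.ne_nil (insWord j w) (List.mem_map_of_mem hw) (insWord_eq_nil.2 hn),
      ?_, fun x => ?_, fun w hw a ha b hb => ?_, ?_⟩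
    · have := h.nodup
      rwa [flatten_insertBefore, nodup_insWord] at this
    · have := h.mem x.castSucc
      rw [flatten_insertBefore, mem_insWord] at this
      simpa [Fin.castSucc_ne_last] using this
    · have := h.least (insWord j w) (List.mem_map_of_mem hw) a.castSucc
        (mem_insWord.2 (Or.inr ⟨a, ha, rfl⟩)) b.castSucc
        (by rw [getLast?_insWord]; exact Option.mem_map_of_mem _ hb)
      simpa using this
    · have := h.incr
      rw [filterMap_getLast?_insertBefore, List.pairwise_map] at this
      simpa using this
  · intro h
    refine ⟨?_, ?_, fun x => ?_, ?_, ?_⟩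
    · intro w hw hn
      obtain ⟨w', hw', rfl⟩ := List.mem_map.1 hw
      exact h.ne_nil w' hw' (insWord_eq_nil.1 hn)
    · rw [flatten_insertBefore, nodup_insWord]; exact h.nodup
    · rw [flatten_insertBefore, mem_insWord]
      induction x using Fin.lastCases with
      | last => exact Or.inl ⟨rfl, h.mem j⟩
      | cast x => exact Or.inr ⟨x, h.mem x, rfl⟩
    · intro w hw a ha b hb
      obtain ⟨w', hw', rfl⟩ := List.mem_map.1 hw
      rw [getLast?_insWord, Option.mem_map] at hb
      obtain ⟨b, hb, rfl⟩ := hb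
      rcases mem_insWord.1 ha with ⟨rfl, -⟩ | ⟨a, ha', rfl⟩
      · exact Fin.le_last _
      · exact Fin.castSucc_le_castSucc_iff.2 (h.least w' hw' a ha' b hb)
    · rw [filterMap_getLast?_insertBefore, List.pairwise_map]
      simpa using h.incr

theorem flatten_appendLast (L : List (List (Fin d))) :
    (appendLast L).flatten = L.flatten.map Fin.castSucc ++ [Fin.last d] := by
  simp [appendLast, List.map_flatten]

theorem filterMap_getLast?_appendLast (L : List (List (Fin d))) :
    (appendLast L).filterMap List.getLast? =
      (L.filterMap List.getLast?).map Fin.castSucc ++ [Fin.last d] := by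
  rw [appendLast, List.filterMap_append, List.filterMap_map, List.map_filterMap]
  congr 1
  congr 1
  funext w
  simp

theorem isGood_appendLast {L : List (List (Fin d))} : IsGood (appendLast L) ↔ IsGood L := by
  have hmem : ∀ {w}, w ∈ L → w.map Fin.castSucc ∈ appendLast L := fun hw =>
    List.mem_append.2 (Or.inl (List.mem_map_of_mem hw))
  have hnd : (appendLast L).flatten.Nodup ↔ L.flatten.Nodup := by
    rw [flatten_appendLast, List.nodup_append]
    simp only [List.nodup_map_iff (Fin.castSucc_injective d)]
    simp only [List.mem_map, List.mem_singleton, List.nodup_singleton, true_and]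
    refine and_iff_left ?_
    rintro _ ⟨x, -, rfl⟩ _ rfl
    exact Fin.castSucc_ne_last x
  have hinc : ((appendLast L).filterMap List.getLast?).Pairwise (· < ·) ↔
      (L.filterMap List.getLast?).Pairwise (· < ·) := by
    rw [filterMap_getLast?_appendLast, List.pairwise_append, List.pairwise_map]
    simp only [Fin.castSucc_lt_castSucc_iff, List.pairwise_singleton, true_and]
    refine and_iff_left ?_
    intro a ha b hb
    obtain ⟨x, -, rfl⟩ := List.mem_map.1 ha
    rw [List.mem_singleton.1 hb]
    exact Fin.castSucc_lt_last x
  constructor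
  · intro h
    refine ⟨fun w hw hn => h.ne_nil _ (hmem hw) (by simp [hn]), hnd.1 h.nodup, fun x => ?_,
      fun w hw a ha b hb => ?_, hinc.1 h.incr⟩
    · have := h.mem x.castSucc
      rw [flatten_appendLast] at this
      simpa [Fin.castSucc_ne_last] using this
    · have := h.least _ (hmem hw) a.castSucc (List.mem_map_of_mem ha) b.castSucc
        (by rw [List.getLast?_map]; exact Option.mem_map_of_mem _ hb)
      simpa using this
  · intro h
    refine ⟨?_, hnd.2 h.nodup, fun x => ?_, ?_, hinc.2 h.incr⟩
    · intro w hw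
      rcases List.mem_append.1 hw with hw | hw
      · obtain ⟨w', hw', rfl⟩ := List.mem_map.1 hw
        simpa using h.ne_nil w' hw'
      · rw [List.mem_singleton.1 hw]; simp
    · rw [flatten_appendLast, List.mem_append]
      induction x using Fin.lastCases with
      | last => simp
      | cast x => exact Or.inl (List.mem_map_of_mem (h.mem x))
    · intro w hw a ha b hb
      rcases List.mem_append.1 hw with hw | hw
      · obtain ⟨w', hw', rfl⟩ := List.mem_map.1 hw
        rw [List.getLast?_map, Option.mem_map] at hb
        obtain ⟨b, hb, rfl⟩ := hb
        obtain ⟨a, ha', rfl⟩ := List.mem_map.1 ha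
        exact Fin.castSucc_le_castSucc_iff.2 (h.least w' hw' a ha' b hb)
      · rw [List.mem_singleton.1 hw] at ha
        rw [List.mem_singleton.1 ha]
        exact Fin.le_last b

theorem appendLast_injective : Function.Injective (appendLast (d := d)) := by
  intro L L' h
  exact List.map_injective_iff.2 (List.map_injective_iff.2 (Fin.castSucc_injective d))
    (List.append_cancel_right h)

theorem insWord_left_inj {j j' : Fin d} {w : List (Fin d)} (hj : j ∈ w)
    (h : insWord j w = insWord j' w) : j = j' := by
  induction w with
  | nil => simp at hj
  | cons x w ih =>
    by_cases h1 : x = j <;> by_cases h2 : x = j'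
    · rw [← h1, ← h2]
    · subst h1
      rw [insWord_cons_self, insWord_cons_of_ne h2, List.cons.injEq] at h
      exact absurd h.1.symm (Fin.castSucc_ne_last x)
    · subst h2
      rw [insWord_cons_self, insWord_cons_of_ne h1, List.cons.injEq] at h
      exact absurd h.1 (Fin.castSucc_ne_last x)
    · rw [insWord_cons_of_ne h1, insWord_cons_of_ne h2, List.cons.injEq] at h
      exact ih (by simpa [Ne.symm h1] using hj) h.2

/-- Remove the largest letter. -/
def removeLast (w : List (Fin (d + 1))) : List (Fin d) :=
  w.filterMap fun x => if h : x = Fin.last d then none else some (x.castPred h)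

theorem removeLast_insWord (j : Fin d) (w : List (Fin d)) : removeLast (insWord j w) = w := by
  induction w with
  | nil => rfl
  | cons x w ih =>
    unfold removeLast at ih ⊢
    by_cases h : x = j
    · subst h
      rw [insWord_cons_self, List.filterMap_cons_none (by simp),
        List.filterMap_cons_some (b := x) (by simp [Fin.castSucc_ne_last]), ih]
    · rw [insWord_cons_of_ne h,
        List.filterMap_cons_some (b := x) (by simp [Fin.castSucc_ne_last]), ih]

/-- Deleting the largest letter recovers the partition, and `j` is the letter that follows it. -/
theorem insertBefore_inj {j j' : Fin d} {L L' : List (List (Fin d))} (hL : IsGood L)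
    (h : insertBefore j L = insertBefore j' L') : L = L' ∧ j = j' := by
  have h1 : L = L' := by
    have := congrArg (List.map removeLast) h
    simpa [insertBefore, Function.comp_def, removeLast_insWord] using this
  subst h1
  refine ⟨rfl, ?_⟩
  have h2 := congrArg List.flatten h
  rw [flatten_insertBefore, flatten_insertBefore] at h2
  exact insWord_left_inj (hL.mem j) h2

theorem appendLast_ne_insertBefore (L L' : List (List (Fin d))) (j : Fin d) :
    appendLast L ≠ insertBefore j L' := by
  intro h
  have h1 := congrArg List.flatten h
  rw [flatten_appendLast, flatten_insertBefore] at h1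
  have h2 := congrArg List.getLast? h1
  rw [List.getLast?_concat, getLast?_insWord] at h2
  rcases h3 : L'.flatten.getLast? with _ | x
  · simp [h3] at h2
  · rw [h3, Option.map_some, Option.some.injEq] at h2
    exact Fin.castSucc_ne_last x h2.symm

theorem exists_map_castSucc {w : List (Fin (d + 1))} (h : Fin.last d ∉ w) :
    ∃ w' : List (Fin d), w = w'.map Fin.castSucc := by
  induction w with
  | nil => exact ⟨[], rfl⟩
  | cons x w ih =>
    simp only [List.mem_cons, not_or] at h
    obtain ⟨w', rfl⟩ := ih h.2
    exact ⟨x.castPred (Ne.symm h.1) :: w', by simp⟩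

theorem exists_map_map_castSucc {L : List (List (Fin (d + 1)))} (h : Fin.last d ∉ L.flatten) :
    ∃ L' : List (List (Fin d)), L = L'.map (List.map Fin.castSucc) := by
  induction L with
  | nil => exact ⟨[], rfl⟩
  | cons w L ih =>
    rw [List.flatten_cons, List.mem_append, not_or] at h
    obtain ⟨L', rfl⟩ := ih h.2
    obtain ⟨w', rfl⟩ := exists_map_castSucc h.1
    exact ⟨w' :: L', by simp⟩

theorem map_insWord_of_notMem {j : Fin d} {L : List (List (Fin d))} (h : j ∉ L.flatten) :
    L.map (insWord j) = L.map (List.map Fin.castSucc) :=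
  List.map_congr_left fun w hw => insWord_of_notMem fun hj =>
    h (List.mem_flatten.2 ⟨w, hw, hj⟩)

/-- The alternative is whether the largest letter ends its block. If it does, minimality of last
entries leaves no other letter in the block, and the increase of last entries leaves no later block.
If it does not, some letter `j` follows it in its block. -/
theorem IsGood.eq_appendLast_or {L : List (List (Fin (d + 1)))} (h : IsGood L) :
    (∃ L', L = appendLast L') ∨ ∃ j L', L = insertBefore j L' := by
  obtain ⟨w, hw, hlw⟩ := List.mem_flatten.1 (h.mem (Fin.last d))
  obtain ⟨L₁, L₂, rfl⟩ := List.append_of_mem hw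
  obtain ⟨w₁, w₂, rfl⟩ := List.append_of_mem hlw
  have hnd := h.nodup
  simp only [List.flatten_append, List.flatten_cons, List.append_assoc, List.cons_append] at hnd
  have hnd' : (L₁.flatten ++ (w₁ ++ (w₂ ++ L₂.flatten))).Nodup ∧
      Fin.last d ∉ L₁.flatten ++ (w₁ ++ (w₂ ++ L₂.flatten)) := by
    have hp : (L₁.flatten ++ (w₁ ++ Fin.last d :: (w₂ ++ L₂.flatten))).Perm
        (Fin.last d :: (L₁.flatten ++ (w₁ ++ (w₂ ++ L₂.flatten)))) := by
      rw [← List.append_assoc, ← List.append_assoc L₁.flatten]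
      exact List.perm_middle
    have := hp.nodup_iff.1 hnd
    rw [List.nodup_cons] at this
    exact ⟨this.2, this.1⟩
  obtain ⟨hnd1, hnl⟩ := hnd'
  simp only [List.mem_append, not_or] at hnl
  obtain ⟨hl1, hl2, hl3, hl4⟩ := hnl
  obtain ⟨L₁, rfl⟩ := exists_map_map_castSucc hl1
  obtain ⟨L₂, rfl⟩ := exists_map_map_castSucc hl4
  obtain ⟨w₁, rfl⟩ := exists_map_castSucc hl2
  obtain ⟨w₂, rfl⟩ := exists_map_castSucc hl3
  rcases w₂ with _ | ⟨j, w₂⟩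
  · left
    have hw1 : w₁ = [] := by
      rcases w₁ with _ | ⟨a, w₁⟩
      · rfl
      · have := h.least _ hw a.castSucc (by simp) (Fin.last d)
          (by rw [List.map_nil, List.getLast?_concat]; rfl)
        exact absurd this (not_le.2 (Fin.castSucc_lt_last a))
    subst hw1
    -- The last entry of a following block would have to exceed the largest letter.
    have hL2 : L₂ = [] := by
      rcases L₂ with _ | ⟨w', L₂⟩
      · rfl
      · have hne : w' ≠ [] := by
          have := h.ne_nil (w'.map Fin.castSucc) (by simp)
          simpa using this
        have hi := h.incr
        rcases List.eq_nil_or_concat w' with rfl | ⟨l, c, rfl⟩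
        · exact absurd rfl hne
        · rw [List.filterMap_append] at hi
          have hi2 := (List.pairwise_append.1 hi).2.1
          simp only [List.map_nil, List.nil_append, List.map_cons, List.concat_eq_append,
            List.map_append] at hi2
          rw [List.filterMap_cons_some (b := Fin.last d) (by simp),
            List.filterMap_cons_some (b := c.castSucc) (by simp), List.pairwise_cons] at hi2
          exact absurd (hi2.1 _ List.mem_cons_self) (not_lt.2 (Fin.le_last _))
    subst hL2
    exact ⟨L₁, by simp [appendLast]⟩
  · right
    refine ⟨j, L₁ ++ (w₁ ++ j :: w₂) :: L₂, ?_⟩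
    have hnd2 : (L₁.flatten ++ (w₁ ++ (j :: w₂ ++ L₂.flatten))).Nodup := by
      rw [← List.nodup_map_iff (Fin.castSucc_injective d)]
      simpa [List.map_flatten] using hnd1
    have hp : (L₁.flatten ++ (w₁ ++ (j :: w₂ ++ L₂.flatten))).Perm
        (j :: (L₁.flatten ++ (w₁ ++ (w₂ ++ L₂.flatten)))) := by
      rw [← List.append_assoc, ← List.append_assoc L₁.flatten, List.cons_append]
      exact List.perm_middle
    -- As `j` occurs only once, insertion in front of `j` affects no other place in the word and no
    -- other block.
    have h3 := (List.nodup_cons.1 (hp.nodup_iff.1 hnd2)).1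
    simp only [List.mem_append, not_or] at h3
    rw [insertBefore, List.map_append (f := insWord j), List.map_cons (f := insWord j), map_insWord_of_notMem h3.1,
      map_insWord_of_notMem h3.2.2.2, insWord_append, insWord_cons_self,
      insWord_of_notMem h3.2.1, insWord_of_notMem h3.2.2.1]
    simp

/-- This recursion mirrors the Leibniz rule on `M ⊗ S^d V`: one term for the action on `M`, and one
for the action on each of the `d` dual vectors. -/
theorem sum_goodLists_succ {P : Type w} [AddCommMonoid P] (F : List (List (Fin (d + 1))) → P) :
    ∑ L ∈ goodLists (d + 1), F L =
      ∑ L ∈ goodLists d, (F (appendLast L) + ∑ j, F (insertBefore j L)) := by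
  have h : goodLists (d + 1) = (goodLists d).image appendLast ∪
      (goodLists d ×ˢ Finset.univ).image fun p => insertBefore p.2 p.1 := by
    ext L
    simp only [Finset.mem_union, Finset.mem_image, mem_goodLists, Finset.mem_product,
      Finset.mem_univ, and_true, Prod.exists]
    constructor
    · intro hL
      rcases hL.eq_appendLast_or with ⟨L', rfl⟩ | ⟨j, L', rfl⟩
      · exact Or.inl ⟨L', isGood_appendLast.1 hL, rfl⟩
      · exact Or.inr ⟨L', j, isGood_insertBefore.1 hL, rfl⟩
    · rintro (⟨L', hL, rfl⟩ | ⟨L', j, hL, rfl⟩)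
      · exact isGood_appendLast.2 hL
      · exact isGood_insertBefore.2 hL
  rw [h, Finset.sum_union, Finset.sum_image, Finset.sum_image, Finset.sum_product,
    Finset.sum_add_distrib]
  · rintro ⟨L, j⟩ hL ⟨L', j'⟩ _ hh
    obtain ⟨h1, h2⟩ := insertBefore_inj (mem_goodLists.1 (Finset.mem_product.1 hL).1) hh
    exact Prod.ext h1 h2
  · exact fun _ _ _ _ h => appendLast_injective h
  · rw [Finset.disjoint_left]
    intro L h1 h2
    obtain ⟨L1, -, rfl⟩ := Finset.mem_image.1 h1
    obtain ⟨L2, -, h2⟩ := Finset.mem_image.1 h2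
    exact appendLast_ne_insertBefore _ _ _ h2.symm

/-- The sum of `q a * q b` over the inversions `b < a` of a word. -/
def invList (q : Fin d → ZMod 2) : List (Fin d) → ZMod 2
  | [] => 0
  | a :: l => (l.map fun b => if b < a then q a * q b else 0).sum + invList q l

theorem invList_ofFn (q : Fin d → ZMod 2) : ∀ {m : ℕ} (f : Fin m → Fin d),
    ∑ i, ∑ j, (if i < j ∧ f j < f i then q (f i) * q (f j) else 0) = invList q (List.ofFn f)
  | 0, f => rfl
  | m + 1, f => by
    rw [List.ofFn_succ, invList, ← invList_ofFn q fun i => f i.succ, Fin.sum_univ_succ]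
    congr 1
    · rw [Fin.sum_univ_succ, List.map_ofFn, List.sum_ofFn]
      simp
    · refine Finset.sum_congr rfl fun i _ => ?_
      rw [Fin.sum_univ_succ]
      simp

theorem inversionParity_eq (u : OrdPart d) (q : Fin d → ZMod 2) :
    inversionParity u.1 q = invList q u.parts.flatten := by
  rw [OrdPart.flatten_parts, ← invList_ofFn]
  rfl

theorem invList_map_castSucc (q : Fin (d + 1) → ZMod 2) (l : List (Fin d)) :
    invList q (l.map Fin.castSucc) = invList (fun x => q x.castSucc) l := by
  induction l with
  | nil => rfl
  | cons a l ih => simp [invList, ih, Function.comp_def]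

theorem invList_concat_last (q : Fin (d + 1) → ZMod 2) (l : List (Fin d)) :
    invList q (l.map Fin.castSucc ++ [Fin.last d]) = invList (fun x => q x.castSucc) l := by
  induction l with
  | nil => simp [invList]
  | cons a l ih =>
    simp [invList, ih, Function.comp_def, not_lt.2 (Fin.le_last _)]

theorem sum_map_update {l : List (Fin d)} {p : Fin d → Prop} [DecidablePred p] (q : Fin d → ZMod 2)
    (j : Fin d) (c x : ZMod 2) (hl : l.Nodup) :
    (l.map fun b => if p b then x * Function.update q j (c + q j) b else 0).sum =
      (l.map fun b => if p b then x * q b else 0).sum + if j ∈ l ∧ p j then x * c else 0 := by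
  induction l with
  | nil => simp
  | cons a l ih =>
    rw [List.nodup_cons] at hl
    simp only [List.map_cons, List.sum_cons, ih hl.2]
    by_cases h : a = j
    · subst h
      by_cases hp : p a <;> simp [hl.1, hp]
      ring
    · rw [Function.update_of_ne h]
      simp only [List.mem_cons, Ne.symm h, false_or]
      ring

theorem invList_update_of_notMem (q : Fin d → ZMod 2) {j : Fin d} (x : ZMod 2) {l : List (Fin d)}
    (h : j ∉ l) : invList (Function.update q j x) l = invList q l := by
  induction l with
  | nil => rfl
  | cons a l ih =>
    simp only [List.mem_cons, not_or] at h
    simp only [invList, ih h.2]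
    congr 2
    refine List.map_congr_left fun b hb => ?_
    rw [Function.update_of_ne (Ne.symm h.1), Function.update_of_ne (by rintro rfl; exact h.2 hb)]

/-- The word is compared with the one in which the largest letter has been merged into `j`. A letter
`x > j` after `j` forms an inversion with the largest letter but not with its merged image; for `x >
j` before `j` it is the other way round. Modulo two both cases contribute the same, and the largest
letter also forms an inversion with `j` itself. Hence the correction depends only on which letters
occur, not on their order. -/
theorem invList_insWord (q : Fin (d + 1) → ZMod 2) (j : Fin d) {l : List (Fin d)} (hl : l.Nodup) :
    invList q (insWord j l) =
      invList (Function.update (fun x => q x.castSucc) j (q (Fin.last d) + q j.castSucc)) l +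
        if j ∈ l then q (Fin.last d) * (l.map fun x => if j ≤ x then q x.castSucc else 0).sum
        else 0 := by
  induction l with
  | nil => rfl
  | cons a l ih =>
    rw [List.nodup_cons] at hl
    by_cases h : a = j
    · subst h
      rw [insWord_cons_self, insWord_of_notMem hl.1]
      simp only [invList, invList_map_castSucc, invList_update_of_notMem _ _ hl.1, List.map_cons,
        List.sum_cons, List.map_map, Function.comp_def, Fin.castSucc_lt_last, if_true,
        Fin.castSucc_lt_castSucc_iff, List.mem_cons, true_or, le_refl, Function.update_self]
      have e1 : (l.map fun b => if b < a then (q (Fin.last d) + q a.castSucc) *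
          Function.update (fun x => q x.castSucc) a (q (Fin.last d) + q a.castSucc) b else 0).sum =
          (l.map fun b => if b < a then (q (Fin.last d) + q a.castSucc) * q b.castSucc
            else 0).sum := by
        congr 1
        refine List.map_congr_left fun b hb => ?_
        rw [Function.update_of_ne (by rintro rfl; exact hl.1 hb)]
      have e2 : (l.map fun b => if b < a then (q (Fin.last d) + q a.castSucc) * q b.castSucc
            else 0).sum + q (Fin.last d) * (l.map fun x => if a ≤ x then q x.castSucc else 0).sum =
          (l.map fun b => q (Fin.last d) * q b.castSucc).sum +
            (l.map fun b => if b < a then q a.castSucc * q b.castSucc else 0).sum := by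
        rw [← List.sum_map_mul_left, ← List.sum_map_add, ← List.sum_map_add]
        congr 1
        refine List.map_congr_left fun b _ => ?_
        by_cases hb : b < a
        · simp [hb, not_le.2 hb]; ring
        · simp [hb, not_lt.1 hb]
      rw [e1]
      linear_combination -e2
    · rw [insWord_cons_of_ne h]
      simp only [invList, ih hl.2, List.map_cons, List.sum_cons, Function.update_of_ne h,
        List.mem_cons, Ne.symm h, false_or]
      have e1 : ((insWord j l).map fun b => if b < a.castSucc then q a.castSucc * q b else 0).sum =
          (l.map fun b => if b < a then q a.castSucc * q b.castSucc else 0).sum := by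
        clear ih
        induction l with
        | nil => rfl
        | cons b l ih =>
          simp only [List.nodup_cons, List.mem_cons, not_or] at hl
          have ih' := ih ⟨hl.1.2, hl.2.2⟩
          by_cases hb : b = j
          · subst hb
            simp [insWord_cons_self, ih', not_lt.2 (Fin.le_last _)]
          · simp [insWord_cons_of_ne hb, ih']
      rw [e1, sum_map_update (fun x => q x.castSucc) j (q (Fin.last d)) (q a.castSucc) hl.2]
      by_cases hj : j ∈ l
      · by_cases hja : j < a
        · simp only [hj, hja, hja.le, true_and, if_true]
          have := zmod_two_add_self (q a.castSucc * q (Fin.last d))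
          linear_combination -this
        · have : ¬ j ≤ a := fun h' => hja (lt_of_le_of_ne h' (Ne.symm h))
          simp only [hj, hja, this, true_and, if_true, if_false, add_zero, zero_add]
          ring
      · simp only [hj, false_and, if_false, add_zero]

theorem IsGood.sum_map {L : List (List (Fin d))} (h : IsGood L) (f : Fin d → ZMod 2) :
    (L.flatten.map f).sum = ∑ x, f x := by
  rw [← List.sum_toFinset f h.nodup]
  congr 1
  ext x
  simpa using List.mem_flatten.1 (h.mem x)

/-- All letters occur exactly once, so the correction term becomes independent of the partition. -/
theorem IsGood.invList_insertBefore {L : List (List (Fin d))} (h : IsGood L)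
    (q : Fin (d + 1) → ZMod 2) (j : Fin d) :
    invList q (insertBefore j L).flatten =
      invList (Function.update (fun x => q x.castSucc) j (q (Fin.last d) + q j.castSucc))
        L.flatten + q (Fin.last d) * ∑ x : Fin d, if j ≤ x then q x.castSucc else 0 := by
  rw [flatten_insertBefore, invList_insWord q j h.nodup, if_pos (h.mem j), h.sum_map]

theorem invList_appendLast (q : Fin (d + 1) → ZMod 2) (L : List (List (Fin d))) :
    invList q (appendLast L).flatten = invList (fun x => q x.castSucc) L.flatten := by
  rw [flatten_appendLast, invList_concat_last]

end GoodPartitions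

end ThickCasimir

/-! ### Sums over tuples and parities of pairings. -/

namespace ThickCasimir

/-- Fubini along one coordinate: invariance of the Casimir element compares sums over a single
index, the other indices being fixed. -/
theorem sum_pi_congr_update {T : Type w} [Fintype T] [DecidableEq T] {d : ℕ} {P : Type w₁}
    [AddCommMonoid P] (j : Fin d) (F G : (Fin d → T) → P)
    (h : ∀ a, ∑ e, F (Function.update a j e) = ∑ e, G (Function.update a j e)) :
    ∑ a, F a = ∑ a, G a := by
  rcases isEmpty_or_nonempty T with hT | ⟨⟨t⟩⟩
  · exact Finset.sum_congr rfl fun a _ => isEmptyElim (a j)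
  · have key : ∀ F : (Fin d → T) → P, ∑ a, F a = ∑ b : { i // i ≠ j } → T, ∑ e : T,
        F (Function.update ((Equiv.funSplitAt j T).symm (t, b)) j e) := by
      intro F
      rw [← (Equiv.funSplitAt j T).symm.sum_comp, Fintype.sum_prod_type_right]
      refine Finset.sum_congr rfl fun b _ => Finset.sum_congr rfl fun e _ => congrArg F ?_
      funext i
      by_cases hi : i = j
      · subst hi; simp
      · simp [hi]
    rw [key F, key G]
    exact Finset.sum_congr rfl fun b _ => h _

theorem sum_pi_subtype {I : Type w} {d : ℕ} {P : Type w₁} [AddCommMonoid P] (T : Finset I)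
    (F : (Fin d → I) → P) (hF : ∀ a, F a ≠ 0 → ∀ j, a j ∈ T) :
    ∑ᶠ a, F a = ∑ a : Fin d → T, F fun j => (a j : I) := by
  classical
  rw [finsum_eq_sum_of_support_subset (s := Fintype.piFinset fun _ => T)]
  · symm
    refine Finset.sum_bij (fun a _ j => (a j : I)) ?_ ?_ ?_ ?_
    · intro a _
      exact Fintype.mem_piFinset.2 fun j => (a j).2
    · intro a _ a' _ h
      funext j
      exact Subtype.ext (congrFun h j)
    · intro a ha
      exact ⟨fun j => ⟨a j, Fintype.mem_piFinset.1 ha j⟩, Finset.mem_univ _, rfl⟩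
    · intro a _
      rfl
  · intro a ha
    exact Fintype.mem_piFinset.2 (hF a ha)

section Parities

variable {d : ℕ}

theorem pairingParity_castSucc (p q : Fin (d + 1) → ZMod 2) :
    pairingParity p q = pairingParity (fun j => p j.castSucc) (fun j => q j.castSucc) +
      p (Fin.last d) * ∑ j : Fin d, q j.castSucc + p (Fin.last d) * q (Fin.last d) := by
  unfold pairingParity
  simp only [Fin.sum_univ_castSucc, Fin.castSucc_le_castSucc_iff, Fin.le_last, if_true,
    Finset.sum_add_distrib, Finset.mul_sum]
  have : ∀ j : Fin d, ¬ Fin.last d ≤ j.castSucc := fun j => not_le.2 (Fin.castSucc_lt_last j)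
  simp only [this, if_false, Finset.sum_const_zero, zero_add, add_assoc, mul_comm]

/-- The change in the pairing sign when the index at `j` absorbs a matrix of parity `c`, as happens
in `sum_sum_insertBefore`. -/
theorem pairingParity_update (p q : Fin d → ZMod 2) (j : Fin d) (c : ZMod 2) :
    pairingParity p (Function.update q j (c + q j)) =
      pairingParity p q + c * ∑ l, if j ≤ l then p l else 0 := by
  have : Function.update q j (c + q j) = fun i => (if i = j then c else 0) + q i := by
    funext i
    by_cases h : i = j
    · subst h; simp
    · simp [h]
  unfold pairingParity
  rw [this]
  have e : ∀ i l : Fin d, (if i ≤ l then ((if i = j then c else 0) + q i) * p l else 0) =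
      (if i ≤ l then q i * p l else 0) + if i = j then (if j ≤ l then c * p l else 0) else 0 := by
    intro i l
    by_cases h : i = j
    · subst h
      by_cases h' : i ≤ l <;> simp [h']
      ring
    · simp [h]
  simp only [e, Finset.sum_add_distrib]
  congr 1
  rw [Finset.sum_comm, Finset.mul_sum]
  refine Finset.sum_congr rfl fun l _ => ?_
  simp

theorem sum_lt_add_sum_le (q : Fin d → ZMod 2) (j : Fin d) :
    (∑ l, if l < j then q l else 0) + (∑ l, if j ≤ l then q l else 0) = ∑ l, q l := by
  rw [← Finset.sum_add_distrib]
  refine Finset.sum_congr rfl fun l _ => ?_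
  by_cases h : l < j
  · simp [h, not_le.2 h]
  · simp [h, not_lt.1 h]

end Parities

namespace GlMod

/-! ### Products of matrices along words and their successive action. -/

section Words

variable {k : Type u} [CommRing k] {A : Type u} [NonUnitalRing A] [Module k A]
  [IsScalarTower k A A] [SMulCommClass k A A] [Superalgebra k A] {n d : ℕ}

/-- The product of the matrices indexed by the letters of a nonempty word. -/
def wordProd (X : Fin d → Matrix (Fin n) (Fin n) A) : List (Fin d) → Matrix (Fin n) (Fin n) A
  | [] => 0
  | [j] => X j
  | j :: j' :: w => X j * wordProd X (j' :: w)

theorem wordProd_cons (X : Fin d → Matrix (Fin n) (Fin n) A) (j : Fin d) {w : List (Fin d)}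
    (hw : w ≠ []) : wordProd X (j :: w) = X j * wordProd X w := by
  cases w with
  | nil => exact absurd rfl hw
  | cons _ _ => rfl

theorem wordMat_eq (g : Fin d → A) (r t : Fin d → Fin n) (w : List (Fin d)) :
    wordMat g r t w = wordProd (fun j => Matrix.single (r j) (t j) (g j)) w := by
  induction w with
  | nil => rfl
  | cons j w ih =>
    cases w with
    | nil => rfl
    | cons j' w => exact congrArg _ ih

theorem wordProd_map {e : ℕ} (X : Fin e → Matrix (Fin n) (Fin n) A) (f : Fin d → Fin e)
    (w : List (Fin d)) : wordProd X (w.map f) = wordProd (fun j => X (f j)) w := by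
  induction w with
  | nil => rfl
  | cons j w ih =>
    cases w with
    | nil => rfl
    | cons j' w => exact congrArg _ ih

/-- Inserting the largest letter in front of `j` has the same effect as multiplying the matrix of
`j` on the left by that of the largest letter, which is the shape that invariance produces. -/
theorem wordProd_insWord (X : Fin (d + 1) → Matrix (Fin n) (Fin n) A) (j : Fin d)
    (w : List (Fin d)) : wordProd X (insWord j w) =
      wordProd (Function.update (fun i => X i.castSucc) j (X (Fin.last d) * X j.castSucc)) w := by
  induction w with
  | nil => rfl
  | cons a w ih =>
    by_cases h : a = j
    · subst h
      rw [insWord_cons_self, wordProd_cons _ _ (by simp)]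
      by_cases hw : w = []
      · subst hw; simp [wordProd]
      · rw [wordProd_cons _ _ (by simpa [insWord_eq_nil] using hw), wordProd_cons _ _ hw, ih,
          Function.update_self, mul_assoc]
    · rw [insWord_cons_of_ne h]
      by_cases hw : w = []
      · subst hw; simp [wordProd, h]
      · rw [wordProd_cons _ _ (by simpa [insWord_eq_nil] using hw), wordProd_cons _ _ hw, ih,
          Function.update_of_ne h]

theorem wordProd_update_of_notMem (X : Fin d → Matrix (Fin n) (Fin n) A) {j : Fin d}
    (y : Matrix (Fin n) (Fin n) A) {w : List (Fin d)} (h : j ∉ w) :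
    wordProd (Function.update X j y) w = wordProd X w := by
  induction w with
  | nil => rfl
  | cons a w ih =>
    simp only [List.mem_cons, not_or] at h
    by_cases hw : w = []
    · subst hw; simp [wordProd, Ne.symm h.1]
    · rw [wordProd_cons _ _ hw, wordProd_cons _ _ hw, ih h.2, Function.update_of_ne (Ne.symm h.1)]

theorem wordProd_update (X : Fin d → Matrix (Fin n) (Fin n) A) {j : Fin d} {w : List (Fin d)}
    (hw : w.Nodup) (h : j ∈ w) :
    ∃ f : Matrix (Fin n) (Fin n) A →ₗ[k] Matrix (Fin n) (Fin n) A,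
      ∀ y, wordProd (Function.update X j y) w = f y := by
  induction w with
  | nil => simp at h
  | cons a w ih =>
    rw [List.nodup_cons] at hw
    by_cases ha : a = j
    · subst ha
      by_cases hn : w = []
      · subst hn
        exact ⟨LinearMap.id, fun y => by simp [wordProd]⟩
      · refine ⟨LinearMap.mulRight k (wordProd X w), fun y => ?_⟩
        rw [wordProd_cons _ _ hn, wordProd_update_of_notMem _ _ hw.1, Function.update_self]
        rfl
    · have hj : j ∈ w := by simpa [Ne.symm ha] using h
      obtain ⟨f, hf⟩ := ih hw.2 hj
      refine ⟨LinearMap.mulLeft k (X a) ∘ₗ f, fun y => ?_⟩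
      rw [wordProd_cons _ _ (List.ne_nil_of_mem hj), hf, Function.update_of_ne ha]
      rfl

variable (M : GlMod.{u, w₁} k A n)

/-- The successive action of the products indexed by a list of words. -/
def listAct (X : Fin d → Matrix (Fin n) (Fin n) A) (L : List (List (Fin d))) (m : M.carrier) :
    M.carrier :=
  L.foldl (fun m w => M.act (wordProd X w) m) m

theorem listAct_cons (X : Fin d → Matrix (Fin n) (Fin n) A) (w : List (Fin d))
    (L : List (List (Fin d))) (m : M.carrier) :
    listAct M X (w :: L) m = listAct M X L (M.act (wordProd X w) m) := rfl

theorem partsAct_eq (g : Fin d → A) (r t : Fin d → Fin n) (u : OrdPart d) (m : M.carrier) :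
    partsAct M g r t u m = listAct M (fun j => Matrix.single (r j) (t j) (g j)) u.parts m := by
  unfold partsAct listAct
  congr 1
  funext m w
  rw [wordMat_eq]

theorem listAct_appendLast (X : Fin (d + 1) → Matrix (Fin n) (Fin n) A) (L : List (List (Fin d)))
    (m : M.carrier) : listAct M X (appendLast L) m =
      M.act (X (Fin.last d)) (listAct M (fun j => X j.castSucc) L m) := by
  unfold listAct appendLast
  rw [List.foldl_append, List.foldl_map]
  simp only [wordProd_map]
  rfl

theorem listAct_insertBefore (X : Fin (d + 1) → Matrix (Fin n) (Fin n) A) (j : Fin d)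
    (L : List (List (Fin d))) (m : M.carrier) : listAct M X (insertBefore j L) m =
      listAct M (Function.update (fun i => X i.castSucc) j (X (Fin.last d) * X j.castSucc)) L m := by
  unfold listAct insertBefore
  rw [List.foldl_map]
  simp only [wordProd_insWord]

/-- `listAct` as a linear map. -/
def listActₗ (X : Fin d → Matrix (Fin n) (Fin n) A) (L : List (List (Fin d))) :
    M.carrier →ₗ[k] M.carrier where
  toFun := listAct M X L
  map_add' := by
    induction L with
    | nil => intros; rfl
    | cons w L ih => intro m m'; simp only [listAct_cons, map_add, ih]
  map_smul' := by
    induction L with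
    | nil => intros; rfl
    | cons w L ih => intro c m; simp only [listAct_cons, map_smul, ih]

theorem listAct_zero (X : Fin d → Matrix (Fin n) (Fin n) A) (L : List (List (Fin d))) :
    listAct M X L 0 = 0 := map_zero (listActₗ M X L)

theorem listAct_update_of_notMem (X : Fin d → Matrix (Fin n) (Fin n) A) {j : Fin d}
    (y : Matrix (Fin n) (Fin n) A) {L : List (List (Fin d))} (h : j ∉ L.flatten) (m : M.carrier) :
    listAct M (Function.update X j y) L m = listAct M X L m := by
  induction L generalizing m with
  | nil => rfl
  | cons w L ih =>
    simp only [List.flatten_cons, List.mem_append, not_or] at h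
    rw [listAct_cons, listAct_cons, ih h.2, wordProd_update_of_notMem _ _ h.1]

/-- The letter `j` occurs exactly once, so the action is linear in its matrix; both a repetition and
an absence of `j` would destroy this. -/
theorem listAct_update (X : Fin d → Matrix (Fin n) (Fin n) A) {j : Fin d}
    {L : List (List (Fin d))} (hL : L.flatten.Nodup) (h : j ∈ L.flatten) (m : M.carrier) :
    ∃ f : Matrix (Fin n) (Fin n) A →ₗ[k] M.carrier,
      ∀ y, listAct M (Function.update X j y) L m = f y := by
  induction L generalizing m with
  | nil => simp at h
  | cons w L ih =>
    rw [List.flatten_cons, List.nodup_append] at hL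
    rw [List.flatten_cons, List.mem_append] at h
    by_cases hj : j ∈ w
    · have hj' : j ∉ L.flatten := fun h' => hL.2.2 j hj j h' rfl
      obtain ⟨f, hf⟩ := wordProd_update (k := k) X hL.1 hj
      refine ⟨listActₗ M X L ∘ₗ M.act.flip m ∘ₗ f, fun y => ?_⟩
      rw [listAct_cons, hf, listAct_update_of_notMem M X y hj']
      rfl
    · obtain ⟨f, hf⟩ := ih hL.2.1 (h.resolve_left hj) (M.act (wordProd X w) m)
      refine ⟨f, fun y => ?_⟩
      rw [listAct_cons, wordProd_update_of_notMem _ _ hj, hf]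

end Words

namespace CasimirPair

/-! ### Finiteness of the sums over basis elements. -/

section Finiteness

variable {k : Type u} [CommRing k] {A : Type u} [NonUnitalRing A] [Module k A]
  [IsScalarTower k A A] [SMulCommClass k A A] [Superalgebra k A] {n d : ℕ}
  {V : GlMod.{u, u} k A n} {I : Type w} {K : CasimirPair V I}

variable (K) in
theorem finite_wordProd (v : Fin d → V.carrier) (T : Finset I) (w : List (Fin d)) :
    {Y | ∃ b : Fin d → I, (∀ x ∈ w, b x ∈ T) ∧
      Y = wordProd (fun j => K.mat (b j) (v j)) w}.Finite := by
  induction w with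
  | nil => exact (Set.finite_singleton 0).subset (by rintro Y ⟨b, -, rfl⟩; rfl)
  | cons j w ih =>
    have hT : ((fun a => K.mat a (v j)) '' T).Finite := T.finite_toSet.image _
    by_cases hw : w = []
    · refine hT.subset ?_
      rintro Y ⟨b, hb, rfl⟩
      subst hw
      exact ⟨b j, hb j (by simp), rfl⟩
    · refine (hT.image2 (· * ·) ih).subset ?_
      rintro Y ⟨b, hb, rfl⟩
      rw [wordProd_cons _ _ hw]
      exact Set.mem_image2_of_mem ⟨b j, hb j (by simp), rfl⟩
        ⟨b, fun x hx => hb x (List.mem_cons_of_mem _ hx), rfl⟩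

/-- Since `mat (b j) (v j) * Y = mat (b j) (v j · Y)`, a nonzero action forces `v j · Y ≠ 0`, which
bounds the indices in the tail. Then only finitely many `Y` occur, and for each of them goodness of
`N` bounds the first index. -/
theorem exists_finset_wordProd_cons {N : GlMod.{u, w₁} k A n} (hN : K.Good N) (z : N.carrier)
    (v : Fin d → V.carrier) (j : Fin d) (w : List (Fin d))
    (h : ∃ T : Finset I, ∀ b : Fin d → I, V.act (wordProd (fun j => K.mat (b j) (v j)) w) (v j) ≠ 0 →
      ∀ x ∈ w, b x ∈ T) :
    ∃ T : Finset I, ∀ b : Fin d → I,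
      N.act (wordProd (fun j => K.mat (b j) (v j)) (j :: w)) z ≠ 0 → ∀ x ∈ j :: w, b x ∈ T := by
  classical
  by_cases hw : w = []
  · subst hw
    refine ⟨(hN z (v j)).toFinset, fun b hb x hx => ?_⟩
    rw [List.mem_singleton.1 hx]
    exact (hN z (v j)).mem_toFinset.2 hb
  · obtain ⟨T, hT⟩ := h
    have hfin := (finite_wordProd K v T w).biUnion fun Y _ => hN z (V.act Y (v j))
    refine ⟨T ∪ hfin.toFinset, fun b hb => ?_⟩
    have hb' := hb
    rw [wordProd_cons _ _ hw, K.mat_mul] at hb'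
    have h1 : ∀ x ∈ w, b x ∈ T := hT b fun h => hb' (by rw [h, map_zero, map_zero]; rfl)
    intro x hx
    rw [Finset.mem_union]
    rcases List.mem_cons.1 hx with rfl | hx
    · exact Or.inr (hfin.mem_toFinset.2 (Set.mem_biUnion ⟨b, h1, rfl⟩ hb'))
    · exact Or.inl (h1 x hx)

theorem exists_finset_wordProd {N : GlMod.{u, w₁} k A n} (hN : K.Good N) (z : N.carrier)
    (v : Fin d → V.carrier) (w : List (Fin d)) :
    ∃ T : Finset I, ∀ b : Fin d → I,
      N.act (wordProd (fun j => K.mat (b j) (v j)) w) z ≠ 0 → ∀ x ∈ w, b x ∈ T := by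
  -- Only the first letter of a word meets `N`; the tail acts on a vector of `V`, so the induction
  -- along the word takes place in `V`.
  have hV : ∀ (w : List (Fin d)) (z : V.carrier), ∃ T : Finset I, ∀ b : Fin d → I,
      V.act (wordProd (fun j => K.mat (b j) (v j)) w) z ≠ 0 → ∀ x ∈ w, b x ∈ T := by
    intro w
    induction w with
    | nil => exact fun z => ⟨∅, by simp⟩
    | cons j w ih => exact fun z => exists_finset_wordProd_cons K.finite_act z v j w (ih (v j))
  cases w with
  | nil => exact ⟨∅, by simp⟩
  | cons j w => exact exists_finset_wordProd_cons hN z v j w (hV w (v j))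

/-- The first block bounds its own indices, hence leaves only finitely many vectors on which the
remaining blocks act, and the induction applies to each of these. -/
theorem exists_finset_listAct {M : GlMod.{u, w₁} k A n} (hM : K.Good M) (m : M.carrier)
    (v : Fin d → V.carrier) (L : List (List (Fin d))) :
    ∃ T : Finset I, ∀ b : Fin d → I,
      listAct M (fun j => K.mat (b j) (v j)) L m ≠ 0 → ∀ x ∈ L.flatten, b x ∈ T := by
  classical
  induction L generalizing m with
  | nil => exact ⟨∅, by simp⟩
  | cons w L ih =>
    choose T hT using ih
    obtain ⟨T₁, hT₁⟩ := exists_finset_wordProd hM m v w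
    have hfin := (finite_wordProd K v T₁ w).image fun Y => T (M.act Y m)
    refine ⟨T₁ ∪ hfin.toFinset.biUnion id, fun b hb => ?_⟩
    rw [listAct_cons] at hb
    have h1 := hT₁ b fun h => hb (by rw [h, listAct_zero])
    have h2 := hT _ b hb
    intro x hx
    rw [List.flatten_cons, List.mem_append] at hx
    rw [Finset.mem_union, Finset.mem_biUnion]
    rcases hx with hx | hx
    · exact Or.inl (h1 x hx)
    · exact Or.inr ⟨_, hfin.mem_toFinset.2 ⟨_, ⟨b, h1, rfl⟩, rfl⟩, h2 x hx⟩

theorem exists_finset_goodLists {M : GlMod.{u, w₁} k A n} (hM : K.Good M) (m : M.carrier)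
    (v : Fin d → V.carrier) : ∃ T : Finset I, ∀ L ∈ goodLists d, ∀ b : Fin d → I,
      listAct M (fun j => K.mat (b j) (v j)) L m ≠ 0 → ∀ x, b x ∈ T := by
  classical
  choose T hT using exists_finset_listAct hM m v
  refine ⟨(goodLists d).biUnion T, fun L hL b hb x => ?_⟩
  exact Finset.mem_biUnion.2 ⟨L, hL, hT L b hb x ((mem_goodLists.1 hL).mem x)⟩

end Finiteness

end CasimirPair

end GlMod

end ThickCasimir

namespace ThickCasimir

namespace GlMod

namespace CasimirPair

/-! ### The explicit formula. -/

section Formula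

variable {k : Type u} [CommRing k] {A : Type u} [NonUnitalRing A] [Module k A]
  [IsScalarTower k A A] [SMulCommClass k A A] [Superalgebra k A] {n d : ℕ}
  {V : GlMod.{u, u} k A n} {I : Type w} (K : CasimirPair V I)

/-- The parity of the sign in the thick Casimir map. -/
def signParity (p q : Fin d → ZMod 2) (L : List (List (Fin d))) : ZMod 2 :=
  pairingParity p q + invList (fun j => q j + p j) L.flatten

/-- The terms on the right are, in turn, the sign of the previous step, the sign of the new Casimir
map, the sign of the new matrix passing all dual vectors on its way to `M`, and the sign of
reordering the product. -/
theorem signParity_appendLast (p q : Fin (d + 1) → ZMod 2) (L : List (List (Fin d))) :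
    signParity p q (appendLast L) =
      signParity (fun j => p j.castSucc) (fun j => q j.castSucc) L +
        q (Fin.last d) * p (Fin.last d) +
        (q (Fin.last d) + p (Fin.last d)) * (∑ j : Fin d, q j.castSucc) +
        q (Fin.last d) * ∑ j : Fin d, q j.castSucc := by
  unfold signParity
  rw [pairingParity_castSucc, invList_appendLast]
  have := zmod_two_add_self (q (Fin.last d) * ∑ j : Fin d, q j.castSucc)
  linear_combination -this

/-- The index at `j` takes on the parity of the new matrix because invariance has shifted it, and
the new matrix passes only the dual vectors of smaller index. The corrections to pairing and
inversions combine with the sums over `l < j` and over `j ≤ l` so that everything else occurs twice.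
-/
theorem signParity_insertBefore (p q : Fin (d + 1) → ZMod 2) {L : List (List (Fin d))}
    (hL : IsGood L) (j : Fin d) :
    signParity p q (insertBefore j L) =
      signParity (fun i => p i.castSucc) (Function.update (fun i => q i.castSucc) j
        (q (Fin.last d) + p (Fin.last d) + q j.castSucc)) L +
        q (Fin.last d) * p (Fin.last d) +
        (q (Fin.last d) + p (Fin.last d)) * (∑ l : Fin d, if l < j then q l.castSucc else 0) +
        q (Fin.last d) * ∑ l : Fin d, q l.castSucc := by
  unfold signParity
  set g := q (Fin.last d) + p (Fin.last d) with hg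
  have e1 : (fun i => Function.update (fun i : Fin d => q i.castSucc) j (g + q j.castSucc) i +
      p i.castSucc) = Function.update (fun i : Fin d => q i.castSucc + p i.castSucc) j
        (g + (q j.castSucc + p j.castSucc)) := by
    funext i
    by_cases h : i = j
    · subst h; simp [add_assoc]
    · simp [h]
  rw [pairingParity_castSucc, hL.invList_insertBefore, e1,
    pairingParity_update (fun i => p i.castSucc) (fun i => q i.castSucc), ← hg]
  have e2 : (∑ x : Fin d, if j ≤ x then q x.castSucc + p x.castSucc else 0) =
      (∑ x : Fin d, if j ≤ x then q x.castSucc else 0) +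
        ∑ x : Fin d, if j ≤ x then p x.castSucc else 0 := by
    rw [← Finset.sum_add_distrib]
    refine Finset.sum_congr rfl fun x _ => ?_
    split_ifs <;> simp
  have e3 := sum_lt_add_sum_le (fun x : Fin d => q x.castSucc) j
  rw [e2, ← e3]
  set a := ∑ x : Fin d, if x < j then q x.castSucc else 0
  set b := ∑ x : Fin d, if j ≤ x then q x.castSucc else 0
  have h1 := zmod_two_add_self (q (Fin.last d) * a)
  have h2 := zmod_two_add_self (p (Fin.last d) * b)
  rw [hg]
  linear_combination h2 - h1

/-- The summands of the thick Casimir map. -/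
def term (M : GlMod.{u, w₁} k A n) (m : M.carrier) (v : Fin d → V.carrier) (p : Fin d → ZMod 2)
    (b : Fin d → I) (L : List (List (Fin d))) : (tensor M (symPow V d)).carrier :=
  sgn (signParity p (fun j => K.par (b j)) L) •
    tm M _ (listAct M (fun j => K.mat (b j) (v j)) L m) (rsprod V d fun j => K.dual (b j))

theorem rsprod_homog (d : ℕ) (w : Fin d → V.carrier) (q : Fin d → ZMod 2)
    (hw : ∀ j, IsHomog k (q j) (w j)) : IsHomog k (∑ j, q j) (rsprod V d w) := by
  induction d with
  | zero =>
    have : IsHomog k 0 (tprod V 0 fun j : Fin 0 => w j.rev) := rfl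
    exact toSym_even V 0 _ _ this
  | succ d ih =>
    have h := rsprod_succ V d w q hw
    have h' : rsprod V (d + 1) w = sgn (q (Fin.last d) * ∑ j : Fin d, q j.castSucc) •
        smul₂ V d (rsprod V d fun j => w j.castSucc) (w (Fin.last d)) := by
      rw [h, smul_smul, sgn_mul_self, one_smul]
    rw [h', Fin.sum_univ_castSucc]
    exact IsHomog.zsmul (smul₂_homog V d (ih _ _ fun j => hw _) (hw _)) _

theorem mulS_term_appendLast {M : GlMod.{u, w₁} k A n} (m : M.carrier)
    (v : Fin (d + 1) → V.carrier) (p : Fin (d + 1) → ZMod 2)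
    (b : Fin (d + 1) → I) (L : List (List (Fin d))) :
    sgn (signParity (fun j => p j.castSucc) (fun j : Fin d => K.par (b j.castSucc)) L +
        K.par (b (Fin.last d)) * p (Fin.last d) +
        (K.par (b (Fin.last d)) + p (Fin.last d)) * ∑ j : Fin d, K.par (b j.castSucc)) •
      tm M _ (M.act (K.mat (b (Fin.last d)) (v (Fin.last d)))
        (listAct M (fun j : Fin d => K.mat (b j.castSucc) (v j.castSucc)) L m))
        (smul₂ V d (rsprod V d fun j => K.dual (b j.castSucc)) (K.dual (b (Fin.last d)))) =
      K.term M m v p b (appendLast L) := by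
  have h := rsprod_succ V d (fun j => K.dual (b j)) (fun j => K.par (b j))
    fun j => K.dual_homog (b j)
  rw [h, tm_zsmul_right, sgn_smul_smul, term, listAct_appendLast, signParity_appendLast]

theorem mulS_term_insertBefore {M : GlMod.{u, w₁} k A n} (m : M.carrier)
    (v : Fin (d + 1) → V.carrier) (p : Fin (d + 1) → ZMod 2)
    (b : Fin (d + 1) → I) {L : List (List (Fin d))} (hL : IsGood L) (j : Fin d) :
    sgn (signParity (fun j => p j.castSucc) (Function.update (fun i : Fin d => K.par (b i.castSucc)) j
        (K.par (b (Fin.last d)) + p (Fin.last d) + K.par (b j.castSucc))) L +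
        K.par (b (Fin.last d)) * p (Fin.last d) +
        (K.par (b (Fin.last d)) + p (Fin.last d)) *
          ∑ l : Fin d, if l < j then K.par (b l.castSucc) else 0) •
      tm M _ (listAct M (Function.update (fun j : Fin d => K.mat (b j.castSucc) (v j.castSucc)) j
          (K.mat (b (Fin.last d)) (v (Fin.last d)) * K.mat (b j.castSucc) (v j.castSucc))) L m)
        (smul₂ V d (rsprod V d fun j => K.dual (b j.castSucc)) (K.dual (b (Fin.last d)))) =
      K.term M m v p b (insertBefore j L) := by
  have h := rsprod_succ V d (fun j => K.dual (b j)) (fun j => K.par (b j))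
    fun j => K.dual_homog (b j)
  rw [h, tm_zsmul_right, sgn_smul_smul, term, listAct_insertBefore, signParity_insertBefore _ _ hL]

/-- For a fixed new index `c`, the matrix `mat c v` acting on the `j`-th dual vector is moved, under
the sum over the `j`-th index, in front of the `j`-th matrix. This is the action of the partition
with the largest letter inserted before `j`. The two hypotheses on `T` guarantee that no nonzero
term is lost on either side. -/
theorem sum_sum_insertBefore {M : GlMod.{u, w₁} k A n} (m : M.carrier)
    (v : Fin (d + 1) → V.carrier) (p : Fin (d + 1) → ZMod 2) (hv : ∀ j, IsHomog k (p j) (v j))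
    (T : Finset I)
    (h0 : ∀ L ∈ goodLists d, ∀ b : Fin d → I,
      listAct M (fun j => K.mat (b j) (v j.castSucc)) L m ≠ 0 → ∀ x, b x ∈ T)
    (h1 : ∀ L ∈ goodLists (d + 1), ∀ b : Fin (d + 1) → I,
      listAct M (fun j => K.mat (b j) (v j)) L m ≠ 0 → ∀ x, b x ∈ T)
    {L : List (List (Fin d))} (hL : IsGood L) (j : Fin d) (c : T) :
    ∑ b : Fin d → T,
      sgn (signParity (fun j => p j.castSucc) (fun i => K.par (b i)) L +
        K.par c * p (Fin.last d) +
        (K.par c + p (Fin.last d)) * ∑ l : Fin d, if l < j then K.par (b l) else 0) •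
      tm M _ (listAct M (fun i => K.mat (b i) (v i.castSucc)) L m)
        (smul₂ V d (rsprod V d (Function.update (fun i => K.dual (b i)) j
          (V.act (K.mat c (v (Fin.last d))) (K.dual (b j))))) (K.dual c)) =
    ∑ b : Fin d → T,
      K.term M m v p (Fin.snoc (α := fun _ => I) (fun i => (b i : I)) (c : I)) (insertBefore j L) := by
  classical
  set X := K.mat c (v (Fin.last d)) with hX
  have hXh : IsHomog k (K.par c + p (Fin.last d)) X := K.mat_homog _ _ _ (hv _)
  have hLmem := mem_goodLists.2 hL
  have hLmem' := mem_goodLists.2 (isGood_insertBefore (j := j).2 hL)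
  -- All indices but the `j`-th are now frozen; action and reversed product are linear in their
  -- `j`-th entries.
  refine sum_pi_congr_update j _ _ fun b => ?_
  obtain ⟨f, hf⟩ := listAct_update M (fun i => K.mat (b i) (v i.castSucc)) hL.nodup (hL.mem j) m
  obtain ⟨f', hf'⟩ := rsprod_update V d (fun i => K.dual (b i)) j
  have e1 : ∀ e : T, (fun i => K.mat (Function.update b j e i : T) (v i.castSucc)) =
      Function.update (fun i => K.mat (b i) (v i.castSucc)) j (K.mat e (v j.castSucc)) := by
    intro e
    funext i
    by_cases h : i = j
    · subst h; simp
    · simp [h]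
  have e2 : ∀ (e : T) (Y : Matrix (Fin n) (Fin n) A),
      Function.update (fun i => K.mat (Function.update b j e i : T) (v i.castSucc)) j Y =
      Function.update (fun i => K.mat (b i) (v i.castSucc)) j Y := by
    intro e Y
    rw [e1, Function.update_idem]
  have e3 : ∀ e : T, (fun i => K.dual (Function.update b j e i : T)) =
      Function.update (fun i => K.dual (b i)) j (K.dual e) := by
    intro e
    funext i
    by_cases h : i = j
    · subst h; simp
    · simp [h]
  have e4 : ∀ e : T, (fun i => K.par (Function.update b j e i : T)) =
      Function.update (fun i => K.par (b i)) j (K.par e) := by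
    intro e
    funext i
    by_cases h : i = j
    · subst h; simp
    · simp [h]
  have e5 : ∀ e : T, (∑ l : Fin d, if l < j then K.par (Function.update b j e l : T) else 0) =
      ∑ l : Fin d, if l < j then K.par (b l) else 0 := by
    intro e
    refine Finset.sum_congr rfl fun l _ => ?_
    by_cases h : l < j
    · simp [h, h.ne]
    · simp [h]
  -- The weight is the whole sign as a function of the parity of the `j`-th index; the sum over `l <
  -- j` does not involve that index.
  have hB := K.sum_act_dual ((tmₗ M (symPow V (d + 1))).compl₁₂ f
      ((smul₂ V d).flip (K.dual c) ∘ₗ f'))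
    (fun r => sgn (signParity (fun j => p j.castSucc)
      (Function.update (fun i => K.par (b i)) j r) L + K.par c * p (Fin.last d) +
        (K.par c + p (Fin.last d)) * ∑ l : Fin d, if l < j then K.par (b l) else 0))
    hXh (v j.castSucc) T ?_ ?_
  · rw [← Finset.sum_coe_sort T, ← Finset.sum_coe_sort T] at hB
    refine Eq.trans (Finset.sum_congr rfl fun e _ => ?_) (hB.trans (Finset.sum_congr rfl fun e _ => ?_))
    · rw [e1, e3, e4, e5, Function.update_idem, Function.update_self, hf, hf']
      rfl
    · rw [← K.mulS_term_insertBefore m v p _ hL j]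
      simp only [Fin.snoc_castSucc, Fin.snoc_last]
      rw [← hX, e2, e3, e4, e5, Function.update_self, Function.update_idem, hf, hf', add_comm (K.par e)]
      rfl
  · intro a ha
    have : f (K.mat a (v j.castSucc)) = 0 := by
      by_contra h
      rw [← hf] at h
      refine ha ?_
      have h2 : (Function.update (fun i => K.mat (b i) (v i.castSucc)) j (K.mat a (v j.castSucc))) =
          fun i => K.mat (Function.update (fun i => (b i : I)) j a i) (v i.castSucc) := by
        funext i
        by_cases h : i = j
        · subst h; simp
        · simp [h]
      rw [h2] at h
      have := h0 L hLmem _ h j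
      simpa using this
    ext
    simp [this]
  · intro a ha
    have : f (X * K.mat a (v j.castSucc)) = 0 := by
      by_contra h
      rw [← hf] at h
      refine ha ?_
      -- The action with `X * mat a _` at `j` is itself a term for `d + 1` letters, with last index
      -- `c`, so that the bound for `d + 1` letters applies to it.
      have h2 := listAct_insertBefore M (fun i => K.mat (Fin.snoc (α := fun _ => I)
        (Function.update (fun i => (b i : I)) j a) (c : I) i) (v i)) j L m
      simp only [Fin.snoc_castSucc, Fin.snoc_last, Function.update_self] at h2
      have h3 : (Function.update (fun i : Fin d => K.mat (Function.update (fun i => (b i : I)) j a i)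
          (v i.castSucc)) j (X * K.mat a (v j.castSucc))) =
          Function.update (fun i => K.mat (b i) (v i.castSucc)) j (X * K.mat a (v j.castSucc)) := by
        funext i
        by_cases h : i = j
        · subst h; simp
        · simp [h]
      rw [← hX, h3] at h2
      rw [← h2] at h
      have := h1 _ hLmem' _ h j.castSucc
      simpa using this
    ext
    simp [this]

variable {K}

/-- The formula over a finite index set, by induction on the number of letters. It is asserted for
all larger sets, because each step enlarges the set of the previous one. -/
theorem dmap_tprod {M : GlMod.{u, w₁} k A n} (hM : K.Good M) (m : M.carrier) :
    ∀ (d : ℕ) (v : Fin d → V.carrier) (p : Fin d → ZMod 2) (_ : ∀ j, IsHomog k (p j) (v j)),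
      ∃ T : Finset I, ∀ T', T ⊆ T' → dmap hM d (tm M _ m (tprod V d v)) =
        ∑ b : Fin d → T', ∑ L ∈ goodLists d, K.term M m v p (fun j => (b j : I)) L := by
  classical
  intro d
  induction d with
  | zero =>
    intro v p _
    refine ⟨∅, fun T' _ => ?_⟩
    rw [goodLists_zero]
    simp only [Finset.univ_unique, Finset.sum_singleton]
    have : signParity p (fun j => K.par ((default : Fin 0 → T') j)) [] = 0 := rfl
    rw [term, this, sgn_zero, one_smul, dmap_zero, toSym_tprod]
    rfl
  | succ d ih =>
    intro v p hv
    obtain ⟨T₁, hT₁⟩ := ih (fun j => v j.castSucc) (fun j => p j.castSucc) fun j => hv _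
    obtain ⟨T₂, hT₂⟩ := (good_tensor hM (good_symPow (K := K) d)).exists_finset
      (dmap hM d (tm M _ m (tprod V d fun j => v j.castSucc))) (v (Fin.last d))
    obtain ⟨T₃, hT₃⟩ := exists_finset_goodLists hM m fun j : Fin d => v j.castSucc
    obtain ⟨T₄, hT₄⟩ := exists_finset_goodLists hM m v
    refine ⟨T₁ ∪ T₂ ∪ T₃ ∪ T₄, fun T hT => ?_⟩
    replace hT₁ := hT₁ T (by grind)
    replace hT₂ := hT₂ T (by grind)
    replace hT₃ : ∀ L ∈ goodLists d, ∀ b : Fin d → I,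
      listAct M (fun j => K.mat (b j) (v j.castSucc)) L m ≠ 0 → ∀ x, b x ∈ T :=
        fun L hL b hb x => hT (by have := hT₃ L hL b hb x; grind)
    replace hT₄ : ∀ L ∈ goodLists (d + 1), ∀ b : Fin (d + 1) → I,
      listAct M (fun j => K.mat (b j) (v j)) L m ≠ 0 → ∀ x, b x ∈ T :=
        fun L hL b hb x => hT (by have := hT₄ L hL b hb x; grind)
    -- The new Casimir map contributes the last entry `c` of the index tuple, which is split off
    -- from the first `d` entries.
    rw [tprod_succ, dmap_tsnoc, omega_tm _ _ (hv _) T hT₂, ← Finset.sum_coe_sort T, map_sum,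
      ← (Fin.snocEquiv fun _ => { x // x ∈ T }).sum_comp, Fintype.sum_prod_type]
    refine Finset.sum_congr rfl fun c _ => ?_
    have hsnoc : ∀ b : Fin d → T, (fun j => ((Fin.snocEquiv fun _ => { x // x ∈ T }) (c, b) j : I)) =
        Fin.snoc (α := fun _ => I) (fun i => (b i : I)) (c : I) := by
      intro b
      funext j
      induction j using Fin.lastCases with
      | last => simp
      | cast j => simp
    simp only [hsnoc, sum_goodLists_succ, Finset.sum_add_distrib]
    -- The sum over `b` is brought innermost, since invariance holds only after summation and not
    -- for a single `b`.
    have hins : ∑ b : Fin d → T, ∑ L ∈ goodLists d, ∑ j, K.term M m v p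
          (Fin.snoc (α := fun _ => I) (fun i => (b i : I)) (c : I)) (insertBefore j L) =
        ∑ L ∈ goodLists d, ∑ j, ∑ b : Fin d → T, K.term M m v p
          (Fin.snoc (α := fun _ => I) (fun i => (b i : I)) (c : I)) (insertBefore j L) := by
      rw [Finset.sum_comm]
      exact Finset.sum_congr rfl fun L _ => Finset.sum_comm
    rw [hins, Finset.sum_congr rfl fun L hL => Finset.sum_congr rfl fun j _ =>
      (K.sum_sum_insertBefore m v p hv T hT₃ hT₄ (mem_goodLists.1 hL) j c).symm]
    have hins' := fun F : (L : List (List (Fin d))) → Fin d → (Fin d → T) →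
        (tensor M (symPow V (d + 1))).carrier =>
      (Finset.sum_congr rfl fun L (_ : L ∈ goodLists d) =>
        (Finset.sum_comm (s := Finset.univ) (t := Finset.univ) (f := F L))).trans
        (Finset.sum_comm (s := goodLists d) (t := Finset.univ)
          (f := fun L b => ∑ j, F L j b))
    rw [hins', ← Finset.sum_add_distrib, hT₁]
    simp only [map_sum, tm_sum_left, Finset.smul_sum, ← Finset.sum_add_distrib]
    refine Finset.sum_congr rfl fun b _ => Finset.sum_congr rfl fun L hL => ?_
    have hX := K.mat_homog c _ _ (hv (Fin.last d))
    have hw : ∀ j, IsHomog k (K.par (b j)) (K.dual (b j)) := fun j => K.dual_homog _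
    have happ := K.mulS_term_appendLast m v p
      (Fin.snoc (α := fun _ => I) (fun i => (b i : I)) (c : I)) L
    simp only [Fin.snoc_castSucc, Fin.snoc_last] at happ
    -- The Leibniz rule on `M ⊗ S^d V`: the part on `M` is the appended block, and the parts on the
    -- dual vectors are the insertions. After this only signs differ.
    rw [← happ, term, map_zsmul, map_zsmul, tm_act _ _ hX _ (rsprod_homog d _ _ hw), rsprod_act V d _ _ hw hX]
    simp only [tm_zsmul_left, tm_add_left, map_zsmul, map_add, mulS_tm, tm_zsmul_right,
      tm_sum_right, tm_sum_left, map_sum, smul_add,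
      Finset.smul_sum, sgn_smul_smul]
    congr 1
    · congr 2
      ring
    · refine Finset.sum_congr rfl fun j _ => ?_
      congr 2
      ring

theorem casimir_sprod {M : GlMod.{u, w₁} k A n} (hM : K.Good M) (m : M.carrier)
    (v : Fin d → V.carrier) (p : Fin d → ZMod 2) (hv : ∀ j, IsHomog k (p j) (v j)) :
    casimir hM d (tm M _ m (sprod V d v)) =
      ∑ᶠ b : Fin d → I, ∑ L ∈ goodLists d, K.term M m v p b L := by
  classical
  obtain ⟨T₁, hT₁⟩ := dmap_tprod hM m d v p hv
  obtain ⟨T₂, hT₂⟩ := exists_finset_goodLists hM m v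
  rw [sum_pi_subtype (T₁ ∪ T₂)]
  · exact hT₁ _ Finset.subset_union_left
  · intro b hb j
    obtain ⟨L, hL, h⟩ := Finset.exists_ne_zero_of_sum_ne_zero hb
    refine Finset.mem_union_right _ (hT₂ L hL b (fun h0 => h ?_) j)
    rw [term, h0, tm_zero_left, smul_zero]

end Formula

end CasimirPair

end GlMod

end ThickCasimir

namespace ThickCasimir

/-! ### Dual bases of a Frobenius superalgebra. -/

section Frobenius

variable {k : Type u} [CommRing k] {A : Type v} [NonUnitalRing A] [Module k A]
  [IsScalarTower k A A] [SMulCommClass k A A] {ι : Type w} [Superalgebra k A] {e : ι → A}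
  {β : Type w₁}

theorem FrobeniusStructure.phi_injective (F : FrobeniusStructure k e) :
    Function.Injective (phi k F.tr) := fun _ _ h => F.phi_bij.1 (Subtype.ext h)

theorem HomogBasis.coord_homog (B : HomogBasis k e β) {s : ZMod 2} {x : A} (hx : IsHomog k s x)
    {b : β} (h : B.basis.coord b x ≠ 0) : B.par b = s := by
  by_contra hne
  have key : B.basis.coord b ∘ₗ proj k s = 0 := by
    refine B.basis.ext fun c => ?_
    rw [LinearMap.comp_apply, (B.homog c).proj_eq, LinearMap.zero_apply]
    split_ifs with hc
    · have hcb : c ≠ b := by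
        rintro rfl
        exact hne hc.symm
      simp [hcb]
    · exact map_zero _
  refine h ?_
  have h1 := LinearMap.congr_fun key x
  have h2 : proj k s x = x := hx
  rwa [LinearMap.comp_apply, h2] at h1

theorem HomogBasis.src_eq_of_coord_ne_zero (he : LocallyUnital k e) (B : HomogBasis k e β) {b : β}
    {i : ι} {x : A} (hx : x * e i = x) (h : B.basis.coord b x ≠ 0) : B.src b = i := by
  by_contra hne
  have key : B.basis.coord b ∘ₗ LinearMap.mulRight k (e i) = 0 := by
    refine B.basis.ext fun c => ?_
    have hc : B.basis c * e (B.src c) = B.basis c := (B.mem_peirce c).2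
    rw [LinearMap.comp_apply, LinearMap.mulRight_apply, LinearMap.zero_apply]
    by_cases hi : B.src c = i
    · have hcb : c ≠ b := by
        rintro rfl
        exact hne hi
      rw [← hi, hc]
      simp [hcb]
    · rw [← hc, mul_assoc, he.orth _ _ hi, mul_zero, map_zero]
  have h1 := LinearMap.congr_fun key x
  rw [LinearMap.comp_apply, LinearMap.mulRight_apply, hx] at h1
  exact h h1

theorem HomogBasis.finite_tgt (B : HomogBasis k e β) (i : ι) {J : Set ι} (hJ : J.Finite) :
    {b : {b : β // B.src b = i} | B.tgt b.1 ∈ J}.Finite := by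
  refine Set.Finite.of_finite_image (f := Subtype.val) ?_ Subtype.val_injective.injOn
  refine (hJ.biUnion fun j _ => B.finite j i).subset ?_
  rintro _ ⟨b, hb, rfl⟩
  exact Set.mem_biUnion hb ⟨rfl, b.2⟩

theorem HomogBasis.sum_coord_smul (he : LocallyUnital k e) (B : HomogBasis k e β) {i : ι} {x : A}
    (hx : x * e i = x) (T : Finset {b : β // B.src b = i})
    (hT : ∀ b : {b : β // B.src b = i}, B.basis.coord b.1 x ≠ 0 → b ∈ T) :
    ∑ b ∈ T, B.basis.coord b.1 x • B.basis b.1 = x := by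
  classical
  have h := B.basis.linearCombination_repr x
  have hsub : (B.basis.repr x).support ⊆ T.image Subtype.val := by
    intro b hb
    have hb' : B.basis.coord b x ≠ 0 := Finsupp.mem_support_iff.1 hb
    exact Finset.mem_image.2
      ⟨⟨b, B.src_eq_of_coord_ne_zero he hx hb'⟩, hT ⟨b, _⟩ hb', rfl⟩
  rw [Finsupp.linearCombination_apply, Finsupp.sum_of_support_subset _ hsub _
    (fun b _ => zero_smul k (B.basis b)), Finset.sum_image fun _ _ _ _ h => Subtype.ext h] at h
  exact h

theorem FrobeniusStructure.phi_dualVec_mul (F : FrobeniusStructure k e) (he : LocallyUnital k e)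
    (B : HomogBasis k e β) (b : β) (x y : A) :
    phi k F.tr (F.dualVec he B b * x) y = B.basis.coord b (x * y) := by
  rw [← F.phi_dualVec he B b]
  exact congrArg F.tr (mul_assoc _ _ _)

/-- The trace is even, so a component of `b^∨` pairs to zero with basis elements of a different
parity. The component of parity other than `par b` therefore pairs to zero with the whole basis, and
nondegeneracy makes it vanish. -/
theorem FrobeniusStructure.dualVec_homog (F : FrobeniusStructure k e) (he : LocallyUnital k e)
    (B : HomogBasis k e β) (b : β) : IsHomog k (B.par b) (F.dualVec he B b) := by
  refine isHomog_of_proj_zero fun t ht => F.phi_injective ?_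
  rw [map_zero]
  have tr_homog : ∀ s (a : A), s ≠ 0 → IsHomog k s a → F.tr a = 0 := by
    intro s a hs ha
    rcases parity_cases s with rfl | rfl
    · exact absurd rfl hs
    · exact F.tr_even a ha
  refine B.basis.ext fun c => ?_
  have hmul : ∀ s, F.tr (proj k s (F.dualVec he B b) * B.basis c) =
      if s = B.par c then B.basis.coord b (B.basis c) else 0 := by
    have h0 : ∀ s, s ≠ B.par c → F.tr (proj k s (F.dualVec he B b) * B.basis c) = 0 := by
      intro s hs
      refine tr_homog (s + B.par c) _ (fun h => hs ?_)
        (Superalgebra.mul_homog _ _ _ _ (isHomog_proj _ _) (B.homog c))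
      linear_combination h - zmod_two_add_self (B.par c)
    intro s
    split_ifs with hs
    · have h1 : F.tr (F.dualVec he B b * B.basis c) = B.basis.coord b (B.basis c) :=
        LinearMap.congr_fun (F.phi_dualVec he B b) _
      rw [← h1]
      conv_rhs => rw [← proj_add_proj (k := k) (F.dualVec he B b), add_mul, map_add]
      rcases parity_cases s with rfl | rfl
      · rw [h0 1 (by rw [← hs]; decide), add_zero]
      · rw [h0 0 (by rw [← hs]; decide), zero_add]
    · exact h0 s hs
  refine (hmul t).trans ?_
  split_ifs with htc
  · have hcb : c ≠ b := by
      rintro rfl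
      exact ht htc
    simp [hcb]
  · rfl

/-- The functional `y ↦ coord_b(x y)` is the image of `b^∨ x` under `phi`, so it lies in the local
dual and vanishes on all but finitely many Peirce components; each of these contains only finitely
many basis elements. -/
theorem FrobeniusStructure.finite_coord_mul (F : FrobeniusStructure k e) (he : LocallyUnital k e)
    (B : HomogBasis k e β) (b : β) (x : A) : {c | B.basis.coord b (x * B.basis c) ≠ 0}.Finite := by
  have h : {p : ι × ι | ∃ a ∈ peirce k e p.1 p.2, phi k F.tr (F.dualVec he B b * x) a ≠ 0}.Finite :=
    F.phi_mem _
  refine (h.biUnion fun p _ => B.finite p.1 p.2).subset fun c hc => ?_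
  refine Set.mem_biUnion (x := (B.tgt c, B.src c)) ⟨B.basis c, B.mem_peirce c, ?_⟩ ⟨rfl, rfl⟩
  rw [F.phi_dualVec_mul]
  exact hc

/-- Both sides pair with a basis element `c` to `coord_b(x c)`. The coefficients are those expanding
the products `x c` in the basis, which is the source of the invariance of the Casimir element. -/
theorem FrobeniusStructure.sum_coord_smul_dualVec (F : FrobeniusStructure k e)
    (he : LocallyUnital k e) (B : HomogBasis k e β) {i : ι} {b : β} (hb : B.src b = i) (x : A)
    (T : Finset {b : β // B.src b = i})
    (hT : ∀ c : {b : β // B.src b = i}, B.basis.coord b (x * B.basis c.1) ≠ 0 → c ∈ T) :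
    ∑ c ∈ T, B.basis.coord b (x * B.basis c.1) • F.dualVec he B c.1 = F.dualVec he B b * x := by
  classical
  refine F.phi_injective (B.basis.ext fun c => ?_)
  rw [F.phi_dualVec_mul, map_sum, LinearMap.sum_apply]
  simp only [map_smul, F.phi_dualVec, LinearMap.smul_apply, smul_eq_mul]
  by_cases hc : B.src c = i
  · by_cases hcT : (⟨c, hc⟩ : {b : β // B.src b = i}) ∈ T
    · rw [Finset.sum_eq_single_of_mem _ hcT]
      · simp
      · intro c' _ hne
        have : c ≠ c'.1 := fun h => hne (Subtype.ext h.symm)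
        simp [this]
    · have h0 : B.basis.coord b (x * B.basis c) = 0 := by
        by_contra h
        exact hcT (hT ⟨c, hc⟩ h)
      rw [h0]
      refine Finset.sum_eq_zero fun c' hc' => ?_
      have : c ≠ c'.1 := by
        rintro rfl
        exact hcT hc'
      simp [this]
  -- Right multiplication by idempotents is respected by the basis: `x c` has the source of `c`,
  -- which differs from that of `b`.
  · have h0 : B.basis.coord b (x * B.basis c) = 0 := by
      by_contra h
      refine hc ((B.src_eq_of_coord_ne_zero he ?_ h).symm.trans hb)
      have h2 : B.basis c * e (B.src c) = B.basis c := (B.mem_peirce c).2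
      rw [mul_assoc, h2]
    rw [h0]
    refine Finset.sum_eq_zero fun c' _ => ?_
    have : c ≠ c'.1 := by
      rintro rfl
      exact hc c'.2
    simp [this]

end Frobenius

/-! ### The Casimir pair of the row vectors. -/

section Rows

variable {k : Type u} [CommRing k] {A : Type u} [NonUnitalRing A] [Module k A]
  [IsScalarTower k A A] [SMulCommClass k A A] [Superalgebra k A] {n : ℕ} {ι : Type v} {e : ι → A}
  {β : Type w₁}

theorem isHomog_matrix {s : ZMod 2} {x : Matrix (Fin n) (Fin n) A} :
    IsHomog k s x ↔ ∀ p q, IsHomog k s (x p q) := by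
  unfold IsHomog
  rw [← Matrix.ext_iff]
  simp only [proj_matrix]

theorem FrobeniusStructure.finite_coord_row (F : FrobeniusStructure k e) (he : LocallyUnital k e)
    {i : ι} (B : HomogBasis k e β) (X : Matrix (Fin n) (Fin n) A) (a : Fin n × B.Src i) :
    {a' : Fin n × B.Src i | B.basis.coord a.2.1 (X a.1 a'.1 * B.basis a'.2.1) ≠ 0}.Finite := by
  have h : ∀ q : Fin n, {c : B.Src i | B.basis.coord a.2.1 (X a.1 q * B.basis c.1) ≠ 0}.Finite := by
    intro q
    refine Set.Finite.of_finite_image (f := Subtype.val) ?_ Subtype.val_injective.injOn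
    refine (F.finite_coord_mul he B a.2.1 (X a.1 q)).subset ?_
    rintro _ ⟨c, hc, rfl⟩
    exact hc
  refine (Set.finite_univ.prod (Set.finite_iUnion h)).subset fun a' ha' => ⟨trivial, ?_⟩
  exact Set.mem_iUnion.2 ⟨a'.1, ha'⟩

variable (he : LocallyUnital k e) (n) (i : ι)

/-- The coordinates of a row vector. -/
def entry (t : Fin n) : (GlMod.V he n i).carrier →ₗ[k] A :=
  LinearMap.proj t ∘ₗ (rowVec k n e i).subtype

variable {n i}

theorem entry_ext {v v' : (GlMod.V he n i).carrier} (h : ∀ t, entry n he i t v = entry n he i t v') :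
    v = v' := Subtype.ext (funext h)

theorem entry_mem (t : Fin n) (v : (GlMod.V he n i).carrier) :
    entry n he i t v ∈ rightIdeal k e i := v.2 t

theorem entry_act (t : Fin n) (x : Matrix (Fin n) (Fin n) A) (v : (GlMod.V he n i).carrier) :
    entry n he i t ((GlMod.V he n i).act x v) = ∑ s, entry n he i s v * x s t := rfl

theorem entry_rowSingle (s t : Fin n) (a : rightIdeal k e i) :
    entry n he i s (rowSingle he t a) = if s = t then (a : A) else 0 := by
  change (Pi.single t (a : A) : Fin n → A) s = _
  rw [Pi.single_apply]

theorem entry_proj (t : Fin n) (s : ZMod 2) (v : (GlMod.V he n i).carrier) :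
    entry n he i t (proj k s v) = proj k s (entry n he i t v) := by
  unfold proj
  split_ifs
  · rfl
  · rfl

theorem isHomog_row {s : ZMod 2} {v : (GlMod.V he n i).carrier} :
    IsHomog k s v ↔ ∀ t, IsHomog k s (entry n he i t v) := by
  unfold IsHomog
  simp only [← entry_proj]
  exact ⟨fun h t => by rw [h], fun h => entry_ext he h⟩

theorem rowSingle_homog {s : ZMod 2} (t : Fin n) {a : rightIdeal k e i} (ha : IsHomog k s (a : A)) :
    IsHomog k s (rowSingle he t a) := by
  rw [isHomog_row]
  intro q
  rw [entry_rowSingle]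
  split_ifs
  · exact ha
  · exact isHomog_zero s

theorem span_rowSingle_homog :
    Submodule.span k {v : (GlMod.V he n i).carrier | ∃ (t : Fin n) (a : rightIdeal k e i)
      (s : ZMod 2), IsHomog k s (a : A) ∧ rowSingle he t a = v} = ⊤ := by
  rw [eq_top_iff]
  intro v _
  have hv : v = ∑ t, ∑ s : ZMod 2, rowSingle he t
      ⟨proj k s (entry n he i t v), proj_rightIdeal he s (entry_mem he t v)⟩ := by
    refine entry_ext he fun q => ?_
    simp only [map_sum, entry_rowSingle]
    rw [Finset.sum_eq_single_of_mem q (Finset.mem_univ q)]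
    · simp only [if_true]
      rw [sum_parity, proj_add_proj]
    · intro t _ ht
      simp [ht.symm]
  rw [hv]
  exact Submodule.sum_mem _ fun t _ => Submodule.sum_mem _ fun s _ =>
    Submodule.subset_span ⟨t, _, s, isHomog_proj _ _, rfl⟩

variable (B : HomogBasis k e β)

/-- The matrix `∑ₜ E_{r,t}^{b vₜ}`. -/
def rowMat (r : Fin n) (b : A) : (GlMod.V he n i).carrier →ₗ[k] Matrix (Fin n) (Fin n) A :=
  LinearMap.pi fun p => LinearMap.pi fun q =>
    if p = r then LinearMap.mulLeft k b ∘ₗ entry n he i q else 0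

theorem rowMat_apply (r : Fin n) (b : A) (v : (GlMod.V he n i).carrier) (p q : Fin n) :
    rowMat he r b v p q = if p = r then b * entry n he i q v else 0 := by
  change (if p = r then LinearMap.mulLeft k b ∘ₗ entry n he i q else 0 :
    (GlMod.V he n i).carrier →ₗ[k] A) v = _
  split_ifs <;> rfl

theorem rowMat_rowSingle (r t : Fin n) (b : A) (a : rightIdeal k e i) :
    rowMat he r b (rowSingle he t a) = Matrix.single r t (b * (a : A)) := by
  ext p q
  rw [rowMat_apply, entry_rowSingle, Matrix.single_apply]
  simp only [eq_comm (a := r), eq_comm (a := t)]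
  by_cases hp : p = r <;> by_cases hq : q = t <;> simp [hp, hq]

theorem rowMat_eq_sum (r : Fin n) (b : A) (v : (GlMod.V he n i).carrier) :
    rowMat he r b v = ∑ t, Matrix.single r t (b * entry n he i t v) := by
  ext p q
  rw [rowMat_apply, Matrix.sum_apply]
  simp only [Matrix.single_apply]
  by_cases hp : p = r
  · simp [hp]
  · simp [hp, Ne.symm hp]

theorem rowMat_homog {s t : ZMod 2} (r : Fin n) {b : A} (hb : IsHomog k s b)
    {v : (GlMod.V he n i).carrier} (hv : IsHomog k t v) : IsHomog k (s + t) (rowMat he r b v) := by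
  rw [isHomog_matrix]
  intro p q
  rw [rowMat_apply]
  split_ifs
  · exact Superalgebra.mul_homog _ _ _ _ hb ((isHomog_row he).1 hv q)
  · exact isHomog_zero _

theorem rowMat_mul (r : Fin n) (b : A) (v : (GlMod.V he n i).carrier)
    (X : Matrix (Fin n) (Fin n) A) :
    rowMat he r b v * X = rowMat he r b ((GlMod.V he n i).act X v) := by
  ext p q
  rw [Matrix.mul_apply]
  simp only [rowMat_apply, entry_act]
  split_ifs
  · rw [Finset.mul_sum]
    exact Finset.sum_congr rfl fun s _ => mul_assoc _ _ _
  · simp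

theorem entry_act_rowMat (r q : Fin n) (b : A) (v w : (GlMod.V he n i).carrier) :
    entry n he i q ((GlMod.V he n i).act (rowMat he r b v) w) =
      entry n he i r w * b * entry n he i q v := by
  rw [entry_act, Finset.sum_eq_single_of_mem r (Finset.mem_univ r)]
  · rw [rowMat_apply, if_pos rfl, mul_assoc]
  · intro s _ hs
    rw [rowMat_apply, if_neg hs, mul_zero]

/-- The product involves `w_r b`, and `w_r e_j` is nonzero for only finitely many `j`; finitely many
basis elements have such a target and source `i`. -/
theorem HomogBasis.finite_act_rowMat (v w : (GlMod.V he n i).carrier) :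
    {a : Fin n × B.Src i |
      (GlMod.V he n i).act (rowMat he a.1 (B.basis a.2.1) v) w ≠ 0}.Finite := by
  have hJ : {j | ∃ r, entry n he i r w * e j ≠ 0}.Finite := by
    have := Set.finite_iUnion fun r => finite_mul_e he (entry n he i r w)
    refine this.subset fun j hj => ?_
    obtain ⟨r, hr⟩ := hj
    exact Set.mem_iUnion.2 ⟨r, hr⟩
  refine (Set.finite_univ.prod (B.finite_tgt i hJ)).subset fun a ha => ⟨trivial, ?_⟩
  by_contra h
  refine ha (entry_ext he fun q => ?_)
  have h0 : entry n he i a.1 w * e (B.tgt a.2.1) = 0 := by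
    by_contra h'
    exact h ⟨a.1, h'⟩
  have h1 : e (B.tgt a.2.1) * B.basis a.2.1 = B.basis a.2.1 := (B.mem_peirce a.2.1).1
  rw [entry_act_rowMat, ← h1, ← mul_assoc, h0, zero_mul, zero_mul, map_zero]

/-- Expand each product `X_{r,r'} b'` in the basis; since `b'` has source `i`, only basis elements
of source `i` occur. The coefficients match those of `act_rowSingle_dual`, with the roles of rows
and columns exchanged. -/
theorem HomogBasis.mul_rowMat (X : Matrix (Fin n) (Fin n) A) (a' : Fin n × B.Src i)
    (v : (GlMod.V he n i).carrier) (T : Finset (B.Src i))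
    (hT : ∀ r (b : B.Src i), B.basis.coord b.1 (X r a'.1 * B.basis a'.2.1) ≠ 0 → b ∈ T) :
    X * rowMat he a'.1 (B.basis a'.2.1) v =
      ∑ᶠ a : Fin n × B.Src i, B.basis.coord a.2.1 (X a.1 a'.1 * B.basis a'.2.1) •
        rowMat he a.1 (B.basis a.2.1) v := by
  rw [finsum_eq_sum_of_support_subset (s := Finset.univ ×ˢ T), Finset.sum_product]
  · ext p q
    have h1 : B.basis a'.2.1 * e i = B.basis a'.2.1 := by
      have h2 : B.basis a'.2.1 * e (B.src a'.2.1) = B.basis a'.2.1 := (B.mem_peirce a'.2.1).2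
      rwa [a'.2.2] at h2
    simp only [Matrix.mul_apply, Matrix.sum_apply, Matrix.smul_apply, rowMat_apply]
    rw [Finset.sum_eq_single_of_mem a'.1 (Finset.mem_univ _) (fun s _ hs => by simp [hs]),
      Finset.sum_eq_single_of_mem p (Finset.mem_univ _) (fun s _ hs => by simp [hs.symm])]
    simp only [if_true]
    rw [← mul_assoc]
    conv_lhs => rw [← B.sum_coord_smul he (i := i) (x := X p a'.1 * B.basis a'.2.1)
      (by rw [mul_assoc, h1]) T (hT p)]
    rw [Finset.sum_mul]
    exact Finset.sum_congr rfl fun b _ => smul_mul_assoc _ _ _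
  · intro a ha
    rw [Finset.mem_coe, Finset.mem_product]
    refine ⟨Finset.mem_univ _, hT a.1 a.2 fun h => ha ?_⟩
    simp only [h, zero_smul]

variable (F : FrobeniusStructure k e)

theorem FrobeniusStructure.act_rowSingle_dual (X : Matrix (Fin n) (Fin n) A) (a : Fin n × B.Src i)
    (T : Finset (B.Src i))
    (hT : ∀ q (c : B.Src i), B.basis.coord a.2.1 (X a.1 q * B.basis c.1) ≠ 0 → c ∈ T) :
    (GlMod.V he n i).act X (rowSingle he a.1 (dualIn F he B a.2)) =
      ∑ᶠ a' : Fin n × B.Src i, B.basis.coord a.2.1 (X a.1 a'.1 * B.basis a'.2.1) •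
        rowSingle he a'.1 (dualIn F he B a'.2) := by
  rw [finsum_eq_sum_of_support_subset (s := Finset.univ ×ˢ T), Finset.sum_product]
  · refine entry_ext he fun q => ?_
    simp only [entry_act, entry_rowSingle, map_sum, map_smul]
    rw [Finset.sum_eq_single_of_mem a.1 (Finset.mem_univ _) (fun s _ hs => by simp [hs]),
      Finset.sum_eq_single_of_mem q (Finset.mem_univ _) (fun s _ hs => by simp [hs.symm])]
    simp only [if_true]
    exact (F.sum_coord_smul_dualVec he B a.2.2 (X a.1 q) T (hT q)).symm
  · intro a' ha'
    rw [Finset.mem_coe, Finset.mem_product]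
    refine ⟨Finset.mem_univ _, hT a'.1 a'.2 fun h => ha' ?_⟩
    simp only [h, zero_smul]

theorem HomogBasis.finite_coord_col (X : Matrix (Fin n) (Fin n) A) (a' : Fin n × B.Src i) :
    {a : Fin n × B.Src i | B.basis.coord a.2.1 (X a.1 a'.1 * B.basis a'.2.1) ≠ 0}.Finite := by
  have h : ∀ r : Fin n, {b : B.Src i | B.basis.coord b.1 (X r a'.1 * B.basis a'.2.1) ≠ 0}.Finite := by
    intro r
    refine Set.Finite.of_finite_image (f := Subtype.val) ?_ Subtype.val_injective.injOn
    refine (B.basis.repr (X r a'.1 * B.basis a'.2.1)).support.finite_toSet.subset ?_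
    rintro _ ⟨b, hb, rfl⟩
    exact Finsupp.mem_support_iff.2 hb
  refine (Set.finite_univ.prod (Set.finite_iUnion h)).subset fun a ha => ⟨trivial, ?_⟩
  exact Set.mem_iUnion.2 ⟨a.1, ha⟩

/-- The matrices `rowMat r b` and the row vectors `v_r^{b^∨}`, for `b` a basis element in `Ai`. -/
noncomputable def FrobeniusStructure.casimirPair :
    GlMod.CasimirPair (GlMod.V he n i) (Fin n × B.Src i) where
  par a := B.par a.2.1
  dual a := rowSingle he a.1 (dualIn F he B a.2)
  dual_homog a := rowSingle_homog he a.1 (F.dualVec_homog he B a.2.1)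
  mat a := rowMat he a.1 (B.basis a.2.1)
  mat_homog a _ _ hv := rowMat_homog he a.1 (B.homog a.2.1) hv
  mat_mul a v X := rowMat_mul he a.1 _ v X
  finite_act w v := B.finite_act_rowMat he v w
  coef X a a' := B.basis.coord a.2.1 (X a.1 a'.1 * B.basis a'.2.1)
  coef_row X a := F.finite_coord_row he B X a
  coef_col X a' := B.finite_coord_col X a'
  coef_par c X a a' hX h := by
    have := B.coord_homog
      (Superalgebra.mul_homog _ _ _ _ (isHomog_matrix.1 hX a.1 a'.1) (B.homog a'.2.1)) h
    rw [this, add_comm]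
  act_dual X a := by
    classical
    refine F.act_rowSingle_dual he B X a ((F.finite_coord_row he B X a).toFinset.image Prod.snd) ?_
    intro q c hc
    exact Finset.mem_image.2 ⟨(q, c), (Set.Finite.mem_toFinset _).2 hc, rfl⟩
  mul_mat X a' v := by
    classical
    refine B.mul_rowMat he X a' v ((B.finite_coord_col X a').toFinset.image Prod.snd) ?_
    intro r b hb
    exact Finset.mem_image.2 ⟨(r, b), (Set.Finite.mem_toFinset _).2 hb, rfl⟩

/-- The matrix `mat (r, b) v` is a sum of `n` matrix units with entries `b v_t`. The defining
condition of the subcategory leaves finitely many targets of `b`, and local finiteness leaves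
finitely many `b` for each. -/
theorem casimirFinite.good {M : GlMod.{u, w₂} k A n} (hM : casimirFinite k n e i M) :
    (F.casimirPair (n := n) (i := i) he B).Good M := by
  intro m v
  have hJ : {j | ∃ r t, ∃ a ∈ peirce k e j i,
      M.act (Matrix.single r t (a * entry n he i t v)) m ≠ 0}.Finite := by
    have := Set.finite_iUnion fun r => Set.finite_iUnion fun t =>
      hM m (entry n he i t v) (entry_mem he t v) r t
    refine this.subset ?_
    rintro j ⟨r, t, h⟩
    exact Set.mem_iUnion.2 ⟨r, Set.mem_iUnion.2 ⟨t, h⟩⟩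
  refine (Set.finite_univ.prod (B.finite_tgt i hJ)).subset fun a ha => ⟨trivial, ?_⟩
  change M.act (rowMat he a.1 (B.basis a.2.1) v) m ≠ 0 at ha
  rw [rowMat_eq_sum, map_sum, LinearMap.sum_apply] at ha
  obtain ⟨t, -, ht⟩ := Finset.exists_ne_zero_of_sum_ne_zero ha
  refine ⟨a.1, t, B.basis a.2.1, ?_, ht⟩
  have := B.mem_peirce a.2.1
  rwa [a.2.2] at this

end Rows

end ThickCasimir

namespace ThickCasimir

/-! ### The theorem. -/

section Main

variable {k : Type u} [CommRing k] {A : Type u} [NonUnitalRing A] [Module k A]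
  [IsScalarTower k A A] [SMulCommClass k A A] [Superalgebra k A] {n : ℕ} {ι : Type v} {e : ι → A}
  {β : Type w₁} (he : LocallyUnital k e) {i : ι} (B : HomogBasis k e β)
  (F : FrobeniusStructure k e)

theorem casimirFinite_of_finite (h : {j | peirce k e j i ≠ ⊥}.Finite) (M : GlMod.{u, w} k A n) :
    casimirFinite k n e i M := by
  intro m f _ r s
  refine h.subset ?_
  rintro j ⟨a, ha, hne⟩ hbot
  rw [hbot, Submodule.mem_bot] at ha
  refine hne ?_
  rw [ha, zero_mul, Matrix.single_zero, map_zero, LinearMap.zero_apply]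

/-- The Casimir pair is indexed by pairs of a row and a basis element, whereas the formula sums over
the two tuples separately. -/
theorem finsum_pi_prod {d : ℕ} {S : Type w} {T : Type w₂} [Fintype T] {P : Type w₁}
    [AddCommMonoid P] (f : (Fin d → T × S) → P) (hf : (Function.support f).Finite) :
    ∑ᶠ c, f c = ∑ᶠ b : Fin d → S, ∑ r : Fin d → T, f fun j => (r j, b j) := by
  let φ : (Fin d → S) × (Fin d → T) ≃ (Fin d → T × S) :=
    (Equiv.prodComm _ _).trans (Equiv.arrowProdEquivProdArrow (Fin d) (fun _ => T) fun _ => S).symm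
  have h : ((fun x => f (φ x)).support).Finite :=
    hf.preimage φ.injective.injOn
  rw [← finsum_comp_equiv φ, finsum_curry _ h]
  refine finsum_congr fun b => ?_
  rw [finsum_eq_sum_of_fintype]
  rfl

theorem casimir_isThickCasimir {M : GlMod.{u, w₂} k A n} (hM : casimirFinite k n e i M) (d : ℕ) :
    IsThickCasimir F he B i d M (GlMod.CasimirPair.casimir (hM.good he B F) d) := by
  classical
  intro m f p t hf
  have hG := hM.good he B F
  have hact : ∀ (b : Fin d → B.Src i) (r : Fin d → Fin n) (u : OrdPart d),
      partsAct M (fun j => B.basis (b j).1 * (f j : A)) r t u m =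
        GlMod.listAct M (fun j => (F.casimirPair he B).mat (r j, b j) (rowSingle he (t j) (f j)))
          u.parts m := by
    intro b r u
    rw [GlMod.partsAct_eq]
    congr 1
    funext j
    exact (rowMat_rowSingle he (r j) (t j) (B.basis (b j).1) (f j)).symm
  obtain ⟨T, hT⟩ := GlMod.CasimirPair.exists_finset_goodLists hG m fun j => rowSingle he (t j) (f j)
  refine ⟨(Fintype.piFinset fun _ : Fin d => T.image Prod.snd).finite_toSet.subset ?_, ?_⟩
  · rintro b ⟨r, u, hu, h⟩
    rw [hact] at h
    have := hT u.parts (mem_goodLists.2 ((OrdPart.good_iff u).1 hu)) (fun j => (r j, b j)) h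
    exact Fintype.mem_piFinset.2 fun x => Finset.mem_image.2 ⟨_, this x, rfl⟩
  · rw [GlMod.CasimirPair.casimir_sprod hG m _ p fun j => rowSingle_homog he (t j) (hf j),
      finsum_pi_prod]
    · refine finsum_congr fun b => Finset.sum_congr rfl fun r _ => ?_
      rw [sum_goodLists]
      refine Finset.sum_congr rfl fun u _ => ?_
      rw [hact, inversionParity_eq]
      rfl
    · refine (Fintype.piFinset fun _ : Fin d => T).finite_toSet.subset fun c hc => ?_
      obtain ⟨L, hL, h⟩ := Finset.exists_ne_zero_of_sum_ne_zero hc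
      refine Fintype.mem_piFinset.2 (hT L hL c fun h0 => h ?_)
      rw [GlMod.CasimirPair.term, h0, GlMod.tm_zero_left, smul_zero]

/-- The formula prescribes the values on products of homogeneous `v_t^f`, and these span by
`span_rowSingle_homog`. -/
theorem IsThickCasimir.ext {d : ℕ} {M : GlMod.{u, w₂} k A n}
    {C C' : (GlMod.tensor M (GlMod.symPow (GlMod.V he n i) d)).carrier →ₗ[k]
      (GlMod.tensor M (GlMod.symPow (GlMod.V he n i) d)).carrier}
    (h : IsThickCasimir F he B i d M C) (h' : IsThickCasimir F he B i d M C') : C = C' := by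
  refine GlMod.tensor_symPow_hom_ext _ (span_rowSingle_homog he) d fun m v hv => ?_
  choose t f p hf hv using hv
  obtain rfl : (fun j => rowSingle he (t j) (f j)) = v := funext hv
  rw [(h m f p t hf).2, (h' m f p t hf).2]

/-- The thick Casimir maps as a natural transformation. -/
noncomputable def thickCasimir (n d : ℕ) (i : ι) :
    tensorSym.{u, v, w} he n i d ⟶ tensorSym.{u, v, w} he n i d where
  app M := ObjectProperty.homMk ⟨GlMod.CasimirPair.casimir (M.property.good he B F) d,
    GlMod.CasimirPair.casimir_isHom (M.property.good he B F) d⟩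
  -- The morphism may have any parity, or none: it commutes with the right action without a sign,
  -- and the Casimir maps are even, so the supernaturality relation is plain commutation.
  naturality M M' f := by
    refine ObjectProperty.hom_ext _ (GlMod.Hom.ext (LinearMap.ext fun ζ => ?_))
    exact GlMod.CasimirPair.casimir_map (M.property.good he B F) (M'.property.good he B F)
      (GlMod.linOf f.hom) (GlMod.Hom.map_act f.hom) d ζ

end Main

end ThickCasimir

theorem theoremT {k A : Type u} [CommRing k] [IsDomain k] [CharZero k]
    [NonUnitalRing A] [Module k A] [IsScalarTower k A A] [SMulCommClass k A A] [Superalgebra k A]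
    {ι : Type v} (e : ι → A) (he : LocallyUnital k e) (F : FrobeniusStructure k e)
    {β : Type w₁} (B : HomogBasis k e β) (n : ℕ) (hn : 1 ≤ n) (i : ι) (d : ℕ) (hd : 1 ≤ d) :
    ({j | peirce k e j i ≠ ⊥}.Finite →
      ∀ M : GlMod.{u, max w u} k A n, casimirFinite k n e i M) ∧
    ∃ η : tensorSym.{u, v, w} he n i d ⟶ tensorSym.{u, v, w} he n i d,
      (∀ M, GlMod.IsEven (GlMod.linOf (η.app M).hom)) ∧
      ∀ M C, IsThickCasimir F he B i d M.obj C ↔ C = GlMod.linOf (η.app M).hom := by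
  refine ⟨fun h M => casimirFinite_of_finite h M, thickCasimir he B F n d i, fun M => ?_,
    fun M C => ⟨fun h => ?_, ?_⟩⟩
  · exact GlMod.CasimirPair.casimir_even (M.property.good he B F) d
  · exact h.ext he B F (casimir_isThickCasimir he B F M.property d)
  · rintro rfl
    exact casimir_isThickCasimir he B F M.property d
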